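/- **Setting.** Let $m,n\ge 0$, $0\le r\le n$, and let $J=J^1(\mathbb R^m\times\mathbb R^n,\mathbb R)$ have coordinates $(t,q,z,s,p)$ and contact form $\Theta=dz-\sum_i p_i\,dq_i-\sum_i s_i\,dt_i$. Put $I_r=\{1,\dots,r\}$. For $\sigma\subset I_r$ let $$\tilde L^0_\sigma=\{q_\sigma=p_{I_r-\sigma}=q_{r+1}=\cdots=q_n=s=z=0,\ q_{I_r-\sigma}\ge 0\},\qquad \mathbb L=\bigcup_{\sigma\subset I_r}\tilde L^0_\sigma .$$ For an open set $U\ni 0$ of $J$, let $C_T(U)$ be the set of smooth contact embeddings $C:U\to J$ (i.e. $C^*\Theta=\alpha\Theta$ with $\alpha$ nowhere zero) of the form $$C(t,q,z,s,p)=(t,\,q_C(t,q,z,p),\,z_C(t,q,z,p),\,h_C(t,q,z,s,p),\,p_C(t,q,z,p)),$$ where $h_C^i$ depends only on $t,q,z,s_i,p$. Let $C^\Theta_T(U)=\{C\in C_T(U): C^*\Theta=\Theta\}$, and let $C_T^Z(U)$, $C_T^{\Theta,Z}(U)$ be the sets of restrictions to $V=U\cap\{z=0\}$ of elements of $C_T(U)$,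 $C_T^\Theta(U)$. A *reticular Legendrian unfolding* is a map germ $\mathcal L:(\mathbb L,0)\to(J,0)$ that is the restriction to $\mathbb L$ of the germ at $0$ of some $C\in C_T(U)$ with $C(0)=0$. Two reticular Legendrian unfoldings $\mathcal L_1,\mathcal L_2$ are *$\mathcal P$-Legendrian equivalent* if $K\circ\mathcal L_1=\mathcal L_2\circ\Psi$ on $(\mathbb L,0)$ for contact diffeomorphism germs $K,\Psi$ on $(J,0)$ such that $K$ has the form $(\phi_1(t),\phi_2(t,q,z),\phi_3(t,q,z),\phi_4(t,q,z,s,p),\phi_5(t,q,z,s,p))$, the $t$-component of $\Psi$ depends only on $t$, and $\Psi$ preserves the germ of every $\tilde L^0_\sigma$. For $w=(t_w,q_w,z_w,s_w,p_w)\in J$ let $\tau_w(x)=w+x+(0,0,\langle p_w,q\rangle+\langle s_w,t\rangle,0,0)$ for $x=(t,q,z,s,p)$; this is a diffeomorphism of $J$ preserving $\Theta$ with $\tau_w(0)=w$. For a map $C$ in one of the classes above and a point $x_0=(T,0,\dots,0,P^0_{r+1},\dots,P^0_n)\in U$ (all coordinates other than $t$ and $p_{r+1},\dots,p_n$ vanish),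 let $\mathcal L_{C,x_0}=\tau_{C(x_0)}^{-1}\circ C\circ\tau_{x_0}|_{\mathbb L}$. **Stability.** Let $\mathcal C$ be one of $C_T,\ C_T^\Theta,\ C_T^Z,\ C_T^{\Theta,Z}$. A reticular Legendrian unfolding $\mathcal L$ is *stable with respect to $\mathcal C$* if for every open $U\ni 0$ and every $C^0\in\mathcal C(U)$ that is an extension of $\mathcal L$, there is a neighbourhood $N$ of $C^0$, open in the $C^\infty$-topology (uniform convergence of all derivatives on compact subsets of $U$, respectively of $V$), such that for every $C\in N\cap\mathcal C(U)$ there is a point $x_0=(T,0,\dots,0,P^0_{r+1},\dots,P^0_n)\in U$ such that $\mathcal L_{C,x_0}$ and $\mathcal L$ are $\mathcal P$-Legendrian equivalent. Here "$C^0$ is an extension of $\mathcal L$" is understood in one of two senses: - *strict*: $C^0|_{\mathbb L}=\mathcal L$ as germs at $0$; - *wide*: $C^0$ defines the configuration of $\mathcal L$, i.e. $C^0(\tilde L^0_\sigma)=\mathcal L(\tilde L^0_\sigma)$ as set germs at $0$ for all $\sigma\subset I_r$. The original definition of stability is stability with respect to $C_T$ with strict extensions. **Lemma 4.2.** Let $\mathcal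 L$ be a reticular Legendrian unfolding. (a) The following are equivalent: $\mathcal L$ is stable with respect to $C_T$ with strict extensions (the original definition); with respect to $C_T^Z$ with strict extensions; with respect to $C_T$ with wide extensions; with respect to $C_T^\Theta$ with wide extensions; with respect to $C_T^Z$ with wide extensions; with respect to $C_T^{\Theta,Z}$ with wide extensions. (b) If $\mathcal L$ has a strict extension that preserves $\Theta$, then the four definitions of stability with strict extensions, with respect to $C_T$, $C_T^\Theta$, $C_T^Z$ and $C_T^{\Theta,Z}$, are equivalent. -/

import Mathlib

open Filter Topology
open scoped ContDiff

noncomputable section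

namespace RetLeg

/-- The big 1-jet bundle `J¹(ℝᵐ × ℝⁿ, ℝ)` in its canonical coordinates `(t, q, z, s, p)`. -/
abbrev J (m n : ℕ) : Type :=
  (Fin m → ℝ) × (Fin n → ℝ) × ℝ × (Fin m → ℝ) × (Fin n → ℝ)

/-- The hyperplane `{Z = 0}` of the 1-jet bundle, with coordinates `(t, q, s, p)`. -/
abbrev J0 (m n : ℕ) : Type :=
  (Fin m → ℝ) × (Fin n → ℝ) × (Fin m → ℝ) × (Fin n → ℝ)

variable {m n : ℕ}

abbrev tc (x : J m n) : Fin m → ℝ := x.1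
abbrev qc (x : J m n) : Fin n → ℝ := x.2.1
abbrev zc (x : J m n) : ℝ := x.2.2.1
abbrev sc (x : J m n) : Fin m → ℝ := x.2.2.2.1
abbrev pc (x : J m n) : Fin n → ℝ := x.2.2.2.2

/-- The inclusion of `{Z = 0}`. -/
def incl (y : J0 m n) : J m n := (y.1, y.2.1, 0, y.2.2.1, y.2.2.2)

/-- Forgetting `z`; on points with `z = 0` this is the inverse of `incl`. -/
def forgetZ (x : J m n) : J0 m n := (tc x, qc x, sc x, pc x)

/-- The canonical 1-form `Θ = dz - ∑ pᵢ dqᵢ - ∑ sᵢ dtᵢ`, at the point `x` on the vector `v`. -/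
def Theta (x v : J m n) : ℝ :=
  zc v - ∑ i, pc x i * qc v i - ∑ i, sc x i * tc v i

/-- A smooth contact embedding of the open set `U`: a smooth embedding with `C^*Θ = α Θ` for a
nowhere vanishing function `α` on `U` (which is then automatically smooth). -/
structure IsContactEmbedding (U : Set (J m n)) (C : J m n → J m n) : Prop where
  smooth : ContDiffOn ℝ ∞ C U
  embedding : IsEmbedding (fun x : U => C x)
  immersion : ∀ x ∈ U, Function.Injective (fderiv ℝ C x)
  contact : ∀ x ∈ U, ∃ a : ℝ, a ≠ 0 ∧ ∀ v, Theta (C x) (fderiv ℝ C x v) = a * Theta x v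

/-- On `U`, the map `C` has the form
`C(t,q,z,s,p) = (t, q_C(t,q,z,p), z_C(t,q,z,p), h_C(t,q,z,s,p), p_C(t,q,z,p))`,
where the `i`-th component of `h_C` depends only on `t, q, z, sᵢ, p`. -/
structure IsPForm (U : Set (J m n)) (C : J m n → J m n) : Prop where
  time : ∀ x ∈ U, tc (C x) = tc x
  base : ∀ x ∈ U, ∀ y ∈ U, tc x = tc y → qc x = qc y → zc x = zc y → pc x = pc y →
    qc (C x) = qc (C y) ∧ zc (C x) = zc (C y) ∧ pc (C x) = pc (C y)
  slope : ∀ i, ∀ x ∈ U, ∀ y ∈ U, tc x = tc y → qc x = qc y → zc x = zc y → pc x = pc y →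
    sc x i = sc y i → sc (C x) i = sc (C y) i

/-- `C_T(U, J¹)`: contact embeddings of `U` of the above form. -/
def CT (U : Set (J m n)) : Set (J m n → J m n) :=
  {C | IsContactEmbedding U C ∧ IsPForm U C}

/-- `C_T^Θ(U, J¹)`: those elements of `C_T(U, J¹)` that preserve the canonical 1-form. -/
def CTTheta (U : Set (J m n)) : Set (J m n → J m n) :=
  {C | C ∈ CT U ∧ ∀ x ∈ U, ∀ v, Theta (C x) (fderiv ℝ C x v) = Theta x v}

/-- `C_T^Z(V, J¹)`, `V = U ∩ {Z = 0}`: restrictions to `V` of elements of `C_T(U, J¹)`. -/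
def CTZ (U : Set (J m n)) : Set (J0 m n → J m n) :=
  {c | ∃ C ∈ CT U, Set.EqOn c (C ∘ incl) (incl ⁻¹' U)}

/-- `C_T^{Θ,Z}(V, J¹)`, `V = U ∩ {Z = 0}`: restrictions to `V` of elements of `C_T^Θ(U, J¹)`. -/
def CTThetaZ (U : Set (J m n)) : Set (J0 m n → J m n) :=
  {c | ∃ C ∈ CTTheta U, Set.EqOn c (C ∘ incl) (incl ⁻¹' U)}

/-- The standard `L̃⁰_σ`. The index set `I_r` consists of the first `r` indices. -/
def L0 (r : ℕ) (σ : Set (Fin n)) : Set (J m n) :=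
  {x | (∀ i : Fin n, (i : ℕ) < r → i ∈ σ → qc x i = 0) ∧
    (∀ i : Fin n, (i : ℕ) < r → i ∉ σ → pc x i = 0 ∧ 0 ≤ qc x i) ∧
    (∀ i : Fin n, r ≤ (i : ℕ) → qc x i = 0) ∧ sc x = 0 ∧ zc x = 0}

/-- The standard set `𝕃`, the union of all `L̃⁰_σ`. -/
def LL (m n r : ℕ) : Set (J m n) :=
  {x | (∀ i : Fin n, (i : ℕ) < r → qc x i * pc x i = 0 ∧ 0 ≤ qc x i) ∧
    (∀ i : Fin n, r ≤ (i : ℕ) → qc x i = 0) ∧ sc x = 0 ∧ zc x = 0}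

/-- Contact diffeomorphism germs on `(J¹, 0)` that are `𝒫`-contact. -/
def IsPContactDiffeoGerm (C : J m n → J m n) : Prop :=
  C 0 = 0 ∧ ∃ U, IsOpen U ∧ (0 : J m n) ∈ U ∧ C ∈ CT U

/-- `f` extends the map germ `ℒ : (𝕃, 0) → J¹`, i.e. `f|_𝕃 = ℒ` as germs at `0`. Only the values
of `ℒ` at the points of `𝕃` near `0` matter, here and in all the definitions below. -/
def Extends (r : ℕ) (f ℒ : J m n → J m n) : Prop :=
  ∀ᶠ x in 𝓝[LL m n r] 0, f x = ℒ x

/-- Reticular Legendrian unfoldings: restrictions to `𝕃` of `𝒫`-contact diffeomorphism germs. -/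
def IsReticularLegendrianUnfolding (r : ℕ) (ℒ : J m n → J m n) : Prop :=
  ∃ C, IsPContactDiffeoGerm C ∧ Extends r C ℒ

/-- `f` defines the unfolded contact regular `r`-cubic configuration of `ℒ`: the set germs at `0`
of `f(L̃⁰_σ)` and `ℒ(L̃⁰_σ)` are equal for every `σ ⊆ I_r`. -/
def DefinesConfiguration (r : ℕ) (f ℒ : J m n → J m n) : Prop :=
  ∀ σ ⊆ {i : Fin n | (i : ℕ) < r}, ∀ W ∈ 𝓝 (0 : J m n), ∃ W' ∈ 𝓝 (0 : J m n),
    f '' (L0 r σ ∩ W') ⊆ ℒ '' (L0 r σ ∩ W) ∧ ℒ '' (L0 r σ ∩ W') ⊆ f '' (L0 r σ ∩ W)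

/-- `𝒫`-Legendrian equivalences: contact diffeomorphism germs on `(J¹, 0)` of the form
`(φ₁(t), φ₂(t,q,z), φ₃(t,q,z), φ₄(t,q,z,s,p), φ₅(t,q,z,s,p))`. -/
def IsPLegendrianEquivalence (K : J m n → J m n) : Prop :=
  K 0 = 0 ∧ ∃ U, IsOpen U ∧ (0 : J m n) ∈ U ∧ IsContactEmbedding U K ∧
    (∀ x ∈ U, ∀ y ∈ U, tc x = tc y → tc (K x) = tc (K y)) ∧
    (∀ x ∈ U, ∀ y ∈ U, tc x = tc y → qc x = qc y → zc x = zc y →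
      qc (K x) = qc (K y) ∧ zc (K x) = zc (K y))

/-- Reticular `𝒫`-diffeomorphisms: contact diffeomorphism germs `Ψ` on `(J¹, 0)` such that the
`t`-component of `Ψ` depends only on `t`, and `Ψ` preserves the set germ of every `L̃⁰_σ`. -/
def IsReticularPDiffeo (r : ℕ) (Ψ : J m n → J m n) : Prop :=
  Ψ 0 = 0 ∧ ∃ U, IsOpen U ∧ (0 : J m n) ∈ U ∧ IsContactEmbedding U Ψ ∧
    (∀ x ∈ U, ∀ y ∈ U, tc x = tc y → tc (Ψ x) = tc (Ψ y)) ∧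
    (∀ σ ⊆ {i : Fin n | (i : ℕ) < r}, ∀ᶠ x in 𝓝 (0 : J m n), Ψ x ∈ L0 r σ ↔ x ∈ L0 r σ)

/-- `𝒫`-Legendrian equivalence of two reticular Legendrian unfoldings: `K ∘ ℒ₁ = ℒ₂ ∘ Ψ` as
map germs on `(𝕃, 0)`. -/
def PLegendrianEquivalent (r : ℕ) (ℒ₁ ℒ₂ : J m n → J m n) : Prop :=
  ∃ K Ψ, IsPLegendrianEquivalence K ∧ IsReticularPDiffeo r Ψ ∧
    ∀ᶠ x in 𝓝[LL m n r] 0, K (ℒ₁ x) = ℒ₂ (Ψ x)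

/-- The translation `x ↦ w + x` of the 1-jet bundle, corrected in its `z`-component so that it
preserves `Θ`; it maps `0` to `w`. -/
def contactTranslate (w x : J m n) : J m n :=
  (tc w + tc x, qc w + qc x,
    zc w + zc x + ∑ i, pc w i * qc x i + ∑ i, sc w i * tc x i,
    sc w + sc x, pc w + pc x)

/-- The inverse of `contactTranslate w`; it maps `w` to `0`. -/
def contactTranslateBack (w y : J m n) : J m n :=
  (tc y - tc w, qc y - qc w,
    zc y - zc w - ∑ i, pc w i * (qc y i - qc w i) - ∑ i, sc w i * (tc y i - tc w i),
    sc y - sc w, pc y - pc w)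

/-- The map germ of `f` at `x₀`, moved to a germ from `0` to `0` by contact translations. -/
def germAt (f : J m n → J m n) (x₀ : J m n) : J m n → J m n :=
  fun x => contactTranslateBack (f x₀) (f (contactTranslate x₀ x))

/-- There is a point `x₀ = (T, 0, …, 0, P⁰_{r+1}, …, P⁰_n)` of `U` such that the reticular
Legendrian unfolding given by `f` at `x₀` is `𝒫`-Legendrian equivalent to `ℒ`. -/
def Realizes (r : ℕ) (U : Set (J m n)) (f ℒ : J m n → J m n) : Prop :=
  ∃ x₀ ∈ U, qc x₀ = 0 ∧ zc x₀ = 0 ∧ sc x₀ = 0 ∧ (∀ i : Fin n, (i : ℕ) < r → pc x₀ i = 0) ∧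
    PLegendrianEquivalent r (germAt f x₀) ℒ

/-- The `C^∞`-topology over the open set `U`: uniform convergence of all derivatives on the compact
subsets of `U`. It is only used on maps that are smooth on `U`. -/
abbrev cInfty {E F : Type*} [NormedAddCommGroup E] [NormedSpace ℝ E] [NormedAddCommGroup F]
    [NormedSpace ℝ F] (U : Set E) : TopologicalSpace (E → F) :=
  ⨅ k : ℕ, TopologicalSpace.induced
    (fun f : E → F => UniformOnFun.ofFun {K : Set E | IsCompact K ∧ K ⊆ U} (iteratedFDeriv ℝ k f))
    inferInstance

/-- Stability of `ℒ` with respect to a class `𝒞 U` of maps on `U`. The argument `ext f ℒ` says in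
which sense the germ `f` is an extension of `ℒ`. The germ `C⁰` is given by its representative. -/
def IsStableOver (𝒞 : Set (J m n) → Set (J m n → J m n))
    (ext : ℕ → (J m n → J m n) → (J m n → J m n) → Prop) (r : ℕ) (ℒ : J m n → J m n) : Prop :=
  ∀ U : Set (J m n), IsOpen U → 0 ∈ U → ∀ C₀ ∈ 𝒞 U, ext r C₀ ℒ →
    ∃ N : Set (J m n → J m n), IsOpen[cInfty U] N ∧ C₀ ∈ N ∧
      ∀ C ∈ N, C ∈ 𝒞 U → Realizes r U C ℒ

/-- Stability of `ℒ` with respect to a class `𝒞 U` of maps on `V = U ∩ {Z = 0}`. Since `𝕃` and the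
points `x₀` lie in `{Z = 0}`, a map on `V` defines germs on `𝕃` as before. -/
def IsStableOverZ (𝒞 : Set (J m n) → Set (J0 m n → J m n))
    (ext : ℕ → (J m n → J m n) → (J m n → J m n) → Prop) (r : ℕ) (ℒ : J m n → J m n) : Prop :=
  ∀ U : Set (J m n), IsOpen U → 0 ∈ U → ∀ c₀ ∈ 𝒞 U, ext r (c₀ ∘ forgetZ) ℒ →
    ∃ N : Set (J0 m n → J m n), IsOpen[cInfty (incl ⁻¹' U)] N ∧ c₀ ∈ N ∧
      ∀ c ∈ N, c ∈ 𝒞 U → Realizes r U (c ∘ forgetZ) ℒ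

/-- `ℒ` has an extension that preserves the canonical 1-form. -/
def HasThetaExtension (r : ℕ) (ℒ : J m n → J m n) : Prop :=
  ∃ C U, IsOpen U ∧ (0 : J m n) ∈ U ∧ C ∈ CTTheta U ∧ Extends r C ℒ

end RetLeg

end

/-! Enlarging the class of maps or the set of admissible extensions strengthens stability, and
restriction to {z = 0} is continuous, so stability for `CTZ` with wide extensions implies all the
other conditions. Everything reduces to one converse, `IsStableOver.isStableOverZ`: stability for
`CT` or `CTTheta` implies that strongest condition as soon as the class contains one admissible
extension `D` of `ℒ` that defines its configuration.

Two facts carry the argument. The first is that realizing `ℒ` at a base point depends only on the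
configuration there: if `C` and `D` have the same germs of images of all `L0 r σ`, then D⁻¹ ∘ C is a
contact germ that preserves t and every `L0 r σ`, and it can be absorbed into the reticular
diffeomorphism (`PLegendrianEquivalent.of_configLE`).

The second is that a Θ-preserving map with the same configurations can be built from C|{z=0} alone.
If C^*Θ = αΘ, the fibre scaling (t,q,s,p) ↦ (t,q,αs,αp) multiplies the form -p dq - s dt by α, and
no derivative of α enters. Composing C|{z=0} with the inverse scaling removes the factor, and adding
z∂_z extends the result to a map that preserves Θ (`normalForm_spec`). The scaling preserves every
`L0 r σ`, because these sets impose on p and s only vanishing conditions.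

It remains to see that this construction depends continuously on the map. If stability fails at c₀,
there are bad maps c_j that converge to c₀ so fast that all of them lie on one smooth family, c_j at
the parameter 2⁻ʲ and c₀ at 0 (`exists_smooth_interpolation`). Their conformal factors form a smooth
family by Hadamard division (`exists_fiberFactor`), and the inverse function theorem with the
parameter as an extra variable yields a smooth family Γ_ε on a common neighbourhood, which at these
parameters consists of Θ-preserving models (`exists_thetaModel_family`). Now Φ = Γ₀⁻¹ ∘ D preserves
every `L0 r σ`, and Γ_ε ∘ Φ tends to D in the C^∞-topology. Stability at D gives a base point at
which Γ_ε ∘ Φ realizes `ℒ` for ε = 2⁻ʲ with j large, and by the first fact c_j realizes `ℒ` too, a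
contradiction. -/

namespace RetLeg

/-! ### The C^∞-topology: basic neighbourhoods, smooth families, linear precomposition. -/

section CInfty

variable {E F G : Type*} [NormedAddCommGroup E] [NormedSpace ℝ E] [NormedAddCommGroup F]
  [NormedSpace ℝ F] [NormedAddCommGroup G] [NormedSpace ℝ G]

/-- The basic neighbourhoods of the `C^∞`-topology. -/
theorem mem_nhds_cInfty_iff {U : Set E} {f : E → F} {N : Set (E → F)} :
    N ∈ @nhds _ (cInfty U) f ↔ ∃ K : Set E, IsCompact K ∧ K ⊆ U ∧ ∃ k : ℕ, ∃ ε : ℝ, 0 < ε ∧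
      {g : E → F | ∀ i ≤ k, ∀ x ∈ K,
        ‖iteratedFDeriv ℝ i g x - iteratedFDeriv ℝ i f x‖ < ε} ⊆ N := by
  have hbasis : ∀ k : ℕ, (@nhds _ (TopologicalSpace.induced
      (fun f : E → F => UniformOnFun.ofFun {K : Set E | IsCompact K ∧ K ⊆ U}
        (iteratedFDeriv ℝ k f)) inferInstance) f).HasBasis
      (fun Kε : Set E × ℝ => (IsCompact Kε.1 ∧ Kε.1 ⊆ U) ∧ 0 < Kε.2)
      (fun Kε => {g : E → F | ∀ x ∈ Kε.1,
        ‖iteratedFDeriv ℝ k g x - iteratedFDeriv ℝ k f x‖ < Kε.2}) := by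
    intro k
    rw [nhds_induced]
    have h := (UniformOnFun.hasBasis_nhds_of_basis E (E [×k]→L[ℝ] F)
      {K : Set E | IsCompact K ∧ K ⊆ U}
      (UniformOnFun.ofFun {K : Set E | IsCompact K ∧ K ⊆ U} (iteratedFDeriv ℝ k f))
      ⟨∅, isCompact_empty, Set.empty_subset _⟩
      (fun a ha b hb => ⟨a ∪ b, ⟨ha.1.union hb.1, Set.union_subset ha.2 hb.2⟩,
        Set.subset_union_left, Set.subset_union_right⟩)
      Metric.uniformity_basis_dist).comap
      (fun f : E → F => UniformOnFun.ofFun {K : Set E | IsCompact K ∧ K ⊆ U}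
        (iteratedFDeriv ℝ k f))
    refine h.congr (fun _ => Iff.rfl) fun Kε _ => ?_
    ext g
    simp only [Set.mem_ofPred_eq, Set.mem_preimage, UniformOnFun.gen]
    refine forall₂_congr fun x _ => ?_
    rw [← dist_eq_norm]
    rfl
  rw [nhds_iInf]
  constructor
  · intro h
    -- Finitely many conditions merge into one: take the union of the compact sets, the larger order
    -- and the smaller radius.
    refine Filter.iInf_sets_induct h (p := fun N => ∃ K : Set E, IsCompact K ∧ K ⊆ U ∧
      ∃ k : ℕ, ∃ ε : ℝ, 0 < ε ∧ {g : E → F | ∀ i ≤ k, ∀ x ∈ K,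
        ‖iteratedFDeriv ℝ i g x - iteratedFDeriv ℝ i f x‖ < ε} ⊆ N) ?_ ?_
    · exact ⟨∅, isCompact_empty, Set.empty_subset _, 0, 1, one_pos, Set.subset_univ _⟩
    · rintro l s₁ s₂ h₁ ⟨K, hK, hKU, k, ε, hε, hs⟩
      obtain ⟨⟨K', ε'⟩, ⟨⟨hK', hKU'⟩, hε'⟩, hs'⟩ := (hbasis l).mem_iff.1 h₁
      refine ⟨K ∪ K', hK.union hK', Set.union_subset hKU hKU', max k l, min ε ε',
        lt_min hε hε', fun g hg => ⟨hs' fun x hx => ?_, hs fun i hi x hx => ?_⟩⟩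
      · exact (hg l (le_max_right _ _) x (Or.inr hx)).trans_le (min_le_right _ _)
      · exact (hg i (hi.trans (le_max_left _ _)) x (Or.inl hx)).trans_le (min_le_left _ _)
  · rintro ⟨K, hK, hKU, k, ε, hε, hs⟩
    have : (⋂ i ∈ Finset.range (k + 1), {g : E → F | ∀ x ∈ K,
        ‖iteratedFDeriv ℝ i g x - iteratedFDeriv ℝ i f x‖ < ε}) ∈ ⨅ k : ℕ, @nhds _
        (TopologicalSpace.induced (fun f : E → F => UniformOnFun.ofFun
          {K : Set E | IsCompact K ∧ K ⊆ U} (iteratedFDeriv ℝ k f)) inferInstance) f := by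
      refine (Filter.biInter_finset_mem _).2 fun i _ => Filter.mem_iInf_of_mem i ?_
      exact (hbasis i).mem_of_mem (i := (K, ε)) ⟨⟨hK, hKU⟩, hε⟩
    refine Filter.mem_of_superset this fun g hg => hs fun i hi x hx => ?_
    simp only [Set.mem_iInter, Finset.mem_range] at hg
    exact hg i (Nat.lt_succ_of_le hi) x hx

theorem iteratedFDeriv_comp_continuousLinearMap {f : E → F} {s : Set E} (hs : IsOpen s)
    (hf : ContDiffOn ℝ ∞ f s) (g : G →L[ℝ] E) {x : G} (hx : g x ∈ s) (i : ℕ) :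
    iteratedFDeriv ℝ i (f ∘ g) x =
      (iteratedFDeriv ℝ i f (g x)).compContinuousLinearMap fun _ => g := by
  have hs' : IsOpen (g ⁻¹' s) := hs.preimage g.continuous
  have h := g.iteratedFDerivWithin_comp_right hf hs.uniqueDiffOn hs'.uniqueDiffOn hx
    (i := i) (by exact_mod_cast le_top)
  rwa [iteratedFDerivWithin_of_isOpen i hs' hx, iteratedFDerivWithin_of_isOpen i hs hx] at h

/-- The slice inclusion is affine, a translation after `inr`, so derivatives of a slice are
restrictions of the joint derivatives. This turns joint continuity into continuity in the parameter.
-/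
theorem iteratedFDeriv_slice {f : ℝ × E → F} {s : Set (ℝ × E)} (hs : IsOpen s)
    (hf : ContDiffOn ℝ ∞ f s) {ε : ℝ} {x : E} (hx : (ε, x) ∈ s) (i : ℕ) :
    iteratedFDeriv ℝ i (fun y => f (ε, y)) x = (iteratedFDeriv ℝ i f (ε, x)).compContinuousLinearMap
      fun _ => ContinuousLinearMap.inr ℝ ℝ E := by
  have hadd : ∀ y : E, ((ε, 0) : ℝ × E) + ContinuousLinearMap.inr ℝ ℝ E y = (ε, y) := by
    intro y; simp
  have h1 : (fun y => f (ε, y)) =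
      (fun z => f ((ε, 0) + z)) ∘ ContinuousLinearMap.inr ℝ ℝ E := by
    funext y; simp
  rw [h1, iteratedFDeriv_comp_continuousLinearMap (s := (fun z => ((ε, 0) : ℝ × E) + z) ⁻¹' s)
    (hs.preimage (by fun_prop)) ?_ _ (by simpa using hx), iteratedFDeriv_comp_add_left, hadd]
  exact hf.comp (by fun_prop) fun z hz => hz

/-- A smooth one-parameter family of maps is continuous in the `C^∞`-topology. -/
theorem tendsto_cInfty_of_contDiffOn {ι : Type*} {l : Filter ι} {U : Set E} (hU : IsOpen U)
    {δ : ℝ} (hδ : 0 < δ) {f : ℝ × E → F} (hf : ContDiffOn ℝ ∞ f (Set.Ioo (-δ) δ ×ˢ U))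
    {D : E → F} (hD : ∀ x ∈ U, f (0, x) = D x) {ε : ι → ℝ} (hε : Tendsto ε l (𝓝 0)) :
    Tendsto (fun j x => f (ε j, x)) l (@nhds _ (cInfty U) D) := by
  intro N hN
  obtain ⟨K, hK, hKU, k, η, hη, hs⟩ := mem_nhds_cInfty_iff.1 hN
  have hop : IsOpen (Set.Ioo (-δ) δ ×ˢ U) := isOpen_Ioo.prod hU
  have h0 : (0 : ℝ) ∈ Set.Ioo (-δ) δ := ⟨by linarith, hδ⟩
  have key : ∀ i : ℕ, ∀ᶠ e in 𝓝 (0 : ℝ), ∀ x ∈ K,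
      ‖iteratedFDeriv ℝ i (fun y => f (e, y)) x - iteratedFDeriv ℝ i D x‖ < η := by
    intro i
    refine hK.eventually_forall_of_forall_eventually fun x hx => ?_
    have hmem : ∀ᶠ z : ℝ × E in 𝓝 (0, x), z ∈ Set.Ioo (-δ) δ ×ˢ U :=
      hop.mem_nhds ⟨h0, hKU hx⟩
    have hc : ContinuousAt (iteratedFDeriv ℝ i f) (0, x) := by
      have := hf.continuousOn_iteratedFDerivWithin (m := i) (by exact_mod_cast le_top)
        hop.uniqueDiffOn
      exact ((this.congr fun z hz => (iteratedFDerivWithin_of_isOpen i hop hz).symm)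
        |>.continuousAt (hop.mem_nhds ⟨h0, hKU hx⟩))
    have hL : Continuous (ContinuousMultilinearMap.compContinuousLinearMapL (𝕜 := ℝ) (F := F)
      fun _ : Fin i => ContinuousLinearMap.inr ℝ ℝ E) := ContinuousLinearMap.continuous _
    have hc1 : ContinuousAt (fun z : ℝ × E => ContinuousMultilinearMap.compContinuousLinearMapL
        (𝕜 := ℝ) (F := F) (fun _ : Fin i => ContinuousLinearMap.inr ℝ ℝ E)
        (iteratedFDeriv ℝ i f z)) (0, x) := hL.continuousAt.comp hc
    -- The comparison point is `(0, z.2)` and not `(0, x)`: the estimate is needed near each x at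
    -- moving points, and compactness of `K` then makes it uniform.
    have hc2 : ContinuousAt (fun z : ℝ × E => ContinuousMultilinearMap.compContinuousLinearMapL
        (𝕜 := ℝ) (F := F) (fun _ : Fin i => ContinuousLinearMap.inr ℝ ℝ E)
        (iteratedFDeriv ℝ i f (0, z.2))) (0, x) :=
      ContinuousAt.comp (f := fun z : ℝ × E => ((0 : ℝ), z.2)) (x := ((0 : ℝ), x)) hc1
        (by fun_prop)
    have hlim := (hc1.sub hc2).norm.tendsto.eventually_lt_const (u := η) (by simpa using hη)
    filter_upwards [hlim, hmem] with z hz hzm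
    have e1 := iteratedFDeriv_slice hop hf (ε := z.1) (x := z.2) hzm i
    have e2 := iteratedFDeriv_slice hop hf (ε := 0) (x := z.2) ⟨h0, hzm.2⟩ i
    have e3 : iteratedFDeriv ℝ i D z.2 = iteratedFDeriv ℝ i (fun y => f (0, y)) z.2 := by
      refine Filter.EventuallyEq.eq_of_nhds (Filter.EventuallyEq.iteratedFDeriv ℝ ?_ i)
      filter_upwards [hU.mem_nhds hzm.2] with y hy using (hD y hy).symm
    rw [e1, e3, e2]
    exact hz
  have hall : ∀ᶠ e in 𝓝 (0 : ℝ), ∀ i ∈ Finset.range (k + 1), ∀ x ∈ K,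
      ‖iteratedFDeriv ℝ i (fun y => f (e, y)) x - iteratedFDeriv ℝ i D x‖ < η :=
    (Filter.eventually_all_finset _).2 fun i _ => key i
  refine Filter.mem_map.2 (Filter.mem_of_superset (hε.eventually hall) fun j hj => ?_)
  exact hs fun i hi x hx => hj i (Finset.mem_range.2 (Nat.lt_succ_of_le hi)) x hx

/-- Precomposition with a linear map is continuous on smooth maps. -/
theorem exists_isOpen_cInfty_comp_mem {U : Set E} (hU : IsOpen U) (L : G →L[ℝ] E) {f : E → F}
    (hf : ContDiffOn ℝ ∞ f U) {N : Set (G → F)} (hN : N ∈ @nhds _ (cInfty (L ⁻¹' U)) (f ∘ L)) :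
    ∃ M : Set (E → F), IsOpen[cInfty U] M ∧ f ∈ M ∧
      ∀ g ∈ M, ContDiffOn ℝ ∞ g U → g ∘ L ∈ N := by
  obtain ⟨K, hK, hKU, k, η, hη, hs⟩ := mem_nhds_cInfty_iff.1 hN
  -- The maximum with 1 makes this one constant bound ‖L‖ⁱ for every order i ≤ k.
  set R : ℝ := (max 1 ‖L‖) ^ k with hR
  have hR1 : 0 < R := by positivity
  have hM : {g : E → F | ∀ i ≤ k, ∀ x ∈ L '' K,
      ‖iteratedFDeriv ℝ i g x - iteratedFDeriv ℝ i f x‖ < η / R} ∈ @nhds _ (cInfty U) f :=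
    mem_nhds_cInfty_iff.2 ⟨L '' K, hK.image L.continuous,
      Set.image_subset_iff.2 hKU, k, η / R, by positivity, subset_rfl⟩
  obtain ⟨M, hMs, hMo, hfM⟩ := (@mem_nhds_iff _ (cInfty U) _ _).1 hM
  refine ⟨M, hMo, hfM, fun g hg hgs => hs fun i hi x hx => ?_⟩
  rw [iteratedFDeriv_comp_continuousLinearMap hU hgs L (hKU hx),
    iteratedFDeriv_comp_continuousLinearMap hU hf L (hKU hx)]
  have h1 := hMs hg i hi (L x) ⟨x, hx, rfl⟩
  have h2 : (iteratedFDeriv ℝ i g (L x)).compContinuousLinearMap (fun _ => L) -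
      (iteratedFDeriv ℝ i f (L x)).compContinuousLinearMap (fun _ => L) =
      (iteratedFDeriv ℝ i g (L x) - iteratedFDeriv ℝ i f (L x)).compContinuousLinearMap
        (fun _ => L) := rfl
  rw [h2]
  refine (ContinuousMultilinearMap.norm_compContinuousLinearMap_le _ _).trans_lt ?_
  have h3 : ∏ _j : Fin i, ‖L‖ ≤ R := by
    rw [Finset.prod_const, Finset.card_univ, Fintype.card_fin, hR]
    exact (pow_le_pow_left₀ (norm_nonneg _) (le_max_right _ _) i).trans
      (pow_le_pow_right₀ (le_max_left _ _) hi)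
  calc _ ≤ ‖iteratedFDeriv ℝ i g (L x) - iteratedFDeriv ℝ i f (L x)‖ * R := by gcongr
    _ < η / R * R := by gcongr
    _ = η := by field_simp

end CInfty

/-! ### The inverse function theorem with a smooth inverse on an open set. -/

section InverseFunction

variable {E F : Type*} [NormedAddCommGroup E] [NormedSpace ℝ E] [NormedAddCommGroup F]
  [NormedSpace ℝ F] [CompleteSpace E]

/-- The smooth inverse function theorem, with a smooth inverse on the whole target. -/
theorem exists_openPartialHomeomorph {f : E → F} {O : Set E} (hO : IsOpen O)
    (hf : ContDiffOn ℝ ∞ f O) {a : E} (ha : a ∈ O) {f' : E ≃L[ℝ] F}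
    (hf' : HasFDerivAt f (f' : E →L[ℝ] F) a) :
    ∃ e : OpenPartialHomeomorph E F, a ∈ e.source ∧ e.source ⊆ O ∧ ⇑e = f ∧
      ContDiffOn ℝ ∞ e.symm e.target ∧
      ∀ x ∈ e.source, ∃ f'' : E ≃L[ℝ] F, HasFDerivAt f (f'' : E →L[ℝ] F) x := by
  have hfa : ContDiffAt ℝ ∞ f a := hf.contDiffAt (hO.mem_nhds ha)
  have hne : (∞ : WithTop ℕ∞) ≠ 0 := by simp
  set e₀ := hfa.toOpenPartialHomeomorph f hf' hne with he₀
  have hcont : ContinuousOn (fderiv ℝ f) O :=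
    hf.continuousOn_fderiv_of_isOpen hO (by exact_mod_cast le_top)
  -- Smoothness of the inverse at a point needs an invertible derivative at its preimage.
  -- Invertibility is an open condition, so shrinking the source to `S` secures it everywhere.
  set S : Set E := O ∩ fderiv ℝ f ⁻¹' Set.range ((↑) : (E ≃L[ℝ] F) → E →L[ℝ] F) with hS
  have hSo : IsOpen S := hcont.isOpen_inter_preimage hO ContinuousLinearEquiv.isOpen
  have haS : a ∈ S := ⟨ha, f', hf'.fderiv.symm⟩
  have hder : ∀ x ∈ S, ∃ f'' : E ≃L[ℝ] F, HasFDerivAt f (f'' : E →L[ℝ] F) x := by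
    rintro x ⟨hx, f'', hf''⟩
    refine ⟨f'', ?_⟩
    have := ((hf.contDiffAt (hO.mem_nhds hx)).differentiableAt (by simp)).hasFDerivAt
    rwa [← hf''] at this
  refine ⟨e₀.restrOpen S hSo, ⟨hfa.mem_toOpenPartialHomeomorph_source hf' hne, haS⟩,
    fun x hx => hx.2.1, rfl, fun y hy => ContDiffAt.contDiffWithinAt ?_,
    fun x hx => hder x hx.2⟩
  have hy' : (e₀.restrOpen S hSo).symm y ∈ (e₀.restrOpen S hSo).source :=
    (e₀.restrOpen S hSo).map_target hy
  obtain ⟨f'', hf''⟩ := hder _ hy'.2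
  exact (e₀.restrOpen S hSo).contDiffAt_symm hy hf''
    (hf.contDiffAt (hO.mem_nhds hy'.2.1))

end InverseFunction

/-! ### Integrals depending on a parameter, and Hadamard division. -/

section ParametricIntegral

universe u

/-- Differentiation under the integral sign: the derivative is continuous and [0, 1] is compact, so
a constant dominates it for all parameters near `x`. -/
theorem hasFDerivAt_intervalIntegral_of_contDiff {E F : Type u} [NormedAddCommGroup E]
    [NormedSpace ℝ E] [NormedAddCommGroup F] [NormedSpace ℝ F] {g : E × ℝ → F}
    (hg : ContDiff ℝ 1 g) (x : E) :
    HasFDerivAt (fun x => ∫ θ in (0 : ℝ)..1, g (x, θ))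
      (∫ θ in (0 : ℝ)..1, (fderiv ℝ g (x, θ)).comp (ContinuousLinearMap.inl ℝ E ℝ)) x := by
  have hd : Continuous fun z => (fderiv ℝ g z).comp (ContinuousLinearMap.inl ℝ E ℝ) :=
    (hg.continuous_fderiv (by simp)).clm_comp continuous_const
  obtain ⟨M, hM⟩ := (isCompact_Icc (a := (0 : ℝ)) (b := 1)).exists_bound_of_continuousOn
    (f := fun θ => (fderiv ℝ g (x, θ)).comp (ContinuousLinearMap.inl ℝ E ℝ))
    (hd.comp (by fun_prop)).continuousOn
  have hbd : ∀ᶠ y in 𝓝 x, ∀ θ ∈ Set.Icc (0 : ℝ) 1,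
      ‖(fderiv ℝ g (y, θ)).comp (ContinuousLinearMap.inl ℝ E ℝ)‖ < M + 1 :=
    isCompact_Icc.eventually_forall_of_forall_eventually fun θ hθ =>
      hd.norm.continuousAt.eventually_lt continuousAt_const
        (lt_of_le_of_lt (hM θ hθ) (lt_add_one M))
  refine intervalIntegral.hasFDerivAt_integral_of_dominated_of_fderiv_le
    (F' := fun x θ => (fderiv ℝ g (x, θ)).comp (ContinuousLinearMap.inl ℝ E ℝ))
    (bound := fun _ => M + 1) hbd ?_ ?_ ?_ ?_ ?_ ?_
  · exact Eventually.of_forall fun y => (hg.continuous.comp (by fun_prop)).aestronglyMeasurable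
  · exact (hg.continuous.comp (by fun_prop)).intervalIntegrable _ _
  · exact (hd.comp (g := fun z => (fderiv ℝ g z).comp (ContinuousLinearMap.inl ℝ E ℝ))
      (f := fun θ : ℝ => (x, θ)) (by fun_prop)).aestronglyMeasurable
  · refine Eventually.of_forall fun θ hθ y hy => (hy θ ?_).le
    rw [Set.uIoc_of_le zero_le_one] at hθ
    exact Set.Ioc_subset_Icc_self hθ
  · exact intervalIntegrable_const
  · refine Eventually.of_forall fun θ _ y _ => ?_
    have h1 := (hg.differentiable (by simp) (y, θ)).hasFDerivAt
    exact h1.comp y (hasFDerivAt_prodMk_left y θ)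

/-- The induction varies `F`, since the derivative is again such an integral with values in `E →L[ℝ]
F`. This is why both spaces live in one universe. -/
theorem contDiff_intervalIntegral_nat {E : Type u} [NormedAddCommGroup E] [NormedSpace ℝ E]
    (n : ℕ) : ∀ {F : Type u} [NormedAddCommGroup F] [NormedSpace ℝ F] {g : E × ℝ → F},
    ContDiff ℝ ∞ g → ContDiff ℝ n fun x => ∫ θ in (0 : ℝ)..1, g (x, θ) := by
  induction n with
  | zero =>
    intro F _ _ g hg
    refine contDiff_zero.2 ?_
    exact intervalIntegral.continuous_parametric_intervalIntegral_of_continuous'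
      (f := fun x θ => g (x, θ)) hg.continuous 0 1
  | succ n ih =>
    intro F _ _ g hg
    refine (contDiff_succ_iff_hasFDerivAt (n := n)).2 ⟨_, ?_, fun x =>
      hasFDerivAt_intervalIntegral_of_contDiff (hg.of_le (by exact_mod_cast le_top)) x⟩
    refine ih (g := fun z => (fderiv ℝ g z).comp (ContinuousLinearMap.inl ℝ E ℝ)) ?_
    exact (hg.fderiv_right (m := ∞) (by simp)).clm_comp contDiff_const

theorem contDiff_intervalIntegral {E F : Type u} [NormedAddCommGroup E] [NormedSpace ℝ E]
    [NormedAddCommGroup F] [NormedSpace ℝ F] {g : E × ℝ → F} (hg : ContDiff ℝ ∞ g) :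
    ContDiff ℝ ∞ fun x => ∫ θ in (0 : ℝ)..1, g (x, θ) :=
  contDiff_infty.2 fun n => contDiff_intervalIntegral_nat n hg

/-- Hadamard division by a linear form, smoothly in a parameter. -/
theorem exists_contDiff_quotient {E : Type} [NormedAddCommGroup E] [NormedSpace ℝ E]
    (l : E →L[ℝ] ℝ) {e : E} (he : l e = 1) {H : ℝ × E → ℝ} (hH : ContDiff ℝ ∞ H) :
    ∃ A : ℝ × E → ℝ, ContDiff ℝ ∞ A ∧ ∀ (ε : ℝ) (B : Set E) (a : E → ℝ), IsOpen B →
      (∀ x ∈ B, ∀ θ ∈ Set.Icc (0 : ℝ) 1, x - ((1 - θ) * l x) • e ∈ B) →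
      ContDiffOn ℝ ∞ a B → (∀ x ∈ B, H (ε, x) = l x * a x) → ∀ x ∈ B, A (ε, x) = a x := by
  -- The integrand uses only `H`, so `A` is smooth for all parameters, whether or not a quotient
  -- exists there. Along the segment from the projection of x to ker l (along e) up to x, this
  -- integral recovers the quotient even where l vanishes.
  refine ⟨fun z => ∫ θ in (0 : ℝ)..1,
    fderiv ℝ H (z.1, z.2 - ((1 - θ) * l z.2) • e) (0, e), ?_, ?_⟩
  · refine contDiff_intervalIntegral
      (g := fun w : (ℝ × E) × ℝ =>
        fderiv ℝ H (w.1.1, w.1.2 - ((1 - w.2) * l w.1.2) • e) (0, e)) ?_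
    refine ContDiff.clm_apply ((hH.fderiv_right (m := ∞) (by simp)).comp ?_) contDiff_const
    fun_prop
  · intro ε B a hB hseg ha hHa x hx
    have hda : ∀ y ∈ B, HasFDerivAt a (fderiv ℝ a y) y := fun y hy =>
      ((ha.contDiffAt (hB.mem_nhds hy)).differentiableAt (by simp)).hasFDerivAt
    set S : ℝ → E := fun θ => x - ((1 - θ) * l x) • e with hS
    have hSd : ∀ θ, HasDerivAt S (l x • e) θ := by
      intro θ
      have h1 : HasDerivAt (fun θ : ℝ => (1 - θ) * l x) (-1 * l x) θ :=
        ((hasDerivAt_id θ).const_sub 1).mul_const _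
      have h2 := (h1.smul_const e).const_sub x
      simpa using h2
    have hlS : ∀ θ, l (S θ) = θ * l x := by
      intro θ; simp [hS, he]; ring
    -- If H = l·a, then ∂_e H = a + l·∂_e a, and l equals θ·l(x) at S(θ). This is exactly the
    -- θ-derivative of θ·a(S(θ)), whose increment over [0, 1] is a(x).
    have hint : ∀ θ ∈ Set.Icc (0 : ℝ) 1, HasDerivAt (fun θ => θ * a (S θ))
        (fderiv ℝ H (ε, S θ) (0, e)) θ := by
      intro θ hθ
      have hSB : S θ ∈ B := hseg x hx θ hθ
      have h1 : HasDerivAt (fun θ => a (S θ)) (fderiv ℝ a (S θ) (l x • e)) θ :=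
        (hda _ hSB).comp_hasDerivAt θ (hSd θ)
      have h2 := (hasDerivAt_id θ).mul h1
      have h3 : HasFDerivAt (fun y => H (ε, y))
          ((fderiv ℝ H (ε, S θ)).comp (ContinuousLinearMap.inr ℝ ℝ E)) (S θ) :=
        (hH.differentiable (by simp) (ε, S θ)).hasFDerivAt.comp (S θ)
          (hasFDerivAt_prodMk_right ε (S θ))
      have h4 : HasFDerivAt (fun y => l y * a y)
          (l (S θ) • fderiv ℝ a (S θ) + a (S θ) • l) (S θ) := l.hasFDerivAt.mul (hda _ hSB)
      have h5 : HasFDerivAt (fun y => H (ε, y))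
          (l (S θ) • fderiv ℝ a (S θ) + a (S θ) • l) (S θ) := by
        refine h4.congr_of_eventuallyEq ?_
        filter_upwards [hB.mem_nhds hSB] with y hy using hHa y hy
      have h6 := congrArg (fun T : E →L[ℝ] ℝ => T e) (h3.unique h5)
      have h7 : fderiv ℝ H (ε, S θ) (0, e) = 1 * a (S θ) + id θ * fderiv ℝ a (S θ) (l x • e) := by
        simp [he, hlS] at h6
        simp [h6]; ring
      rw [h7]
      exact h2
    have := intervalIntegral.integral_eq_sub_of_hasDerivAt (a := 0) (b := 1)
      (fun θ hθ => hint θ (by rwa [Set.uIcc_of_le zero_le_one] at hθ)) ?_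
    · refine this.trans ?_
      simp [hS]
    · refine Continuous.intervalIntegrable ?_ _ _
      have h1 : Continuous (fderiv ℝ H) := hH.continuous_fderiv (by simp)
      have h2 : Continuous fun θ => ((ε, S θ) : ℝ × E) := by simp only [hS]; fun_prop
      exact (h1.comp h2).clm_apply continuous_const

end ParametricIntegral

/-! ### Putting a fast convergent sequence on a smooth one-parameter family. -/

section Interpolation

variable {E F G : Type*} [NormedAddCommGroup E] [NormedSpace ℝ E] [NormedAddCommGroup F]
  [NormedSpace ℝ F] [NormedAddCommGroup G] [NormedSpace ℝ G]

theorem contDiff_cutoff_smul_comp {V : Set E} (hV : IsOpen V) (π : G →L[ℝ] E) {Λ : G → ℝ}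
    (hΛ : ContDiff ℝ ∞ Λ) (hΛV : ∀ z ∈ tsupport Λ, π z ∈ V) {f : E → F}
    (hf : ContDiffOn ℝ ∞ f V) : ContDiff ℝ ∞ fun z => Λ z • f (π z) := by
  rw [contDiff_iff_contDiffAt]
  intro z
  by_cases hz : z ∈ tsupport Λ
  · exact hΛ.contDiffAt.smul
      ((hf.contDiffAt (hV.mem_nhds (hΛV z hz))).comp z π.contDiff.contDiffAt)
  · refine (contDiffAt_const (c := (0 : F))).congr_of_eventuallyEq ?_
    filter_upwards [notMem_tsupport_iff_eventuallyEq.1 hz] with w hw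
    simp [hw]

/-- Cutting off is continuous from the `C^k`-norm on a compact set to the `C^k`-norm. -/
theorem exists_norm_iteratedFDeriv_cutoff_le {V K : Set E} (hV : IsOpen V) (hKV : K ⊆ V)
    (π : G →L[ℝ] E) (hπ : ‖π‖ ≤ 1) {Λ : G → ℝ} (hΛ : ContDiff ℝ ∞ Λ)
    (hΛc : HasCompactSupport Λ) (hΛK : ∀ z ∈ tsupport Λ, π z ∈ K) (k : ℕ) {η : ℝ} (hη : 0 < η) :
    ∃ δ > 0, ∀ f : E → F, ContDiffOn ℝ ∞ f V →
      (∀ i ≤ k, ∀ x ∈ K, ‖iteratedFDeriv ℝ i f x‖ < δ) →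
      ∀ i ≤ k, ∀ z, ‖iteratedFDeriv ℝ i (fun z => Λ z • f (π z)) z‖ ≤ η := by
  have hb : ∀ i : ℕ, ∃ M, ∀ z, ‖iteratedFDeriv ℝ i Λ z‖ ≤ M := fun i =>
    (hΛ.continuous_iteratedFDeriv (m := i) (by exact_mod_cast le_top)).bounded_above_of_compact_support
      (hΛc.iteratedFDeriv i)
  choose M hM using hb
  set R : ℝ := 1 + ∑ i ∈ Finset.range (k + 1), |M i| with hR
  have hRpos : 0 < R := by positivity
  have hMR : ∀ i ≤ k, ∀ z, ‖iteratedFDeriv ℝ i Λ z‖ ≤ R := by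
    intro i hi z
    have h1 : |M i| ≤ ∑ i ∈ Finset.range (k + 1), |M i| :=
      Finset.single_le_sum (f := fun i => |M i|) (fun i _ => abs_nonneg _)
        (Finset.mem_range.2 (Nat.lt_succ_of_le hi))
    linarith [hM i z, le_abs_self (M i)]
  -- `R` bounds the derivatives of the cutoff up to order k, and 2^k bounds the sum of the binomial
  -- coefficients in the Leibniz formula.
  refine ⟨η / (2 ^ k * R), by positivity, fun f hf hfδ i hi z => ?_⟩
  by_cases hz : z ∈ tsupport Λ
  swap
  · have : (fun z => Λ z • f (π z)) =ᶠ[𝓝 z] fun _ => 0 := by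
      filter_upwards [notMem_tsupport_iff_eventuallyEq.1 hz] with w hw
      simp [hw]
    rw [(Filter.EventuallyEq.iteratedFDeriv ℝ this i).eq_of_nhds]
    have : iteratedFDeriv ℝ i (fun _ : G => (0 : F)) z = 0 := by
      rw [iteratedFDeriv_fun_zero]; rfl
    rw [this, norm_zero]
    exact hη.le
  have hzV : π z ∈ V := hKV (hΛK z hz)
  have hop : IsOpen (π ⁻¹' V) := hV.preimage π.continuous
  have hfπ : ContDiffOn ℝ ∞ (f ∘ π) (π ⁻¹' V) := hf.comp π.contDiff.contDiffOn fun _ h => h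
  have h1 := norm_iteratedFDerivWithin_smul_le (𝕜 := ℝ) (n := i) hΛ.contDiffOn hfπ hop.uniqueDiffOn
    (x := z) hzV (by exact_mod_cast le_top)
  rw [iteratedFDerivWithin_of_isOpen i hop hzV] at h1
  refine h1.trans ?_
  have h2 : ∀ j ∈ Finset.range (i + 1), (i.choose j : ℝ) *
      ‖iteratedFDerivWithin ℝ j Λ (π ⁻¹' V) z‖ *
      ‖iteratedFDerivWithin ℝ (i - j) (f ∘ π) (π ⁻¹' V) z‖ ≤
      (i.choose j : ℝ) * (R * (η / (2 ^ k * R))) := by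
    intro j hj
    have hj' : j ≤ i := Nat.lt_succ_iff.1 (Finset.mem_range.1 hj)
    rw [iteratedFDerivWithin_of_isOpen _ hop hzV, iteratedFDerivWithin_of_isOpen _ hop hzV,
      iteratedFDeriv_comp_continuousLinearMap hV hf π hzV, mul_assoc]
    have h3 : ‖(iteratedFDeriv ℝ (i - j) f (π z)).compContinuousLinearMap fun _ => π‖ ≤
        η / (2 ^ k * R) := by
      refine (ContinuousMultilinearMap.norm_compContinuousLinearMap_le _ _).trans ?_
      rw [Finset.prod_const]
      calc _ ≤ ‖iteratedFDeriv ℝ (i - j) f (π z)‖ * 1 := by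
            gcongr; exact pow_le_one₀ (norm_nonneg _) hπ
        _ ≤ _ := by rw [mul_one]; exact (hfδ _ ((Nat.sub_le _ _).trans hi) _ (hΛK z hz)).le
    gcongr
    exact hMR j (hj'.trans hi) z
  refine (Finset.sum_le_sum h2).trans ?_
  rw [← Finset.sum_mul]
  have h4 : (∑ j ∈ Finset.range (i + 1), (i.choose j : ℝ)) = 2 ^ i := by
    exact_mod_cast Nat.sum_range_choose i
  rw [h4]
  have h5 : R * (η / (2 ^ k * R)) = η / 2 ^ k := by field_simp
  rw [h5]
  have h6 : (2 : ℝ) ^ i ≤ 2 ^ k := pow_le_pow_right₀ one_le_two hi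
  calc (2 : ℝ) ^ i * (η / 2 ^ k) ≤ 2 ^ k * (η / 2 ^ k) := by gcongr
    _ = η := by field_simp

/-- A sequence of smooth maps that converges fast enough in the `C^∞`-topology lies, locally, on a
smooth one-parameter family. -/
theorem exists_smooth_interpolation [FiniteDimensional ℝ E] [CompleteSpace F] {V : Set E}
    (hV : IsOpen V) {a : E} (ha : a ∈ V) {c₀ : E → F} (hc₀ : ContDiffOn ℝ ∞ c₀ V) :
    ∃ b > 0, Metric.ball a b ⊆ V ∧ ∃ N : ℕ → Set (E → F), (∀ j, N j ∈ @nhds _ (cInfty V) c₀) ∧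
      ∀ c : ℕ → E → F, (∀ j, ContDiffOn ℝ ∞ (c j) V) → (∀ j, c j ∈ N j) →
        ∃ g : ℝ × E → F, ContDiff ℝ ∞ g ∧ ∀ x ∈ Metric.ball a b,
          g (0, x) = c₀ x ∧ ∀ j, g ((1 / 2) ^ j, x) = c j x := by
  obtain ⟨R, hR, hRV⟩ := Metric.isOpen_iff.1 hV a ha
  let ρ : ContDiffBump a := ⟨R / 4, R / 2, by positivity, by linarith⟩
  -- The radius 2⁻ʲ/4 is less than the distance from 2⁻ʲ to the other powers, so `χ j` is 1 at its
  -- own node and vanishes at all others and at 0.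
  let χ : ∀ j : ℕ, ContDiffBump ((1 / 2 : ℝ) ^ j) := fun j =>
    ⟨(1 / 2) ^ j / 8, (1 / 2) ^ j / 4, by positivity, by
      have : (0 : ℝ) < (1 / 2) ^ j := by positivity
      linarith⟩
  set K : Set E := Metric.closedBall a (R / 2) with hK
  have hKV : K ⊆ V := (Metric.closedBall_subset_ball (by linarith)).trans hRV
  have hKc : IsCompact K := isCompact_closedBall _ _
  have hρK : tsupport ρ = K := ρ.tsupport_eq
  let Λ : ℕ → ℝ × E → ℝ := fun j z => χ j z.1 * ρ z.2
  have hΛ : ∀ j, ContDiff ℝ ∞ (Λ j) := fun j =>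
    ((χ j).contDiff.comp contDiff_fst).mul (ρ.contDiff.comp contDiff_snd)
  have hΛs : ∀ j, tsupport (Λ j) ⊆ Metric.closedBall ((1 / 2 : ℝ) ^ j) ((1 / 2) ^ j / 4) ×ˢ K := by
    intro j
    refine closure_minimal ?_ (Metric.isClosed_closedBall.prod Metric.isClosed_closedBall)
    intro z hz
    have h1 : χ j z.1 ≠ 0 := left_ne_zero_of_mul hz
    have h2 : ρ z.2 ≠ 0 := right_ne_zero_of_mul hz
    exact ⟨(χ j).tsupport_eq ▸ subset_tsupport _ h1, hρK ▸ subset_tsupport _ h2⟩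
  have hΛc : ∀ j, HasCompactSupport (Λ j) := fun j =>
    ((isCompact_closedBall _ _).prod hKc).of_isClosed_subset (isClosed_tsupport _) (hΛs j)
  have hΛK : ∀ j, ∀ z ∈ tsupport (Λ j), ContinuousLinearMap.snd ℝ ℝ E z ∈ K :=
    fun j z hz => (hΛs j hz).2
  -- The derivatives of `χ j` blow up with j. The neighbourhood of order j is chosen afterwards, so
  -- small that the j-th summand is at most 2⁻ʲ in C^j-norm.
  have hδ := fun j : ℕ => exists_norm_iteratedFDeriv_cutoff_le (F := F) hV hKV
    (ContinuousLinearMap.snd ℝ ℝ E) (ContinuousLinearMap.norm_snd_le ..) (hΛ j) (hΛc j) (hΛK j) j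
    (η := (1 / 2 : ℝ) ^ j) (by positivity)
  choose δ hδ0 hδ using hδ
  refine ⟨R / 4, by positivity, (Metric.ball_subset_ball (by linarith)).trans hRV,
    fun j => {g | ∀ i ≤ j, ∀ x ∈ K, ‖iteratedFDeriv ℝ i g x - iteratedFDeriv ℝ i c₀ x‖ < δ j},
    fun j => mem_nhds_cInfty_iff.2 ⟨K, hKc, hKV, j, δ j, hδ0 j, subset_rfl⟩, fun c hc hcN => ?_⟩
  have hdiff : ∀ j, ContDiffOn ℝ ∞ (fun x => c j x - c₀ x) V := fun j => (hc j).sub hc₀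
  have hcut : ∀ j, ∀ i ≤ j, ∀ z, ‖iteratedFDeriv ℝ i
      (fun z : ℝ × E => Λ j z • (c j z.2 - c₀ z.2)) z‖ ≤ (1 / 2 : ℝ) ^ j := by
    intro j
    refine hδ j (fun x => c j x - c₀ x) (hdiff j) fun i hi x hx => ?_
    have h1 : iteratedFDeriv ℝ i (fun x => c j x - c₀ x) x =
        iteratedFDeriv ℝ i (c j) x - iteratedFDeriv ℝ i c₀ x :=
      iteratedFDeriv_sub_apply
        (((hc j).contDiffAt (hV.mem_nhds (hKV hx))).of_le (by exact_mod_cast le_top))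
        ((hc₀.contDiffAt (hV.mem_nhds (hKV hx))).of_le (by exact_mod_cast le_top))
    rw [h1]
    exact hcN j i hi x hx
  refine ⟨fun z => ρ z.2 • c₀ z.2 + ∑' j, Λ j z • (c j z.2 - c₀ z.2), ?_, fun x hx => ?_⟩
  · refine ContDiff.add ?_ ?_
    · refine contDiff_cutoff_smul_comp hV (ContinuousLinearMap.snd ℝ ℝ E)
        (Λ := fun z : ℝ × E => ρ z.2) (ρ.contDiff.comp contDiff_snd) (fun z hz => ?_) hc₀
      have : tsupport (fun z : ℝ × E => ρ z.2) ⊆ Prod.snd ⁻¹' K :=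
        closure_minimal (fun z hz => hρK ▸ subset_tsupport _ hz)
          (Metric.isClosed_closedBall.preimage continuous_snd)
      exact hKV (this hz)
    -- The geometric bound on k-th derivatives holds for j ≥ k, which leaves out only finitely many
    -- terms.
    · refine contDiff_tsum_of_eventually (v := fun _ j => (1 / 2 : ℝ) ^ j)
        (fun j => contDiff_cutoff_smul_comp hV (ContinuousLinearMap.snd ℝ ℝ E) (hΛ j)
          (fun z hz => hKV (hΛK j z hz)) (hdiff j)) (fun _ _ => summable_geometric_two)
        fun k _ => ?_
      rw [Nat.cofinite_eq_atTop]
      filter_upwards [eventually_ge_atTop k] with j hj z using hcut j k hj z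
  · have hρ1 : ρ x = 1 := ρ.one_of_mem_closedBall (Metric.ball_subset_closedBall hx)
    have hχ0 : ∀ j, χ j 0 = 0 := fun j => (χ j).zero_of_le_dist (by
      have : (0 : ℝ) < (1 / 2) ^ j := by positivity
      rw [Real.dist_eq, zero_sub, abs_neg, abs_of_pos this]
      change (1 / 2 : ℝ) ^ j / 4 ≤ _
      linarith)
    have hχ1 : ∀ j, χ j ((1 / 2) ^ j) = 1 := fun j => (χ j).one_of_mem_closedBall
      (Metric.mem_closedBall_self (χ j).rIn_pos.le)
    have hχij : ∀ i j, i ≠ j → χ i ((1 / 2) ^ j) = 0 := fun i j hij =>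
      (χ i).zero_of_le_dist (by
        change (1 / 2 : ℝ) ^ i / 4 ≤ _
        have hi : (0 : ℝ) < (1 / 2) ^ i := by positivity
        have hj : (0 : ℝ) < (1 / 2) ^ j := by positivity
        rw [Real.dist_eq]
        rcases lt_or_gt_of_ne hij with h | h
        · have : (1 / 2 : ℝ) ^ j ≤ (1 / 2) ^ (i + 1) :=
            pow_le_pow_of_le_one (by norm_num) (by norm_num) h
          rw [pow_succ] at this
          rw [abs_sub_comm]
          exact le_trans (by linarith) (le_abs_self _)
        · have : (1 / 2 : ℝ) ^ i ≤ (1 / 2) ^ (j + 1) :=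
            pow_le_pow_of_le_one (by norm_num) (by norm_num) h
          rw [pow_succ] at this
          exact le_trans (by linarith) (le_abs_self _))
    constructor
    · simp [Λ, hρ1, hχ0]
    · intro j
      change ρ x • c₀ x + ∑' i, Λ i ((1 / 2) ^ j, x) • (c i x - c₀ x) = c j x
      have hz : ∀ i, i ≠ j → Λ i ((1 / 2) ^ j, x) • (c i x - c₀ x) = 0 := fun i hij => by
        simp only [Λ, hχij i j hij, zero_mul, zero_smul]
      rw [tsum_eq_single j hz]
      simp only [Λ, hρ1, hχ1, mul_one, one_smul]
      abel

end Interpolation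

variable {m n : ℕ}

/-! ### Linear structure of the coordinates and of the contact form. -/

section ContactForm

/-- The inclusion of `{Z = 0}` as a continuous linear map. -/
noncomputable def inclL (m n : ℕ) : J0 m n →L[ℝ] J m n :=
  LinearMap.toContinuousLinearMap
    { toFun := incl
      map_add' := fun x y => by simp [incl]; rfl
      map_smul' := fun c x => by simp [incl]; rfl }

/-- The projection along `z` as a continuous linear map. -/
noncomputable def forgetZL (m n : ℕ) : J m n →L[ℝ] J0 m n :=
  LinearMap.toContinuousLinearMap
    { toFun := forgetZ
      map_add' := fun x y => by simp [forgetZ, tc, qc, sc, pc]; rfl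
      map_smul' := fun c x => by simp [forgetZ, tc, qc, sc, pc]; rfl }

@[simp] theorem coe_inclL : ⇑(inclL m n) = incl := rfl

@[simp] theorem coe_forgetZL : ⇑(forgetZL m n) = forgetZ := rfl

theorem continuous_incl : Continuous (incl : J0 m n → J m n) := (inclL m n).continuous

theorem continuous_forgetZ : Continuous (forgetZ : J m n → J0 m n) := (forgetZL m n).continuous

@[simp] theorem forgetZ_incl (y : J0 m n) : forgetZ (incl y) = y := rfl

theorem incl_forgetZ {x : J m n} (hx : zc x = 0) : incl (forgetZ x) = x := by
  simp only [incl, forgetZ]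
  rw [← hx]

/-- The contact form at a point as a linear form. -/
noncomputable def ThetaL (x : J m n) : J m n →ₗ[ℝ] ℝ where
  toFun := Theta x
  map_add' v w := by
    simp only [Theta, tc, qc, zc, Prod.fst_add, Prod.snd_add, Pi.add_apply, mul_add, Finset.sum_add_distrib]
    ring
  map_smul' c v := by
    simp only [Theta, tc, qc, zc, Prod.smul_fst, Prod.smul_snd, Pi.smul_apply, smul_eq_mul, RingHom.id_apply,
      mul_sub, Finset.mul_sum]
    congr 1
    · congr 1
      exact Finset.sum_congr rfl fun i _ => by ring
    · exact Finset.sum_congr rfl fun i _ => by ring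

theorem contDiff_Theta : ContDiff ℝ ∞ fun p : J m n × J m n => Theta p.1 p.2 := by
  unfold Theta
  refine ContDiff.sub (ContDiff.sub (by fun_prop) (ContDiff.sum fun i _ => ?_))
    (ContDiff.sum fun i _ => ?_)
  · exact ContDiff.mul (by fun_prop) (by fun_prop)
  · exact ContDiff.mul (by fun_prop) (by fun_prop)

/-- The coordinate vector field `∂_z`. -/
def dz (m n : ℕ) : J m n := (0, 0, 1, 0, 0)

@[simp] theorem Theta_dz (x : J m n) : Theta x (dz m n) = 1 := by simp [Theta, dz, tc, qc, zc]

end ContactForm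

/-! ### Restriction, composition and local quotients of contact embeddings. -/

section ContactEmbedding

variable {U U' : Set (J m n)} {C D : J m n → J m n}

theorem IsContactEmbedding.hasFDerivAt (hC : IsContactEmbedding U C) (hU : IsOpen U) {x : J m n}
    (hx : x ∈ U) : HasFDerivAt C (fderiv ℝ C x) x :=
  ((hC.smooth.contDiffAt (hU.mem_nhds hx)).differentiableAt (by simp)).hasFDerivAt

theorem IsContactEmbedding.continuousAt (hC : IsContactEmbedding U C) (hU : IsOpen U) {x : J m n}
    (hx : x ∈ U) : ContinuousAt C x := (hC.hasFDerivAt hU hx).continuousAt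

theorem IsContactEmbedding.injOn (hC : IsContactEmbedding U C) : Set.InjOn C U :=
  Set.injOn_iff_injective.2 hC.embedding.injective

theorem IsContactEmbedding.mono (hC : IsContactEmbedding U C) (h : U' ⊆ U) :
    IsContactEmbedding U' C where
  smooth := hC.smooth.mono h
  embedding := hC.embedding.comp (IsEmbedding.inclusion h)
  immersion x hx := hC.immersion x (h hx)
  contact x hx := hC.contact x (h hx)

theorem IsPForm.mono (hC : IsPForm U C) (h : U' ⊆ U) : IsPForm U' C where
  time x hx := hC.time x (h hx)
  base x hx y hy := hC.base x (h hx) y (h hy)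
  slope i x hx y hy := hC.slope i x (h hx) y (h hy)

theorem CT.mono (hC : C ∈ CT U) (h : U' ⊆ U) : C ∈ CT U' := ⟨hC.1.mono h, hC.2.mono h⟩

theorem CTTheta.mono (hC : C ∈ CTTheta U) (h : U' ⊆ U) : C ∈ CTTheta U' :=
  ⟨CT.mono hC.1 h, fun x hx => hC.2 x (h hx)⟩

theorem IsContactEmbedding.comp (hC : IsContactEmbedding U C) (hU : IsOpen U)
    (hD : IsContactEmbedding U' D) (hU' : IsOpen U') (h : Set.MapsTo D U' U) :
    IsContactEmbedding U' (C ∘ D) := by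
  have hfd : ∀ x ∈ U', fderiv ℝ (C ∘ D) x = (fderiv ℝ C (D x)).comp (fderiv ℝ D x) :=
    fun x hx => ((hC.hasFDerivAt hU (h hx)).comp x (hD.hasFDerivAt hU' hx)).fderiv
  refine ⟨hC.smooth.comp hD.smooth h, ?_, fun x hx => ?_, fun x hx => ?_⟩
  · exact hC.embedding.comp (hD.embedding.codRestrict U fun x => h x.2)
  · rw [hfd x hx]
    exact (hC.immersion _ (h hx)).comp (hD.immersion x hx)
  · obtain ⟨a, ha, ha'⟩ := hC.contact _ (h hx)
    obtain ⟨b, hb, hb'⟩ := hD.contact x hx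
    refine ⟨a * b, mul_ne_zero ha hb, fun v => ?_⟩
    rw [hfd x hx, ContinuousLinearMap.comp_apply, Function.comp_apply, ha', hb', mul_assoc]

theorem IsPForm.comp (hC : IsPForm U C) (hD : IsPForm U' D) (h : Set.MapsTo D U' U) :
    IsPForm U' (C ∘ D) where
  time x hx := (hC.time _ (h hx)).trans (hD.time x hx)
  base x hx y hy ht hq hz hp := by
    obtain ⟨h1, h2, h3⟩ := hD.base x hx y hy ht hq hz hp
    exact hC.base _ (h hx) _ (h hy) (by rw [hD.time x hx, hD.time y hy, ht]) h1 h2 h3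
  slope i x hx y hy ht hq hz hp hs := by
    obtain ⟨h1, h2, h3⟩ := hD.base x hx y hy ht hq hz hp
    exact hC.slope i _ (h hx) _ (h hy) (by rw [hD.time x hx, hD.time y hy, ht]) h1 h2 h3
      (hD.slope i x hx y hy ht hq hz hp hs)

theorem CT.comp (hC : C ∈ CT U) (hU : IsOpen U) (hD : D ∈ CT U') (hU' : IsOpen U')
    (h : Set.MapsTo D U' U) : C ∘ D ∈ CT U' :=
  ⟨hC.1.comp hU hD.1 hU' h, hC.2.comp hD.2 h⟩

theorem CTTheta.comp (hC : C ∈ CTTheta U) (hU : IsOpen U) (hD : D ∈ CTTheta U') (hU' : IsOpen U')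
    (h : Set.MapsTo D U' U) : C ∘ D ∈ CTTheta U' := by
  refine ⟨CT.comp hC.1 hU hD.1 hU' h, fun x hx v => ?_⟩
  rw [((hC.1.1.hasFDerivAt hU (h hx)).comp x (hD.1.1.hasFDerivAt hU' hx)).fderiv,
    ContinuousLinearMap.comp_apply, Function.comp_apply, hC.2 _ (h hx), hD.2 x hx]

theorem IsContactEmbedding.exists_equiv (hC : IsContactEmbedding U C) (hU : IsOpen U) {x : J m n}
    (hx : x ∈ U) : ∃ f' : J m n ≃L[ℝ] J m n, HasFDerivAt C (f' : J m n →L[ℝ] J m n) x := by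
  have hinj := hC.immersion x hx
  refine ⟨(LinearEquiv.ofInjectiveEndo (fderiv ℝ C x : J m n →ₗ[ℝ] J m n)
    hinj).toContinuousLinearEquiv, ?_⟩
  exact hC.hasFDerivAt hU hx

/-- The local quotient `D⁻¹ ∘ C` of two contact embeddings. -/
theorem IsContactEmbedding.exists_quotient (hC : IsContactEmbedding U C) (hU : IsOpen U)
    (hD : IsContactEmbedding U' D) (hU' : IsOpen U') {x y : J m n} (hy : y ∈ U) (hx : x ∈ U')
    (hxy : C y = D x) :
    ∃ (O : Set (J m n)) (Ψ : J m n → J m n), IsOpen O ∧ y ∈ O ∧ O ⊆ U ∧ Set.MapsTo Ψ O U' ∧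
      (∀ w ∈ O, D (Ψ w) = C w) ∧ Ψ y = x ∧ IsContactEmbedding O Ψ := by
  obtain ⟨f', hf'⟩ := hD.exists_equiv hU' hx
  obtain ⟨e, hxe, heU, heD, hes, -⟩ := exists_openPartialHomeomorph hU' hD.smooth hx hf'
  have hO : IsOpen (U ∩ C ⁻¹' e.target) :=
    hC.smooth.continuousOn.isOpen_inter_preimage hU e.open_target
  have hmaps : Set.MapsTo (e.symm ∘ C) (U ∩ C ⁻¹' e.target) U' :=
    fun w hw => heU (e.map_target hw.2)
  have hDe : ∀ w ∈ U ∩ C ⁻¹' e.target, D ((e.symm ∘ C) w) = C w := by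
    intro w hw
    rw [← heD]
    exact e.right_inv hw.2
  have hsm : ContDiffOn ℝ ∞ (e.symm ∘ C) (U ∩ C ⁻¹' e.target) :=
    hes.comp (hC.smooth.mono Set.inter_subset_left) fun w hw => hw.2
  have hΨd : ∀ w ∈ U ∩ C ⁻¹' e.target,
      fderiv ℝ C w = (fderiv ℝ D ((e.symm ∘ C) w)).comp (fderiv ℝ (e.symm ∘ C) w) := by
    intro w hw
    have h1 := ((hsm.contDiffAt (hO.mem_nhds hw)).differentiableAt (by simp)).hasFDerivAt
    have h2 := (hD.hasFDerivAt hU' (hmaps hw)).comp w h1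
    refine (h2.congr_of_eventuallyEq ?_).fderiv
    filter_upwards [hO.mem_nhds hw] with u hu using (hDe u hu).symm
  refine ⟨U ∩ C ⁻¹' e.target, e.symm ∘ C, hO, ⟨hy, ?_⟩, Set.inter_subset_left, hmaps, hDe, ?_,
    hsm, ?_, fun w hw => ?_, fun w hw => ?_⟩
  · rw [Set.mem_preimage, hxy, ← heD]
    exact e.map_source hxe
  · rw [Function.comp_apply, hxy, ← heD]
    exact e.left_inv hxe
  -- A continuous map whose composite with a continuous map is an embedding is an embedding; here
  -- the composite with `D` is `C`.
  · have h1 : Continuous fun w : (U ∩ C ⁻¹' e.target : Set (J m n)) => (e.symm ∘ C) w :=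
      hsm.continuousOn.domRestrict
    have h2 : Continuous fun w : (U ∩ C ⁻¹' e.target : Set (J m n)) =>
        (⟨(e.symm ∘ C) w, hmaps w.2⟩ : U') := h1.subtype_mk _
    have h3 : IsEmbedding ((fun x : U' => D x) ∘
        fun w : (U ∩ C ⁻¹' e.target : Set (J m n)) =>
          (⟨(e.symm ∘ C) w, hmaps w.2⟩ : U')) := by
      have : ((fun x : U' => D x) ∘ fun w : (U ∩ C ⁻¹' e.target : Set (J m n)) =>
          (⟨(e.symm ∘ C) w, hmaps w.2⟩ : U')) =
          fun w : (U ∩ C ⁻¹' e.target : Set (J m n)) => C w := funext fun w => hDe w w.2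
      rw [this]
      exact (hC.mono Set.inter_subset_left).embedding
    exact IsEmbedding.subtypeVal.comp (IsEmbedding.of_comp h2 hD.embedding.continuous h3)
  · have h := hC.immersion w hw.1
    rw [hΨd w hw] at h
    exact Function.Injective.of_comp h
  · obtain ⟨a, ha, ha'⟩ := hC.contact w hw.1
    obtain ⟨b, hb, hb'⟩ := hD.contact _ (hmaps hw)
    refine ⟨a / b, div_ne_zero ha hb, fun v => ?_⟩
    have h1 := ha' v
    rw [hΨd w hw, ContinuousLinearMap.comp_apply, ← hDe w hw, hb'] at h1
    field_simp
    linarith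

end ContactEmbedding

/-! ### Germs of configurations and base points. -/

section Config

variable {r : ℕ}

/-- The set germs of `f(L̃⁰_σ)` at `x` are contained in those of `g(L̃⁰_σ)` at `y`. -/
def ConfigLE (r : ℕ) (f : J m n → J m n) (x : J m n) (g : J m n → J m n) (y : J m n) : Prop :=
  ∀ σ ⊆ {i : Fin n | (i : ℕ) < r}, ∀ W ∈ 𝓝 y, ∃ W' ∈ 𝓝 x,
    f '' (L0 r σ ∩ W') ⊆ g '' (L0 r σ ∩ W)

theorem ConfigLE.trans {f g h : J m n → J m n} {x y z : J m n} (hfg : ConfigLE r f x g y)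
    (hgh : ConfigLE r g y h z) : ConfigLE r f x h z := by
  intro σ hσ W hW
  obtain ⟨W₁, hW₁, h₁⟩ := hgh σ hσ W hW
  obtain ⟨W₂, hW₂, h₂⟩ := hfg σ hσ W₁ hW₁
  exact ⟨W₂, hW₂, h₂.trans h₁⟩

theorem definesConfiguration_iff {f g : J m n → J m n} :
    DefinesConfiguration r f g ↔ ConfigLE r f 0 g 0 ∧ ConfigLE r g 0 f 0 := by
  constructor
  · intro h
    constructor
    · intro σ hσ W hW
      obtain ⟨W', hW', h1, -⟩ := h σ hσ W hW
      exact ⟨W', hW', h1⟩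
    · intro σ hσ W hW
      obtain ⟨W', hW', -, h1⟩ := h σ hσ W hW
      exact ⟨W', hW', h1⟩
  · rintro ⟨h1, h2⟩ σ hσ W hW
    obtain ⟨W₁, hW₁, h₁⟩ := h1 σ hσ W hW
    obtain ⟨W₂, hW₂, h₂⟩ := h2 σ hσ W hW
    exact ⟨W₁ ∩ W₂, inter_mem hW₁ hW₂,
      (Set.image_mono (Set.inter_subset_inter_right _ Set.inter_subset_left)).trans h₁,
      (Set.image_mono (Set.inter_subset_inter_right _ Set.inter_subset_right)).trans h₂⟩

theorem configLE_of_eventually_comp {f g ψ : J m n → J m n} {x y : J m n} (hψ : ContinuousAt ψ x)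
    (hxy : ψ x = y) (h : ∀ σ ⊆ {i : Fin n | (i : ℕ) < r}, ∀ᶠ w in 𝓝 x, w ∈ L0 r σ →
      ψ w ∈ L0 r σ ∧ g (ψ w) = f w) : ConfigLE r f x g y := by
  intro σ hσ W hW
  refine ⟨_, inter_mem (h σ hσ) (hψ (hxy ▸ hW)), ?_⟩
  rintro _ ⟨w, ⟨hw, hw1, hw2⟩, rfl⟩
  exact ⟨ψ w, ⟨(hw1 hw).1, hw2⟩, (hw1 hw).2⟩

/-- The points `(T, 0, …, 0, P⁰_{r+1}, …, P⁰_n)`. -/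
def IsBasePoint (r : ℕ) (x : J m n) : Prop :=
  qc x = 0 ∧ zc x = 0 ∧ sc x = 0 ∧ ∀ i : Fin n, (i : ℕ) < r → pc x i = 0

theorem isBasePoint_zero : IsBasePoint r (0 : J m n) := ⟨rfl, rfl, rfl, fun _ _ => rfl⟩

theorem IsBasePoint.mem_L0 {x : J m n} (hx : IsBasePoint r x) (σ : Set (Fin n)) :
    x ∈ L0 r σ := by
  obtain ⟨hq, hz, hs, hp⟩ := hx
  refine ⟨fun i _ _ => congrFun hq i, fun i hi _ => ⟨hp i hi, (congrFun hq i).ge⟩,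
    fun i _ => congrFun hq i, hs, hz⟩

/-- Base points are the common points of all strata: σ = ∅ kills p_i and σ = I_r kills q_i for i in
I_r. Hence maps that preserve the strata preserve base points. -/
theorem isBasePoint_of_forall_mem_L0 {x : J m n}
    (hx : ∀ σ ⊆ {i : Fin n | (i : ℕ) < r}, x ∈ L0 r σ) : IsBasePoint r x := by
  obtain ⟨-, h1, -, -, -⟩ := hx ∅ (Set.empty_subset _)
  obtain ⟨h2, -, h3, h4, h5⟩ := hx _ subset_rfl
  refine ⟨funext fun i => ?_, h5, h4, fun i hi => (h1 i hi (Set.notMem_empty i)).1⟩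
  rcases lt_or_ge (i : ℕ) r with hi | hi
  · exact h2 i hi hi
  · exact h3 i hi

theorem L0_subset_LL (σ : Set (Fin n)) : L0 (m := m) r σ ⊆ LL m n r := by
  rintro x ⟨h1, h2, h3, h4, h5⟩
  refine ⟨fun i hi => ?_, h3, h4, h5⟩
  by_cases h : i ∈ σ
  · simp [h1 i hi h]
  · simp [(h2 i hi h).1, (h2 i hi h).2]

theorem exists_mem_L0_of_mem_LL {x : J m n} (hx : x ∈ LL m n r) :
    ∃ σ ⊆ {i : Fin n | (i : ℕ) < r}, x ∈ L0 r σ := by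
  obtain ⟨h1, h2, h3, h4⟩ := hx
  refine ⟨{i | (i : ℕ) < r ∧ qc x i = 0}, fun i hi => hi.1, fun i _ hi => hi.2,
    fun i hi hi' => ⟨?_, (h1 i hi).2⟩, h2, h3, h4⟩
  exact (mul_eq_zero.1 (h1 i hi).1).resolve_left fun h => hi' ⟨hi, h⟩

theorem Extends.definesConfiguration {f g : J m n → J m n} (h : Extends r f g) :
    DefinesConfiguration r f g := by
  intro σ _ W hW
  obtain ⟨W', hW', h'⟩ := mem_nhdsWithin_iff_exists_mem_nhds_inter.1 h
  have h'' : ∀ x ∈ L0 r σ ∩ (W' ∩ W), f x = g x := fun x hx => h' ⟨hx.2.1, L0_subset_LL σ hx.1⟩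
  refine ⟨W' ∩ W, inter_mem hW' hW, ?_, ?_⟩
  · rintro _ ⟨x, hx, rfl⟩
    exact ⟨x, ⟨hx.1, hx.2.2⟩, (h'' x hx).symm⟩
  · rintro _ ⟨x, hx, rfl⟩
    exact ⟨x, ⟨hx.1, hx.2.2⟩, h'' x hx⟩

/-- If the values differed, `g` would avoid `f x` near `y`, although `x` lies in every stratum. So a
comparison of configurations already supplies the common value needed to form a quotient. -/
theorem ConfigLE.apply_eq {f g : J m n → J m n} {x y : J m n} (h : ConfigLE r f x g y)
    (hg : ContinuousAt g y) (hx : IsBasePoint r x) : f x = g y := by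
  by_contra hne
  have hW : g ⁻¹' {f x}ᶜ ∈ 𝓝 y := hg (isOpen_compl_singleton.mem_nhds (Ne.symm hne))
  obtain ⟨W', hW', h'⟩ := h ∅ (Set.empty_subset _) _ hW
  obtain ⟨w, hw, hw'⟩ := h' ⟨x, ⟨hx.mem_L0 _, mem_of_mem_nhds hW'⟩, rfl⟩
  exact hw.2 hw'

/-- Equal germs of images pull back to equal germs in the source, because both maps are injective.
Each inclusion of configurations gives one direction. -/
theorem eventually_mem_L0_iff_of_quotient {U U' O : Set (J m n)} {C D Ψ : J m n → J m n}
    {x y : J m n} (hU' : IsOpen U') (hC : Set.InjOn C U) (hD : Set.InjOn D U')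
    (hO : IsOpen O) (hyO : y ∈ O) (hOU : O ⊆ U) (hmaps : Set.MapsTo Ψ O U')
    (hΨ : ∀ w ∈ O, D (Ψ w) = C w) (hΨy : Ψ y = x) (hΨc : ContinuousAt Ψ y)
    (hCD : ConfigLE r C y D x) (hDC : ConfigLE r D x C y) :
    ∀ σ ⊆ {i : Fin n | (i : ℕ) < r}, ∀ᶠ w in 𝓝 y, Ψ w ∈ L0 r σ ↔ w ∈ L0 r σ := by
  intro σ hσ
  have hxU' : x ∈ U' := hΨy ▸ hmaps hyO
  obtain ⟨W₁, hW₁, h₁⟩ := hCD σ hσ U' (hU'.mem_nhds hxU')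
  obtain ⟨W₂, hW₂, h₂⟩ := hDC σ hσ O (hO.mem_nhds hyO)
  filter_upwards [hO.mem_nhds hyO, hW₁, hΨc (hΨy ▸ hW₂)] with w hwO hw1 hw2
  constructor
  · intro h
    obtain ⟨u, hu, hu'⟩ := h₂ ⟨Ψ w, ⟨h, hw2⟩, rfl⟩
    rw [hΨ w hwO] at hu'
    exact hC (hOU hu.2) (hOU hwO) hu' ▸ hu.1
  · intro h
    obtain ⟨u, hu, hu'⟩ := h₁ ⟨w, ⟨h, hw1⟩, rfl⟩
    rw [← hΨ w hwO] at hu'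
    exact hD hu.2 (hmaps hwO) hu' ▸ hu.1

end Config

/-! ### Contact translations, and equivalence of germs with equal configurations. -/

section Translation

variable {r : ℕ}

/-- The linear part of `contactTranslate w`. -/
noncomputable def translateL (w : J m n) : J m n →L[ℝ] J m n :=
  LinearMap.toContinuousLinearMap
    { toFun := fun x => (tc x, qc x, zc x + ∑ i, pc w i * qc x i + ∑ i, sc w i * tc x i,
        sc x, pc x)
      map_add' := fun x y => by
        simp only [tc, qc, zc, sc, pc, Prod.fst_add, Prod.snd_add, Pi.add_apply, mul_add, Finset.sum_add_distrib,
          Prod.mk_add_mk]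
        congr 3; ring
      map_smul' := fun c x => by
        simp only [tc, qc, zc, sc, pc, Prod.smul_fst, Prod.smul_snd, Pi.smul_apply, smul_eq_mul, RingHom.id_apply,
          Prod.smul_mk, mul_add, Finset.mul_sum]
        congr 4
        · congr 1
          exact Finset.sum_congr rfl fun i _ => by ring
        · exact Finset.sum_congr rfl fun i _ => by ring }

theorem translateL_apply (w x : J m n) : translateL w x =
    (tc x, qc x, zc x + ∑ i, pc w i * qc x i + ∑ i, sc w i * tc x i, sc x, pc x) := rfl

theorem contactTranslate_eq (w x : J m n) : contactTranslate w x = w + translateL w x := by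
  simp only [contactTranslate, translateL_apply, Prod.ext_iff, Prod.fst_add, Prod.snd_add, tc, qc,
    zc, sc, pc, true_and, and_true]
  ring

theorem contactTranslateBack_contactTranslate (w x : J m n) :
    contactTranslateBack w (contactTranslate w x) = x := by
  simp only [contactTranslate, contactTranslateBack, Prod.ext_iff, tc, qc, zc, sc, pc,
    add_sub_cancel_left, Pi.add_apply, true_and, and_true]
  ring

theorem contactTranslate_contactTranslateBack (w y : J m n) :
    contactTranslate w (contactTranslateBack w y) = y := by
  simp only [contactTranslate, contactTranslateBack, Prod.ext_iff, tc, qc, zc, sc, pc,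
    add_sub_cancel, Pi.sub_apply, true_and, and_true]
  ring

theorem hasFDerivAt_contactTranslate (w x : J m n) :
    HasFDerivAt (contactTranslate w) (translateL w) x := by
  have : contactTranslate w = fun x => w + translateL w x := funext (contactTranslate_eq w)
  rw [this]
  exact (translateL w).hasFDerivAt.const_add w

theorem contDiff_contactTranslate (w : J m n) : ContDiff ℝ ∞ (contactTranslate w) := by
  have : contactTranslate w = fun x => w + translateL w x := funext (contactTranslate_eq w)
  rw [this]
  exact contDiff_const.add (translateL w).contDiff

theorem contDiff_contactTranslateBack (w : J m n) : ContDiff ℝ ∞ (contactTranslateBack w) := by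
  unfold contactTranslateBack
  refine ContDiff.prodMk (by fun_prop) (ContDiff.prodMk (by fun_prop)
    (ContDiff.prodMk ?_ (by fun_prop)))
  refine ContDiff.sub (ContDiff.sub (by fun_prop) (ContDiff.sum fun i _ => ?_))
    (ContDiff.sum fun i _ => ?_)
  · exact ContDiff.mul (by fun_prop) (by fun_prop)
  · exact ContDiff.mul (by fun_prop) (by fun_prop)

theorem translateL_injective (w : J m n) : Function.Injective (translateL w) := by
  intro x y h
  have := congrArg (fun z => contactTranslateBack w (w + z)) h
  simpa only [← contactTranslate_eq, contactTranslateBack_contactTranslate] using this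

theorem Theta_contactTranslate (w x v : J m n) :
    Theta (contactTranslate w x) (translateL w v) = Theta x v := by
  simp only [Theta, contactTranslate, translateL_apply, pc, qc, zc, sc, tc, Pi.add_apply, add_mul,
    Finset.sum_add_distrib]
  ring

theorem isContactEmbedding_contactTranslate (w : J m n) (U : Set (J m n)) :
    IsContactEmbedding U (contactTranslate w) where
  smooth := (contDiff_contactTranslate w).contDiffOn
  embedding := (Function.LeftInverse.isEmbedding (contactTranslateBack_contactTranslate w)
    (contDiff_contactTranslateBack w).continuous
    (contDiff_contactTranslate w).continuous).comp IsEmbedding.subtypeVal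
  immersion x _ := by
    rw [(hasFDerivAt_contactTranslate w x).fderiv]
    exact translateL_injective w
  contact x _ := ⟨1, one_ne_zero, fun v => by
    rw [(hasFDerivAt_contactTranslate w x).fderiv, Theta_contactTranslate, one_mul]⟩

theorem isContactEmbedding_contactTranslateBack (w : J m n) (U : Set (J m n)) :
    IsContactEmbedding U (contactTranslateBack w) := by
  have hcomp : ∀ x, (translateL w).comp (fderiv ℝ (contactTranslateBack w) x) =
      ContinuousLinearMap.id ℝ (J m n) := by
    intro x
    have h1 := ((contDiff_contactTranslateBack w).differentiable (by simp) x).hasFDerivAt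
    have h2 := (hasFDerivAt_contactTranslate w (contactTranslateBack w x)).comp x h1
    have h3 : contactTranslate w ∘ contactTranslateBack w = id :=
      funext (contactTranslate_contactTranslateBack w)
    rw [h3] at h2
    exact h2.unique (hasFDerivAt_id x)
  refine ⟨(contDiff_contactTranslateBack w).contDiffOn,
    (Function.LeftInverse.isEmbedding (contactTranslate_contactTranslateBack w)
      (contDiff_contactTranslate w).continuous
      (contDiff_contactTranslateBack w).continuous).comp IsEmbedding.subtypeVal,
    fun x _ => ?_, fun x _ => ⟨1, one_ne_zero, fun v => ?_⟩⟩
  · refine Function.LeftInverse.injective (g := translateL w) fun v => ?_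
    exact congrArg (fun T : J m n →L[ℝ] J m n => T v) (hcomp x)
  · rw [← Theta_contactTranslate w, contactTranslate_contactTranslateBack, one_mul]
    exact congrArg (fun T : J m n →L[ℝ] J m n => Theta x (T v)) (hcomp x)

theorem contactTranslate_zero (w : J m n) : contactTranslate w 0 = w := by
  rw [contactTranslate_eq, map_zero, add_zero]

theorem contactTranslateBack_self (w : J m n) : contactTranslateBack w w = 0 := by
  conv_lhs => rw [← contactTranslate_zero w, contactTranslate_zero w]
  nth_rewrite 2 [← contactTranslate_zero w]
  exact contactTranslateBack_contactTranslate w 0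

/-- The correction in z vanishes on the strata: for each i, either p_i of the base point is 0 (i in
I_r) or q_i = 0 on the stratum, and s of the base point is 0. -/
theorem IsBasePoint.contactTranslate_mem_L0_iff {w : J m n} (hw : IsBasePoint r w)
    {σ : Set (Fin n)} {x : J m n} : contactTranslate w x ∈ L0 r σ ↔ x ∈ L0 r σ := by
  obtain ⟨hq, hz, hs, hp⟩ := hw
  have hq' : qc (contactTranslate w x) = qc x := by
    change qc w + qc x = qc x
    rw [hq, zero_add]
  have hs' : sc (contactTranslate w x) = sc x := by
    change sc w + sc x = sc x
    rw [hs, zero_add]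
  have hp' : ∀ i : Fin n, (i : ℕ) < r → pc (contactTranslate w x) i = pc x i := by
    intro i hi
    change pc w i + pc x i = pc x i
    rw [hp i hi, zero_add]
  have hz' : (∀ i : Fin n, (i : ℕ) < r → pc w i * qc x i = 0) →
      (∀ i : Fin n, r ≤ (i : ℕ) → qc x i = 0) → zc (contactTranslate w x) = zc x := by
    intro h1 h2
    change zc w + zc x + ∑ i, pc w i * qc x i + ∑ i, sc w i * tc x i = zc x
    have h3 : ∑ i, pc w i * qc x i = 0 := Finset.sum_eq_zero fun i _ => by
      rcases lt_or_ge (i : ℕ) r with hi | hi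
      · exact h1 i hi
      · rw [h2 i hi, mul_zero]
    rw [h3, hz, hs]
    simp
  have h1 : ∀ i : Fin n, (i : ℕ) < r → pc w i * qc x i = 0 := fun i hi => by
    rw [hp i hi, zero_mul]
  unfold L0
  simp only [Set.mem_ofPred_eq, hq', hs']
  constructor
  · rintro ⟨a1, a2, a3, a4, a5⟩
    refine ⟨a1, fun i hi hi' => ?_, a3, a4, ?_⟩
    · rw [← hp' i hi]; exact a2 i hi hi'
    · rw [← hz' h1 a3]; exact a5
  · rintro ⟨a1, a2, a3, a4, a5⟩
    refine ⟨a1, fun i hi hi' => ?_, a3, a4, ?_⟩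
    · rw [hp' i hi]; exact a2 i hi hi'
    · rw [hz' h1 a3]; exact a5

theorem IsBasePoint.contactTranslate_mem_LL {w x : J m n} (hw : IsBasePoint r w)
    (hx : x ∈ LL m n r) : contactTranslate w x ∈ LL m n r := by
  obtain ⟨σ, -, h⟩ := exists_mem_L0_of_mem_LL hx
  exact L0_subset_LL σ (hw.contactTranslate_mem_L0_iff.2 h)

/-- `𝒫`-Legendrian equivalence to `ℒ` passes between germs with the same configuration. -/
theorem PLegendrianEquivalent.of_configLE {U U' : Set (J m n)} {C D ℒ : J m n → J m n}
    {x y : J m n} (hU : IsOpen U) (hU' : IsOpen U') (hC : IsContactEmbedding U C)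
    (hD : IsContactEmbedding U' D) (hCt : ∀ w ∈ U, tc (C w) = tc w)
    (hDt : ∀ w ∈ U', tc (D w) = tc w) (hyU : y ∈ U) (hxU : x ∈ U') (hy : IsBasePoint r y)
    (hx : IsBasePoint r x) (hCD : ConfigLE r C y D x) (hDC : ConfigLE r D x C y)
    (h : PLegendrianEquivalent r (germAt D x) ℒ) : PLegendrianEquivalent r (germAt C y) ℒ := by
  have hxy : C y = D x := hCD.apply_eq (hD.continuousAt hU' hxU) hy
  obtain ⟨O, Ψ, hO, hyO, hOU, hmaps, hΨ, hΨy, hΨC⟩ := hC.exists_quotient hU hD hU' hyU hxU hxy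
  have hL := eventually_mem_L0_iff_of_quotient hU' hC.injOn hD.injOn hO hyO hOU hmaps hΨ hΨy
    (hΨC.continuousAt hO hyO) hCD hDC
  have hΨt : ∀ w ∈ O, tc (Ψ w) = tc w := fun w hw => by
    rw [← hDt _ (hmaps hw), hΨ w hw, hCt w (hOU hw)]
  obtain ⟨K, Ψ₂, hK, ⟨hΨ₂0, U₂, hU₂, h0U₂, hΨ₂C, hΨ₂t, hΨ₂L⟩, hev⟩ := h
  have hτc : Continuous (contactTranslate y) := (contDiff_contactTranslate y).continuous
  set O₁ : Set (J m n) := contactTranslate y ⁻¹' O with hO₁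
  have hO₁o : IsOpen O₁ := hO.preimage hτc
  -- Since C = D ∘ Ψ near y and C y = D x, the germ of `C` at y is the germ of `D` at x precomposed
  -- with `Φ`. Thus `K` stays the same and `Ψ₂` becomes `Ψ₂ ∘ Φ`.
  set Φ : J m n → J m n := contactTranslateBack x ∘ Ψ ∘ contactTranslate y with hΦ
  have hΦC : IsContactEmbedding O₁ Φ :=
    (isContactEmbedding_contactTranslateBack x Set.univ).comp isOpen_univ
      (hΨC.comp hO (isContactEmbedding_contactTranslate y O₁) hO₁o fun w hw => hw) hO₁o
      fun _ _ => Set.mem_univ _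
  have hΦ0 : Φ 0 = 0 := by
    simp only [hΦ, Function.comp_apply, contactTranslate_zero, hΨy, contactTranslateBack_self]
  have h0O₁ : (0 : J m n) ∈ O₁ := by
    rw [hO₁, Set.mem_preimage, contactTranslate_zero]; exact hyO
  have hΦc : ContinuousAt Φ 0 := hΦC.continuousAt hO₁o h0O₁
  have hτ0 : Tendsto (contactTranslate y) (𝓝 0) (𝓝 y) := by
    have := hτc.tendsto 0
    rwa [contactTranslate_zero] at this
  have hΦL : ∀ σ ⊆ {i : Fin n | (i : ℕ) < r}, ∀ᶠ w in 𝓝 (0 : J m n),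
      Φ w ∈ L0 r σ ↔ w ∈ L0 r σ := by
    intro σ hσ
    filter_upwards [hτ0.eventually (hL σ hσ)] with w hw
    rw [← hx.contactTranslate_mem_L0_iff, hΦ]
    simp only [Function.comp_apply, contactTranslate_contactTranslateBack]
    rw [hw, hy.contactTranslate_mem_L0_iff]
  have hΦt : ∀ w ∈ O₁, tc (Φ w) = tc y + tc w - tc x := by
    intro w hw
    change tc (Ψ (contactTranslate y w)) - tc x = _
    rw [hΨt _ hw]
    rfl
  have hO₂ : IsOpen (O₁ ∩ Φ ⁻¹' U₂) := hΦC.smooth.continuousOn.isOpen_inter_preimage hO₁o hU₂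
  refine ⟨K, Ψ₂ ∘ Φ, hK, ⟨by rw [Function.comp_apply, hΦ0, hΨ₂0], O₁ ∩ Φ ⁻¹' U₂, hO₂,
    ⟨h0O₁, by rwa [Set.mem_preimage, hΦ0]⟩,
    hΨ₂C.comp hU₂ (hΦC.mono Set.inter_subset_left) hO₂ fun w hw => hw.2, ?_, ?_⟩, ?_⟩
  · intro a ha b hb hab
    exact hΨ₂t _ ha.2 _ hb.2 (by rw [hΦt a ha.1, hΦt b hb.1, hab])
  · intro σ hσ
    have h1 : ∀ᶠ w in 𝓝 0, Ψ₂ (Φ w) ∈ L0 r σ ↔ Φ w ∈ L0 r σ := by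
      have h2 : Tendsto Φ (𝓝 0) (𝓝 0) := by simpa only [hΦ0] using hΦc.tendsto
      exact h2.eventually (hΨ₂L σ hσ)
    filter_upwards [h1, hΦL σ hσ] with w hw1 hw2
    rw [Function.comp_apply, hw1, hw2]
  · have hLL : Tendsto Φ (𝓝[LL m n r] 0) (𝓝[LL m n r] 0) := by
      refine tendsto_nhdsWithin_iff.2 ⟨?_, ?_⟩
      · have h2 : Tendsto Φ (𝓝 0) (𝓝 0) := by simpa only [hΦ0] using hΦc.tendsto
        exact h2.mono_left nhdsWithin_le_nhds
      · have hall : ∀ᶠ w in 𝓝 (0 : J m n), ∀ σ : Set (Fin n), σ ⊆ {i : Fin n | (i : ℕ) < r} →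
            (Φ w ∈ L0 r σ ↔ w ∈ L0 r σ) :=
          eventually_all.2 fun σ => by
            by_cases hσ : σ ⊆ {i : Fin n | (i : ℕ) < r}
            · filter_upwards [hΦL σ hσ] with w hw _ using hw
            · exact Eventually.of_forall fun w h => absurd h hσ
        filter_upwards [nhdsWithin_le_nhds hall, self_mem_nhdsWithin] with w hw hwL
        obtain ⟨σ, hσ, hwσ⟩ := exists_mem_L0_of_mem_LL hwL
        exact L0_subset_LL σ ((hw σ hσ).2 hwσ)
    filter_upwards [hLL.eventually hev, nhdsWithin_le_nhds (hO₁o.mem_nhds h0O₁)] with w hw hwO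
    rw [Function.comp_apply, ← hw]
    simp only [germAt, hΦ, Function.comp_apply, contactTranslate_contactTranslateBack]
    rw [hΨ _ hwO, hxy]

theorem PLegendrianEquivalent.congr_left {f g ℒ : J m n → J m n}
    (hfg : ∀ᶠ x in 𝓝[LL m n r] 0, f x = g x) (h : PLegendrianEquivalent r f ℒ) :
    PLegendrianEquivalent r g ℒ := by
  obtain ⟨K, Ψ, hK, hΨ, hev⟩ := h
  refine ⟨K, Ψ, hK, hΨ, ?_⟩
  filter_upwards [hev, hfg] with x hx hxfg
  rw [← hxfg, hx]

end Translation

/-! ### How members of `CT` depend on s, and their quotients. -/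

section BaseMap

variable {U U' : Set (J m n)} {C D : J m n → J m n}

/-- The projection along `s`. -/
noncomputable def baseL (m n : ℕ) :
    J m n →L[ℝ] (Fin m → ℝ) × (Fin n → ℝ) × ℝ × (Fin n → ℝ) :=
  LinearMap.toContinuousLinearMap
    { toFun := fun x => (tc x, qc x, zc x, pc x)
      map_add' := fun _ _ => rfl
      map_smul' := fun _ _ => rfl }

theorem baseL_apply (x : J m n) : baseL m n x = (tc x, qc x, zc x, pc x) := rfl

theorem baseL_eq_iff {x y : J m n} : baseL m n x = baseL m n y ↔
    tc x = tc y ∧ qc x = qc y ∧ zc x = zc y ∧ pc x = pc y := by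
  simp only [baseL_apply, Prod.mk.injEq]

theorem eq_of_baseL_eq {x y : J m n} (h : baseL m n x = baseL m n y) (hs : sc x = sc y) :
    x = y := by
  obtain ⟨h1, h2, h3, h4⟩ := baseL_eq_iff.1 h
  exact Prod.ext h1 (Prod.ext h2 (Prod.ext h3 (Prod.ext hs h4)))

theorem IsPForm.baseL_eq (hC : IsPForm U C) {x y : J m n} (hx : x ∈ U) (hy : y ∈ U)
    (h : baseL m n x = baseL m n y) : baseL m n (C x) = baseL m n (C y) := by
  obtain ⟨h1, h2, h3, h4⟩ := baseL_eq_iff.1 h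
  obtain ⟨g2, g3, g4⟩ := hC.base x hx y hy h1 h2 h3 h4
  exact baseL_eq_iff.2 ⟨by rw [hC.time x hx, hC.time y hy, h1], g2, g3, g4⟩

/-- Near x, the base components of `C` agree with those of its translate by y - x, which moves only
s. -/
theorem CT.baseL_fderiv_eq (hC : C ∈ CT U) (hU : IsOpen U) {x y : J m n} (hx : x ∈ U)
    (hy : y ∈ U) (h : baseL m n x = baseL m n y) (v : J m n) :
    baseL m n (fderiv ℝ C x v) = baseL m n (fderiv ℝ C y v) := by
  have hxy : x + (y - x) = y := by abel
  have h1 := (baseL m n).hasFDerivAt.comp x (hC.1.hasFDerivAt hU hx)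
  have h2 : HasFDerivAt (fun w => C (w + (y - x))) (fderiv ℝ C y) x := by
    have h3 : HasFDerivAt C (fderiv ℝ C y) (id x + (y - x)) := by
      rw [id, hxy]
      exact hC.1.hasFDerivAt hU hy
    exact h3.comp x ((hasFDerivAt_id x).add_const (y - x))
  have h4 := (baseL m n).hasFDerivAt.comp x h2
  have hev : (baseL m n ∘ C) =ᶠ[𝓝 x] (baseL m n ∘ fun w => C (w + (y - x))) := by
    have hc : ContinuousAt (fun w : J m n => w + (y - x)) x := by fun_prop
    filter_upwards [hU.mem_nhds hx, hc (hxy.symm ▸ hU.mem_nhds hy)] with w hw hw'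
    refine hC.2.baseL_eq hw hw' ?_
    rw [map_add, map_sub, h, sub_self, add_zero]
  exact congrArg (fun T : J m n →L[ℝ] _ => T v) (h1.unique (h4.congr_of_eventuallyEq hev))

theorem IsPForm.tc_fderiv (hC : C ∈ CT U) (hU : IsOpen U) {x : J m n} (hx : x ∈ U) (v : J m n) :
    tc (fderiv ℝ C x v) = tc v := by
  have h1 := (ContinuousLinearMap.fst ℝ (Fin m → ℝ)
    ((Fin n → ℝ) × ℝ × (Fin m → ℝ) × (Fin n → ℝ))).hasFDerivAt.comp x (hC.1.hasFDerivAt hU hx)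
  have h2 : HasFDerivAt (ContinuousLinearMap.fst ℝ (Fin m → ℝ)
      ((Fin n → ℝ) × ℝ × (Fin m → ℝ) × (Fin n → ℝ)) ∘ C)
      (ContinuousLinearMap.fst ℝ (Fin m → ℝ) _) x := by
    refine (ContinuousLinearMap.fst ℝ (Fin m → ℝ)
      ((Fin n → ℝ) × ℝ × (Fin m → ℝ) × (Fin n → ℝ))).hasFDerivAt.congr_of_eventuallyEq ?_
    filter_upwards [hU.mem_nhds hx] with w hw using hC.2.time w hw
  exact congrArg (fun T : J m n →L[ℝ] _ => T v) (h1.unique h2)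

/-- The conformal factor `α` of a contact embedding, `C^*Θ = α Θ`. -/
noncomputable def conformalFactor (C : J m n → J m n) (x : J m n) : ℝ :=
  Theta (C x) (fderiv ℝ C x (dz m n))

theorem IsContactEmbedding.Theta_fderiv (hC : IsContactEmbedding U C) {x : J m n} (hx : x ∈ U)
    (v : J m n) : Theta (C x) (fderiv ℝ C x v) = conformalFactor C x * Theta x v := by
  obtain ⟨a, -, ha⟩ := hC.contact x hx
  rw [conformalFactor, ha, ha, Theta_dz, mul_one]

theorem IsContactEmbedding.conformalFactor_ne_zero (hC : IsContactEmbedding U C) {x : J m n}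
    (hx : x ∈ U) : conformalFactor C x ≠ 0 := by
  obtain ⟨a, ha0, ha⟩ := hC.contact x hx
  rwa [conformalFactor, ha, Theta_dz, mul_one]

theorem IsContactEmbedding.contDiffOn_Theta_fderiv (hC : IsContactEmbedding U C) (hU : IsOpen U)
    (v : J m n) : ContDiffOn ℝ ∞ (fun x => Theta (C x) (fderiv ℝ C x v)) U :=
  contDiff_Theta.comp_contDiffOn
    (hC.smooth.prodMk ((hC.smooth.fderiv_of_isOpen hU (m := ∞) (by simp)).clm_apply
      contDiffOn_const))

/-- The value of the contact form without the contribution of the slope coordinates `s`. -/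
noncomputable def ThetaBase (x v : J m n) : ℝ := zc v - ∑ i, pc x i * qc v i

theorem ThetaBase_congr {x y v w : J m n} (hxy : baseL m n x = baseL m n y)
    (hvw : baseL m n v = baseL m n w) : ThetaBase x v = ThetaBase y w := by
  obtain ⟨-, h2, h3, -⟩ := baseL_eq_iff.1 hvw
  obtain ⟨-, -, -, h4⟩ := baseL_eq_iff.1 hxy
  rw [ThetaBase, ThetaBase, h2, h3, h4]

/-- The image of ∂_z has no t-component, so the slopes s drop out of Θ and only base data remain. -/
theorem CT.conformalFactor_congr (hC : C ∈ CT U) (hU : IsOpen U) {x y : J m n} (hx : x ∈ U)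
    (hy : y ∈ U) (h : baseL m n x = baseL m n y) : conformalFactor C x = conformalFactor C y := by
  have key : ∀ w ∈ U, conformalFactor C w = ThetaBase (C w) (fderiv ℝ C w (dz m n)) := by
    intro w hw
    rw [conformalFactor, Theta, IsPForm.tc_fderiv hC hU hw, ThetaBase]
    simp [dz, tc]
  rw [key x hx, key y hy]
  exact ThetaBase_congr (hC.2.baseL_eq hx hy h) (CT.baseL_fderiv_eq hC hU hx hy h _)

/-- The coordinate vector field `∂_{t_i}`. -/
noncomputable def dt (n : ℕ) {m : ℕ} (i : Fin m) : J m n := (Pi.single i 1, 0, 0, 0, 0)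

theorem Theta_of_tc_single {x v : J m n} {i : Fin m} (hv : tc v = Pi.single i 1) :
    Theta x v = ThetaBase x v - sc x i := by
  rw [Theta, ThetaBase, hv]
  simp [Pi.single_apply]

/-- The slope component of a member of `C_T` is affine in `s`. -/
theorem CT.sc_apply (hC : C ∈ CT U) (hU : IsOpen U) {x : J m n} (hx : x ∈ U) (i : Fin m) :
    sc (C x) i = ThetaBase (C x) (fderiv ℝ C x (dt n i)) + conformalFactor C x * sc x i := by
  have h1 := hC.1.Theta_fderiv hx (dt n i)
  rw [Theta_of_tc_single (i := i) (IsPForm.tc_fderiv hC hU hx _),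
    Theta_of_tc_single (x := x) (v := dt n i) (i := i) rfl] at h1
  have h2 : ThetaBase x (dt n i) = 0 := by simp [ThetaBase, dt, zc, qc]
  rw [h2] at h1
  linarith

/-- This is what makes the quotient D⁻¹ ∘ C respect the projection along s. Given u and w with equal
base images, move w along its s-fibre until the slope of its image is that of `D u`. The equation is
affine in s with nonzero coefficient, and its solution `Y (u, w)` is near x when u and w are.
Injectivity of `D` then gives `Y (u, w)` = u, so u and w have the same base. -/
theorem CT.exists_baseL_injOn (hD : D ∈ CT U') (hU' : IsOpen U') {x : J m n} (hx : x ∈ U') :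
    ∃ W : Set (J m n), IsOpen W ∧ x ∈ W ∧ W ⊆ U' ∧
      ∀ u ∈ W, ∀ w ∈ W, baseL m n (D u) = baseL m n (D w) → baseL m n u = baseL m n w := by
  let k : Fin m → J m n → ℝ := fun i u => ThetaBase (D u) (fderiv ℝ D u (dt n i))
  have hα : ContinuousAt (conformalFactor D) x :=
    (hD.1.contDiffOn_Theta_fderiv hU' (dz m n)).continuousOn.continuousAt (hU'.mem_nhds hx)
  have hDc : ContinuousAt D x := hD.1.continuousAt hU' hx
  have hk : ∀ i, ContinuousAt (k i) x := by
    intro i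
    have h1 : ContinuousAt (fun u => Theta (D u) (fderiv ℝ D u (dt n i)) + sc (D u) i) x :=
      ((hD.1.contDiffOn_Theta_fderiv hU' (dt n i)).continuousOn.continuousAt
        (hU'.mem_nhds hx)).add (((continuous_apply i).comp
          (by fun_prop : Continuous fun u : J m n => u.2.2.2.1)).continuousAt.comp hDc)
    refine h1.congr ?_
    filter_upwards [hU'.mem_nhds hx] with u hu
    rw [Theta_of_tc_single (i := i) (IsPForm.tc_fderiv hD hU' hu _)]
    simp [k]
  let s : J m n × J m n → Fin m → ℝ := fun p i =>
    (sc (D p.1) i - k i p.2) / conformalFactor D p.2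
  let Y : J m n × J m n → J m n := fun p => (tc p.2, qc p.2, zc p.2, s p, pc p.2)
  have hα0 : conformalFactor D x ≠ 0 := hD.1.conformalFactor_ne_zero hx
  have hs : ContinuousAt s (x, x) := by
    refine continuousAt_pi.2 fun i => ?_
    have h1 : ContinuousAt (fun p : J m n × J m n => sc (D p.1) i) (x, x) :=
      ContinuousAt.comp (f := D ∘ Prod.fst) (g := fun u : J m n => u.2.2.2.1 i)
        (by fun_prop)
        (ContinuousAt.comp (g := D) (f := Prod.fst) (x := (x, x)) hDc continuousAt_fst)
    have h2 : ContinuousAt (fun p : J m n × J m n => k i p.2) (x, x) :=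
      ContinuousAt.comp (g := k i) (f := Prod.snd) (x := (x, x)) (hk i) continuousAt_snd
    have h3 : ContinuousAt (fun p : J m n × J m n => conformalFactor D p.2) (x, x) :=
      ContinuousAt.comp (g := conformalFactor D) (f := Prod.snd) (x := (x, x)) hα
      continuousAt_snd
    exact (h1.sub h2).div h3 hα0
  have hY : ContinuousAt Y (x, x) := by
    refine ContinuousAt.prodMk (by fun_prop) (ContinuousAt.prodMk (by fun_prop)
      (ContinuousAt.prodMk (by fun_prop) (ContinuousAt.prodMk hs (by fun_prop))))
  have hYx : Y (x, x) = x := by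
    have : s (x, x) = sc x := by
      funext i
      simp only [s, k]
      rw [CT.sc_apply hD hU' hx i]
      field_simp
      ring
    simp only [Y, this]
  have hmem : ∀ᶠ p in 𝓝 (x, x), Y p ∈ U' := hY (hYx.symm ▸ hU'.mem_nhds hx)
  rw [nhds_prod_eq] at hmem
  obtain ⟨W₀, hW₀, hW₀'⟩ := Filter.eventually_prod_self_iff'.1 hmem
  refine ⟨interior W₀ ∩ U', isOpen_interior.inter hU',
    ⟨mem_interior_iff_mem_nhds.2 hW₀, hx⟩, Set.inter_subset_right, fun u hu w hw huw => ?_⟩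
  have hYU : Y (u, w) ∈ U' := hW₀' u (interior_subset hu.1) w (interior_subset hw.1)
  have hYw : baseL m n (Y (u, w)) = baseL m n w := rfl
  have h1 : baseL m n (D (Y (u, w))) = baseL m n (D u) :=
    (hD.2.baseL_eq hYU hw.2 hYw).trans huw.symm
  have h2 : sc (D (Y (u, w))) = sc (D u) := by
    funext i
    rw [CT.sc_apply hD hU' hYU i, CT.conformalFactor_congr hD hU' hYU hw.2 hYw,
      ThetaBase_congr (hD.2.baseL_eq hYU hw.2 hYw) (CT.baseL_fderiv_eq hD hU' hYU hw.2 hYw _)]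
    have h3 := hD.1.conformalFactor_ne_zero hw.2
    change k i w + conformalFactor D w * ((sc (D u) i - k i w) / conformalFactor D w) = _
    field_simp
    ring
  have h3 : Y (u, w) = u := hD.1.injOn hYU hu.2 (eq_of_baseL_eq h1 h2)
  rw [← hYw, h3]

/-- The local quotient `D⁻¹ ∘ C` of two members of `C_T` is in `C_T`. -/
theorem CT.exists_quotient (hC : C ∈ CT U) (hU : IsOpen U) (hD : D ∈ CT U') (hU' : IsOpen U')
    {x y : J m n} (hy : y ∈ U) (hx : x ∈ U') (hxy : C y = D x) :
    ∃ (O : Set (J m n)) (Ψ : J m n → J m n), IsOpen O ∧ y ∈ O ∧ O ⊆ U ∧ Set.MapsTo Ψ O U' ∧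
      (∀ w ∈ O, D (Ψ w) = C w) ∧ Ψ y = x ∧ Ψ ∈ CT O ∧
      (C ∈ CTTheta U → D ∈ CTTheta U' → Ψ ∈ CTTheta O) := by
  obtain ⟨W, hW, hxW, hWU, hinj⟩ := CT.exists_baseL_injOn hD hU' hx
  obtain ⟨O, Ψ, hO, hyO, hOU, hmaps, hΨ, hΨy, hΨC⟩ :=
    hC.1.exists_quotient hU hD.1 hU' hy hx hxy
  have hO' : IsOpen (O ∩ Ψ ⁻¹' W) := hΨC.smooth.continuousOn.isOpen_inter_preimage hO hW
  have hbase : ∀ u ∈ O ∩ Ψ ⁻¹' W, ∀ w ∈ O ∩ Ψ ⁻¹' W, baseL m n u = baseL m n w →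
      baseL m n (Ψ u) = baseL m n (Ψ w) := by
    intro u hu w hw huw
    refine hinj _ hu.2 _ hw.2 ?_
    rw [hΨ u hu.1, hΨ w hw.1]
    exact hC.2.baseL_eq (hOU hu.1) (hOU hw.1) huw
  have hmem : Ψ ∈ CT (O ∩ Ψ ⁻¹' W) := by
    refine ⟨hΨC.mono Set.inter_subset_left, fun u hu => ?_, fun u hu w hw h1 h2 h3 h4 => ?_,
      fun i u hu w hw h1 h2 h3 h4 h5 => ?_⟩
    · rw [← hD.2.time _ (hmaps hu.1), hΨ u hu.1, hC.2.time u (hOU hu.1)]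
    · exact (baseL_eq_iff.1 (hbase u hu w hw (baseL_eq_iff.2 ⟨h1, h2, h3, h4⟩))).2
    · have hb := hbase u hu w hw (baseL_eq_iff.2 ⟨h1, h2, h3, h4⟩)
      have hs := hC.2.slope i u (hOU hu.1) w (hOU hw.1) h1 h2 h3 h4 h5
      have hu' := hmaps hu.1
      have hw' := hmaps hw.1
      rw [← hΨ u hu.1, ← hΨ w hw.1, CT.sc_apply hD hU' hu', CT.sc_apply hD hU' hw',
        CT.conformalFactor_congr hD hU' hu' hw' hb,
        ThetaBase_congr (hD.2.baseL_eq hu' hw' hb)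
          (CT.baseL_fderiv_eq hD hU' hu' hw' hb _)] at hs
      -- The slopes of D ∘ Ψ are affine in those of Ψ, with coefficients depending only on the base,
      -- so equal slopes of `C` force equal slopes of Ψ.
      exact mul_left_cancel₀ (hD.1.conformalFactor_ne_zero hw') (add_left_cancel hs)
  refine ⟨O ∩ Ψ ⁻¹' W, Ψ, hO', ⟨hyO, by rwa [Set.mem_preimage, hΨy]⟩,
    Set.inter_subset_left.trans hOU, fun w hw => hmaps hw.1, fun w hw => hΨ w hw.1, hΨy, hmem,
    fun hCΘ hDΘ => ⟨hmem, fun w hw v => ?_⟩⟩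
  have h1 : HasFDerivAt (D ∘ Ψ) _ w :=
    (hD.1.hasFDerivAt hU' (hmaps hw.1)).comp w (hΨC.hasFDerivAt hO hw.1)
  have h2 : HasFDerivAt C _ w := h1.congr_of_eventuallyEq (by
    filter_upwards [hO.mem_nhds hw.1] with u hu using (hΨ u hu).symm)
  rw [← hDΘ.2 _ (hmaps hw.1), hΨ w hw.1, ← hCΘ.2 w (hOU hw.1), h2.fderiv]
  rfl

end BaseMap

/-! ### Removing the conformal factor by scaling the fibres. -/

section NormalForm

variable {r : ℕ} {U U' : Set (J m n)} {C : J m n → J m n}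

/-- Scaling of the fibre coordinates `(s, p)` by the function `a`. -/
def fiberScale (a : J0 m n → ℝ) (y : J0 m n) : J0 m n :=
  (y.1, y.2.1, a y • y.2.2.1, a y • y.2.2.2)

/-- The extension of `c ∘ φ` to the 1-jet bundle that commutes with translations along `z`. -/
noncomputable def normalForm (c : J0 m n → J m n) (φ : J0 m n → J0 m n) (x : J m n) : J m n :=
  c (φ (forgetZ x)) + zc x • dz m n

theorem contDiff_fiberScale {a : J0 m n → ℝ} (ha : ContDiff ℝ ∞ a) :
    ContDiff ℝ ∞ (fiberScale a) :=
  ContDiff.prodMk (by fun_prop) (ContDiff.prodMk (by fun_prop)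
    (ContDiff.prodMk (ha.smul (by fun_prop)) (ha.smul (by fun_prop))))

/-- The strata constrain s and p only by vanishing; signs are imposed on q alone. Hence a negative
factor is also allowed. -/
theorem mem_L0_iff_of_smul {σ : Set (Fin n)} {x y : J m n} {a : ℝ} (ha : a ≠ 0)
    (hq : qc y = qc x) (hz : zc y = zc x) (hs : sc y = a • sc x) (hp : pc y = a • pc x) :
    y ∈ L0 r σ ↔ x ∈ L0 r σ := by
  unfold L0
  simp only [Set.mem_ofPred_eq, hq, hz, hs, hp, Pi.smul_apply, smul_eq_mul, mul_eq_zero, ha,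
    false_or, smul_eq_zero]

theorem incl_fiberScale_mem_L0_iff {σ : Set (Fin n)} {a : J0 m n → ℝ} {y : J0 m n}
    (ha : a y ≠ 0) : incl (fiberScale a y) ∈ L0 r σ ↔ incl y ∈ L0 r σ :=
  mem_L0_iff_of_smul ha rfl rfl rfl rfl

theorem Theta_incl (x v : J0 m n) : Theta (incl x) (incl v) =
    -(∑ i, x.2.2.2 i * v.2.1 i) - ∑ i, x.2.2.1 i * v.1 i := by
  simp [Theta, incl, zc, pc, qc, sc, tc]

theorem Theta_add_smul_dz (x v : J m n) (z w : ℝ) :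
    Theta (x + z • dz m n) (v + w • dz m n) = Theta x v + w := by
  have h1 : Theta (x + z • dz m n) (v + w • dz m n) = Theta x (v + w • dz m n) := by
    simp [Theta, dz, sc, pc]
  have h2 := (ThetaL x).map_add v (w • dz m n)
  rw [map_smul] at h2
  rw [h1]
  refine h2.trans ?_
  change Theta x v + w * Theta x (dz m n) = _
  rw [Theta_dz, mul_one]

/-- The coordinate `z` as a continuous linear form. -/
noncomputable def zcL (m n : ℕ) : J m n →L[ℝ] ℝ :=
  (ContinuousLinearMap.fst ℝ ℝ ((Fin m → ℝ) × (Fin n → ℝ))).comp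
    ((ContinuousLinearMap.snd ℝ (Fin n → ℝ) (ℝ × (Fin m → ℝ) × (Fin n → ℝ))).comp
      (ContinuousLinearMap.snd ℝ (Fin m → ℝ) ((Fin n → ℝ) × ℝ × (Fin m → ℝ) × (Fin n → ℝ))))

theorem hasFDerivAt_normalForm {c : J0 m n → J m n} {φ : J0 m n → J0 m n} {x : J m n}
    {c' : J0 m n →L[ℝ] J m n} {φ' : J0 m n →L[ℝ] J0 m n}
    (hc : HasFDerivAt c c' (φ (forgetZ x))) (hφ : HasFDerivAt φ φ' (forgetZ x)) :
    HasFDerivAt (normalForm c φ)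
      (c'.comp (φ'.comp (forgetZL m n)) + (zcL m n).smulRight (dz m n)) x := by
  have h1 : HasFDerivAt (fun x : J m n => φ (forgetZ x)) (φ'.comp (forgetZL m n)) x :=
    HasFDerivAt.comp (g := φ) (f := forgetZL m n) x hφ (forgetZL m n).hasFDerivAt
  have h2 : HasFDerivAt (fun x : J m n => c (φ (forgetZ x))) (c'.comp (φ'.comp (forgetZL m n))) x :=
    hc.comp x h1
  exact h2.add ((zcL m n).hasFDerivAt.smul_const (dz m n))

/-- If `ψ = fiberScale a` makes `C|_{Z = 0}` strict and `φ` is a right inverse of `ψ`, then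
`normalForm (C ∘ incl) φ` preserves the contact form and has the form required in `C_T`. -/
theorem normalForm_spec (hU : IsOpen U) (hC : C ∈ CT U) {B B' : Set (J0 m n)} (hB : IsOpen B)
    (hBU : ∀ x ∈ B, incl x ∈ U) (hB0 : ∀ x ∈ B, (x.1, x.2.1, 0, x.2.2.2) ∈ B)
    {c : J0 m n → J m n} (hc : ∀ x ∈ B, c x = C (incl x)) {a : J0 m n → ℝ}
    (ha0 : ∀ x ∈ B, a x ≠ 0)
    (ha : ContDiff ℝ ∞ a)
    (has : ∀ x ∈ B, ∀ y ∈ B, x.1 = y.1 → x.2.1 = y.2.1 → x.2.2.2 = y.2.2.2 → a x = a y)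
    (hcontact : ∀ x ∈ B, ∀ v, Theta (C (incl x)) (fderiv ℝ C (incl x) (incl v)) =
      a x * Theta (incl x) (incl v))
    (hinj : Set.InjOn (fiberScale a) B) (hB' : IsOpen B') {φ : J0 m n → J0 m n}
    (hφ : ContDiffOn ℝ ∞ φ B') (hmaps : Set.MapsTo φ B' B)
    (hψφ : ∀ y ∈ B', fiberScale a (φ y) = y) (hU'B : ∀ x ∈ U', forgetZ x ∈ B') :
    IsPForm U' (normalForm c φ) ∧
      ∀ x ∈ U', ∀ v, Theta (normalForm c φ x) (fderiv ℝ (normalForm c φ) x v) = Theta x v ∧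
        (x = 0 → fderiv ℝ (normalForm c φ) x v = 0 → v = 0) := by
  have hφ1 : ∀ y ∈ B', (φ y).1 = y.1 := fun y hy =>
    (Prod.ext_iff.1 (hψφ y hy)).1
  have hφ2 : ∀ y ∈ B', (φ y).2.1 = y.2.1 :=
    fun y hy => (Prod.ext_iff.1 (Prod.ext_iff.1 (hψφ y hy)).2).1
  have hφs : ∀ y ∈ B', a (φ y) • (φ y).2.2.1 = y.2.2.1 :=
    fun y hy => (Prod.ext_iff.1 (Prod.ext_iff.1 (Prod.ext_iff.1 (hψφ y hy)).2).2).1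
  have hφp : ∀ y ∈ B', a (φ y) • (φ y).2.2.2 = y.2.2.2 :=
    fun y hy => (Prod.ext_iff.1 (Prod.ext_iff.1 (Prod.ext_iff.1 (hψφ y hy)).2).2).2
  -- Setting s = 0 at φ(y) changes neither `a` nor the p-component, and its image under the scaling
  -- is y with s = 0. Injectivity of the scaling then determines p from the base coordinates of y.
  have hφind : ∀ y ∈ B', ∀ w ∈ B', y.1 = w.1 → y.2.1 = w.2.1 → y.2.2.2 = w.2.2.2 →
      (φ y).2.2.2 = (φ w).2.2.2 := by
    intro y hy w hw h1 h2 h3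
    have h4 : ∀ u ∈ B', fiberScale a ((φ u).1, (φ u).2.1, 0, (φ u).2.2.2) =
        (u.1, u.2.1, 0, u.2.2.2) := by
      intro u hu
      have h5 : a ((φ u).1, (φ u).2.1, 0, (φ u).2.2.2) = a (φ u) :=
        has _ (hB0 _ (hmaps hu)) _ (hmaps hu) rfl rfl rfl
      simp only [fiberScale, h5, smul_zero]
      rw [hφ1 u hu, hφ2 u hu, hφp u hu]
    have h6 := hinj (hB0 _ (hmaps hy)) (hB0 _ (hmaps hw))
      ((h4 y hy).trans ((by rw [h1, h2, h3] : _ = _).trans (h4 w hw).symm))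
    exact (Prod.ext_iff.1 (Prod.ext_iff.1 (Prod.ext_iff.1 h6).2).2).2
  have haind : ∀ y ∈ B', ∀ w ∈ B', y.1 = w.1 → y.2.1 = w.2.1 → y.2.2.2 = w.2.2.2 →
      a (φ y) = a (φ w) := by
    intro y hy w hw h1 h2 h3
    exact has _ (hmaps hy) _ (hmaps hw) (by rw [hφ1 y hy, hφ1 w hw, h1])
      (by rw [hφ2 y hy, hφ2 w hw, h2]) (hφind y hy w hw h1 h2 h3)
  constructor
  · have hcC : ∀ x ∈ U', normalForm c φ x = C (incl (φ (forgetZ x))) + zc x • dz m n :=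
      fun x hx => by rw [normalForm, hc _ (hmaps (hU'B x hx))]
    refine ⟨fun x hx => ?_, fun x hx y hy ht hq hz hp => ?_, fun i x hx y hy ht hq hz hp hs => ?_⟩
    · have h1 : tc (normalForm c φ x) = tc (C (incl (φ (forgetZ x)))) := by
        rw [hcC x hx]; simp [dz, tc]
      rw [h1, hC.2.time _ (hBU _ (hmaps (hU'B x hx)))]
      exact hφ1 _ (hU'B x hx)
    · have hx' := hU'B x hx
      have hy' := hU'B y hy
      obtain ⟨h1, h2, h3⟩ := hC.2.base _ (hBU _ (hmaps hx')) _ (hBU _ (hmaps hy'))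
        ((hφ1 _ hx').trans (ht.trans (hφ1 _ hy').symm))
        ((hφ2 _ hx').trans (hq.trans (hφ2 _ hy').symm)) rfl
        (hφind _ hx' _ hy' ht hq hp)
      rw [hcC x hx, hcC y hy]
      refine ⟨?_, ?_, ?_⟩
      · simpa [dz, qc] using h1
      · have : zc x = zc y := hz
        simp only [zc, dz, Prod.fst_add, Prod.snd_add, Prod.smul_fst, Prod.smul_snd] at *
        rw [h2, this]
      · simpa [dz, pc] using h3
    · have hx' := hU'B x hx
      have hy' := hU'B y hy
      have hsi : (φ (forgetZ x)).2.2.1 i = (φ (forgetZ y)).2.2.1 i := by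
        have h1 := congrFun (hφs _ hx') i
        have h2 := congrFun (hφs _ hy') i
        rw [← haind _ hx' _ hy' ht hq hp] at h2
        have h3 : (forgetZ x).2.2.1 i = (forgetZ y).2.2.1 i := hs
        rw [← h1, ← h2] at h3
        exact mul_left_cancel₀ (ha0 _ (hmaps hx')) h3
      have h := hC.2.slope i _ (hBU _ (hmaps hx')) _ (hBU _ (hmaps hy'))
        ((hφ1 _ hx').trans (ht.trans (hφ1 _ hy').symm))
        ((hφ2 _ hx').trans (hq.trans (hφ2 _ hy').symm)) rfl
        (hφind _ hx' _ hy' ht hq hp) hsi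
      rw [hcC x hx, hcC y hy]
      simpa [dz, sc] using h
  · intro x hx v
    set y := forgetZ x with hy
    have hyB' : y ∈ B' := hU'B x hx
    have hφd : HasFDerivAt φ (fderiv ℝ φ y) y :=
      ((hφ.contDiffAt (hB'.mem_nhds hyB')).differentiableAt (by simp)).hasFDerivAt
    have hcd : HasFDerivAt c ((fderiv ℝ C (incl (φ y))).comp (inclL m n)) (φ y) := by
      have h1 : HasFDerivAt (C ∘ inclL m n) ((fderiv ℝ C (incl (φ y))).comp (inclL m n)) (φ y) :=
        HasFDerivAt.comp (φ y) (hC.1.hasFDerivAt hU (hBU _ (hmaps hyB'))) (inclL m n).hasFDerivAt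
      refine h1.congr_of_eventuallyEq ?_
      filter_upwards [hB.mem_nhds (hmaps hyB')] with u hu using hc u hu
    have hd := hasFDerivAt_normalForm hcd hφd
    set w := fderiv ℝ φ y (forgetZ v) with hw
    have hdv : fderiv ℝ (normalForm c φ) x v =
        fderiv ℝ C (incl (φ y)) (incl w) + zc v • dz m n := by
      rw [hd.fderiv]
      rfl
    let π : J0 m n →L[ℝ] (Fin m → ℝ) × (Fin n → ℝ) :=
      (ContinuousLinearMap.fst ℝ (Fin m → ℝ) ((Fin n → ℝ) × (Fin m → ℝ) × (Fin n → ℝ))).prod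
        ((ContinuousLinearMap.fst ℝ (Fin n → ℝ) ((Fin m → ℝ) × (Fin n → ℝ))).comp
          (ContinuousLinearMap.snd ℝ (Fin m → ℝ) ((Fin n → ℝ) × (Fin m → ℝ) × (Fin n → ℝ))))
    have hπ : π w = π (forgetZ v) := by
      have h1 : HasFDerivAt (π ∘ φ) (π.comp (fderiv ℝ φ y)) y := π.hasFDerivAt.comp y hφd
      have h2 : HasFDerivAt (π ∘ φ) π y := by
        refine π.hasFDerivAt.congr_of_eventuallyEq ?_
        filter_upwards [hB'.mem_nhds hyB'] with u hu using Prod.ext (hφ1 u hu) (hφ2 u hu)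
      exact congrArg (fun T : J0 m n →L[ℝ] _ => T (forgetZ v)) (h1.unique h2)
    have hw1 : w.1 = tc v := congrArg Prod.fst hπ
    have hw2 : w.2.1 = qc v := congrArg Prod.snd hπ
    -- Only the t- and q-components of the tangent vector enter Θ on {z = 0}, and φ leaves them
    -- unchanged. The factor a(φ y) turns the s and p of φ(y) into those of y.
    have hΘ : Theta (normalForm c φ x) (fderiv ℝ (normalForm c φ) x v) = Theta x v := by
      rw [hdv, normalForm, Theta_add_smul_dz, hc _ (hmaps hyB'), hcontact _ (hmaps hyB'),
        Theta_incl, Theta, hw1, hw2]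
      have h1 : a (φ y) * ∑ i, (φ y).2.2.2 i * qc v i = ∑ i, pc x i * qc v i := by
        rw [Finset.mul_sum]
        refine Finset.sum_congr rfl fun i _ => ?_
        have : a (φ y) * (φ y).2.2.2 i = pc x i := congrFun (hφp y hyB') i
        rw [← this, mul_assoc]
      have h2 : a (φ y) * ∑ i, (φ y).2.2.1 i * tc v i = ∑ i, sc x i * tc v i := by
        rw [Finset.mul_sum]
        refine Finset.sum_congr rfl fun i _ => ?_
        have : a (φ y) * (φ y).2.2.1 i = sc x i := congrFun (hφs y hyB') i
        rw [← this, mul_assoc]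
      rw [← h1, ← h2]
      ring
    -- Injectivity is needed only at 0, where Θ = dz: preservation of Θ kills the z-component of v,
    -- and the immersion `C` kills the rest.
    refine ⟨hΘ, fun hx0 hv0 => ?_⟩
    have hz : zc v = 0 := by
      have h1 : Theta (normalForm c φ x) 0 = 0 := (ThetaL _).map_zero
      rw [hv0, h1, hx0] at hΘ
      have h2 : Theta 0 v = zc v := by simp [Theta, pc, sc]
      rw [← h2, ← hΘ]
    rw [hdv, hz, zero_smul, add_zero] at hv0
    have hw0 : w = 0 := by
      have h1 : incl w = 0 := hC.1.immersion _ (hBU _ (hmaps hyB')) (hv0.trans (map_zero _).symm)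
      exact congrArg forgetZ h1
    have h1 := ((contDiff_fiberScale ha).differentiable (by simp) (φ y)).hasFDerivAt.comp y hφd
    have h2 : HasFDerivAt (fiberScale a ∘ φ) (ContinuousLinearMap.id ℝ (J0 m n)) y := by
      refine (hasFDerivAt_id y).congr_of_eventuallyEq ?_
      filter_upwards [hB'.mem_nhds hyB'] with u hu using hψφ u hu
    have h3 : fderiv ℝ (fiberScale a) (φ y) w = forgetZ v :=
      congrArg (fun T : J0 m n →L[ℝ] J0 m n => T (forgetZ v)) (h1.unique h2)
    rw [← incl_forgetZ hz, ← h3, hw0, map_zero]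
    exact (inclL m n).map_zero

end NormalForm

/-! ### Smooth families of Θ-preserving models. -/

section Family

variable {r : ℕ} {U : Set (J m n)}

/-- The conformal factor is defined by a z-derivative, which a map on {z = 0} does not see.
Evaluating C^*Θ = αΘ on a tangent vector u with Θ(u) = -l gives lα, and Hadamard division recovers α
smoothly. -/
theorem exists_fiberFactor_of_functional (hU : IsOpen U) {b : ℝ}
    (hb : Metric.ball (0 : J0 m n) b ⊆ incl ⁻¹' U) {G : ℝ × J0 m n → J m n}
    (hG : ContDiff ℝ ∞ G) (l : J0 m n →L[ℝ] ℝ) {e u : J0 m n} (he : l e = 1)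
    (hu : ∀ x : J0 m n, Theta (incl x) (incl u) = -l x)
    (hseg : ∀ x : J0 m n, ∀ θ ∈ Set.Icc (0 : ℝ) 1, ‖x - ((1 - θ) * l x) • e‖ ≤ ‖x‖) :
    ∃ A : ℝ × J0 m n → ℝ, ContDiff ℝ ∞ A ∧ ∀ (ε : ℝ), ∀ C ∈ CT U,
      (∀ x ∈ Metric.ball (0 : J0 m n) b, G (ε, x) = C (incl x)) →
      ∀ x ∈ Metric.ball (0 : J0 m n) b, A (ε, x) = conformalFactor C (incl x) := by
  have hH : ContDiff ℝ ∞ fun z : ℝ × J0 m n =>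
      -Theta (G z) (fderiv ℝ G z ((0 : ℝ), u)) :=
    (contDiff_Theta.comp (hG.prodMk
      ((hG.fderiv_right (m := ∞) (by simp)).clm_apply contDiff_const))).neg
  obtain ⟨A, hA, hA'⟩ := exists_contDiff_quotient l he hH
  refine ⟨A, hA, fun ε C hC hGC => hA' ε _ _ Metric.isOpen_ball ?_ ?_ ?_⟩
  · intro x hx θ hθ
    rw [mem_ball_zero_iff] at hx ⊢
    exact (hseg x θ hθ).trans_lt hx
  · exact (hC.1.contDiffOn_Theta_fderiv hU (dz m n)).comp (inclL m n).contDiff.contDiffOn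
      fun x hx => hb hx
  · intro x hx
    have h1 : HasFDerivAt (fun y => G (ε, y))
        ((fderiv ℝ G (ε, x)).comp (ContinuousLinearMap.inr ℝ ℝ (J0 m n))) x :=
      (hG.differentiable (by simp) (ε, x)).hasFDerivAt.comp x (hasFDerivAt_prodMk_right ε x)
    have h2 : HasFDerivAt (fun y => G (ε, y)) ((fderiv ℝ C (incl x)).comp (inclL m n)) x := by
      have h3 : HasFDerivAt (C ∘ inclL m n) ((fderiv ℝ C (incl x)).comp (inclL m n)) x :=
        HasFDerivAt.comp x (hC.1.hasFDerivAt hU (hb hx)) (inclL m n).hasFDerivAt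
      refine h3.congr_of_eventuallyEq ?_
      filter_upwards [Metric.isOpen_ball.mem_nhds hx] with y hy using hGC y hy
    have h4 : fderiv ℝ G (ε, x) (0, u) = fderiv ℝ C (incl x) (incl u) :=
      congrArg (fun T : J0 m n →L[ℝ] J m n => T u) (h1.unique h2)
    rw [h4, hGC x hx, hC.1.Theta_fderiv (hb hx), hu]
    ring

/-- In the sup norm, shrinking one coordinate does not increase the norm. So balls around 0 contain
the segments used in Hadamard division. -/
theorem norm_sub_single_smul_le {k : ℕ} (x : Fin k → ℝ) (i : Fin k) {θ : ℝ}
    (hθ : θ ∈ Set.Icc (0 : ℝ) 1) : ‖x - ((1 - θ) * x i) • (Pi.single i 1 : Fin k → ℝ)‖ ≤ ‖x‖ := by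
  refine (pi_norm_le_iff_of_nonneg (norm_nonneg _)).2 fun j => ?_
  rcases eq_or_ne j i with rfl | hj
  · have h1 : (x - ((1 - θ) * x j) • (Pi.single j 1 : Fin k → ℝ)) j = θ * x j := by
      simp; ring
    rw [h1, norm_mul, Real.norm_of_nonneg hθ.1]
    exact (mul_le_of_le_one_left (norm_nonneg _) hθ.2).trans (norm_le_pi_norm x j)
  · have h1 : (x - ((1 - θ) * x i) • (Pi.single i 1 : Fin k → ℝ)) j = x j := by
      simp [hj]
    rw [h1]
    exact norm_le_pi_norm x j

/-- For a smooth family of maps on `{Z = 0}`, some of which are restrictions of members of `C_T`,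
the conformal factors of the latter form a smooth family as well. -/
theorem exists_fiberFactor (hU : IsOpen U) {b : ℝ}
    (hb : Metric.ball (0 : J0 m n) b ⊆ incl ⁻¹' U) {G : ℝ × J0 m n → J m n}
    (hG : ContDiff ℝ ∞ G) :
    ∃ A : ℝ × J0 m n → ℝ, ContDiff ℝ ∞ A ∧ ∀ (ε : ℝ), ∀ C ∈ CT U,
      (∀ x ∈ Metric.ball (0 : J0 m n) b, G (ε, x) = C (incl x)) →
      (∀ x ∈ Metric.ball (0 : J0 m n) b, A (ε, x) ≠ 0) ∧
      (∀ x ∈ Metric.ball (0 : J0 m n) b, ∀ y ∈ Metric.ball (0 : J0 m n) b,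
        x.1 = y.1 → x.2.1 = y.2.1 → x.2.2.2 = y.2.2.2 → A (ε, x) = A (ε, y)) ∧
      ∀ x ∈ Metric.ball (0 : J0 m n) b, ∀ v,
        Theta (C (incl x)) (fderiv ℝ C (incl x) (incl v)) =
          A (ε, x) * Theta (incl x) (incl v) := by
  suffices h : (∃ A : ℝ × J0 m n → ℝ, ContDiff ℝ ∞ A ∧ ∀ (ε : ℝ), ∀ C ∈ CT U,
      (∀ x ∈ Metric.ball (0 : J0 m n) b, G (ε, x) = C (incl x)) →
      ∀ x ∈ Metric.ball (0 : J0 m n) b, A (ε, x) = conformalFactor C (incl x)) ∨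
      (m = 0 ∧ n = 0) by
    rcases h with ⟨A, hA, hA'⟩ | ⟨rfl, rfl⟩
    · refine ⟨A, hA, fun ε C hC hGC => ⟨fun x hx => ?_, fun x hx y hy h1 h2 h3 => ?_,
        fun x hx v => ?_⟩⟩
      · rw [hA' ε C hC hGC x hx]
        exact hC.1.conformalFactor_ne_zero (hb hx)
      · rw [hA' ε C hC hGC x hx, hA' ε C hC hGC y hy]
        exact CT.conformalFactor_congr hC hU (hb hx) (hb hy) (baseL_eq_iff.2 ⟨h1, h2, rfl, h3⟩)
      · rw [hA' ε C hC hGC x hx]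
        exact hC.1.Theta_fderiv (hb hx) _
    -- Here {z = 0} is a point on which Θ vanishes, so any nonzero factor serves, and the true one
    -- need not be recovered.
    · refine ⟨fun _ => 1, contDiff_const, fun ε C hC hGC => ⟨fun _ _ => one_ne_zero,
        fun _ _ _ _ _ _ _ => rfl, fun x hx v => ?_⟩⟩
      rw [hC.1.Theta_fderiv (hb hx), Theta_incl]
      simp
  -- The linear form is a coordinate s_i, paired with ∂_{t_i}, or, if there is no time variable, p_i
  -- paired with ∂_{q_i}.
  rcases Nat.eq_zero_or_pos m with hm | hm
  · rcases Nat.eq_zero_or_pos n with hn | hn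
    · exact Or.inr ⟨hm, hn⟩
    · left
      let i : Fin n := ⟨0, hn⟩
      refine exists_fiberFactor_of_functional hU hb hG
        ((ContinuousLinearMap.proj i : (Fin n → ℝ) →L[ℝ] ℝ).comp
          ((ContinuousLinearMap.snd ℝ (Fin m → ℝ) (Fin n → ℝ)).comp
            ((ContinuousLinearMap.snd ℝ (Fin n → ℝ) ((Fin m → ℝ) × (Fin n → ℝ))).comp
              (ContinuousLinearMap.snd ℝ (Fin m → ℝ) ((Fin n → ℝ) × (Fin m → ℝ) × (Fin n → ℝ))))))
        (e := (0, 0, 0, Pi.single i 1)) (u := (0, Pi.single i 1, 0, 0)) (by simp) ?_ ?_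
      · intro x
        rw [Theta_incl]
        simp [Pi.single_apply]
      · intro x θ hθ
        refine norm_prod_le_iff.2 ⟨?_, norm_prod_le_iff.2 ⟨?_, norm_prod_le_iff.2 ⟨?_, ?_⟩⟩⟩
        · simpa using norm_fst_le x
        · simpa using (norm_fst_le x.2).trans (norm_snd_le x)
        · simpa using (norm_fst_le x.2.2).trans ((norm_snd_le x.2).trans (norm_snd_le x))
        · exact (norm_sub_single_smul_le x.2.2.2 i hθ).trans
            ((norm_snd_le x.2.2).trans ((norm_snd_le x.2).trans (norm_snd_le x)))
  · left
    let i : Fin m := ⟨0, hm⟩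
    refine exists_fiberFactor_of_functional hU hb hG
      ((ContinuousLinearMap.proj i : (Fin m → ℝ) →L[ℝ] ℝ).comp
        ((ContinuousLinearMap.fst ℝ (Fin m → ℝ) (Fin n → ℝ)).comp
          ((ContinuousLinearMap.snd ℝ (Fin n → ℝ) ((Fin m → ℝ) × (Fin n → ℝ))).comp
            (ContinuousLinearMap.snd ℝ (Fin m → ℝ) ((Fin n → ℝ) × (Fin m → ℝ) × (Fin n → ℝ))))))
      (e := (0, 0, Pi.single i 1, 0)) (u := (Pi.single i 1, 0, 0, 0)) (by simp) ?_ ?_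
    · intro x
      rw [Theta_incl]
      simp [Pi.single_apply]
    · intro x θ hθ
      refine norm_prod_le_iff.2 ⟨?_, norm_prod_le_iff.2 ⟨?_, norm_prod_le_iff.2 ⟨?_, ?_⟩⟩⟩
      · simpa using norm_fst_le x
      · simpa using (norm_fst_le x.2).trans (norm_snd_le x)
      · exact (norm_sub_single_smul_le x.2.2.1 i hθ).trans
          ((norm_fst_le x.2.2).trans ((norm_snd_le x.2).trans (norm_snd_le x)))
      · simpa using (norm_snd_le x.2.2).trans ((norm_snd_le x.2).trans (norm_snd_le x))

theorem fiberScale_zero (a : J0 m n → ℝ) : fiberScale a 0 = 0 := by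
  simp only [fiberScale, Prod.fst_zero, Prod.snd_zero, smul_zero]
  rfl

theorem exists_box_subset {E : Type*} [NormedAddCommGroup E] [NormedSpace ℝ E] {S : Set (ℝ × E)}
    (hS : S ∈ 𝓝 (0 : ℝ × E)) : ∃ δ > 0, Set.Ioo (-δ) δ ×ˢ Metric.ball (0 : E) δ ⊆ S := by
  obtain ⟨δ, hδ, h⟩ := Metric.mem_nhds_iff.1 hS
  refine ⟨δ, hδ, fun z hz => h ?_⟩
  rw [mem_ball_zero_iff]
  exact max_lt (abs_lt.2 hz.1) (mem_ball_zero_iff.1 hz.2)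

/-- The smooth parametrized inverse of a family of fibre scalings near the origin. -/
theorem exists_fiberScale_inverse {A : ℝ × J0 m n → ℝ} (hA : ContDiff ℝ ∞ A) (hA0 : A 0 ≠ 0)
    {b : ℝ} (hb : 0 < b) :
    ∃ δ > 0, δ ≤ b ∧ ∃ (T : Set (ℝ × J0 m n)) (φ : ℝ × J0 m n → J0 m n), IsOpen T ∧
      ContDiffOn ℝ ∞ φ T ∧
      (∀ z ∈ T, z.1 ∈ Set.Ioo (-δ) δ ∧ φ z ∈ Metric.ball 0 δ ∧
        fiberScale (fun x => A (z.1, x)) (φ z) = z.2) ∧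
      ∀ ε ∈ Set.Ioo (-δ) δ, ∀ x ∈ Metric.ball (0 : J0 m n) δ,
        (ε, fiberScale (fun x => A (ε, x)) x) ∈ T ∧
          φ (ε, fiberScale (fun x => A (ε, x)) x) = x := by
  let Ψ : ℝ × J0 m n → ℝ × J0 m n := fun z =>
    (z.1, z.2.1, z.2.2.1, A z • z.2.2.2.1, A z • z.2.2.2.2)
  have hΨ : ContDiff ℝ ∞ Ψ :=
    ContDiff.prodMk (by fun_prop) (ContDiff.prodMk (by fun_prop) (ContDiff.prodMk (by fun_prop)
      (ContDiff.prodMk (hA.smul (by fun_prop)) (hA.smul (by fun_prop)))))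
  let u : ℝˣ := Units.mk0 (A 0) hA0
  let Ψ' : (ℝ × J0 m n) ≃L[ℝ] ℝ × J0 m n :=
    (ContinuousLinearEquiv.refl ℝ ℝ).prodCongr
      ((ContinuousLinearEquiv.refl ℝ (Fin m → ℝ)).prodCongr
        ((ContinuousLinearEquiv.refl ℝ (Fin n → ℝ)).prodCongr
          ((ContinuousLinearEquiv.smulLeft u).prodCongr (ContinuousLinearEquiv.smulLeft u))))
  have hAd : HasFDerivAt A (fderiv ℝ A 0) 0 := (hA.differentiable (by simp) 0).hasFDerivAt
  -- At 0 the derivative of `A` is multiplied by the vanishing fibre coordinate, so the scaling has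
  -- a block-diagonal derivative with blocks 1 and A(0).
  have hscale : ∀ {k : ℕ} (L : ℝ × J0 m n →L[ℝ] (Fin k → ℝ)),
      HasFDerivAt (fun z => A z • L z) (A 0 • L) 0 := by
    intro k L
    refine (hAd.smul (L.hasFDerivAt (x := (0 : ℝ × J0 m n)))).congr_fderiv ?_
    exact ContinuousLinearMap.ext fun v => by simp
  have hΨ' : HasFDerivAt Ψ (Ψ' : ℝ × J0 m n →L[ℝ] ℝ × J0 m n) 0 := by
    let Q := ContinuousLinearMap.snd ℝ ℝ (J0 m n)
    let Q₁ := (ContinuousLinearMap.snd ℝ (Fin m → ℝ) ((Fin n → ℝ) × (Fin m → ℝ) × (Fin n → ℝ))).comp Q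
    let Q₂ := (ContinuousLinearMap.snd ℝ (Fin n → ℝ) ((Fin m → ℝ) × (Fin n → ℝ))).comp Q₁
    have h1 : HasFDerivAt (fun z : ℝ × J0 m n => z.1) (ContinuousLinearMap.fst ℝ ℝ (J0 m n)) 0 :=
      hasFDerivAt_fst
    have h2 : HasFDerivAt (fun z : ℝ × J0 m n => z.2.1) ((ContinuousLinearMap.fst ℝ (Fin m → ℝ)
      ((Fin n → ℝ) × (Fin m → ℝ) × (Fin n → ℝ))).comp Q) 0 :=
      ((ContinuousLinearMap.fst ℝ (Fin m → ℝ) _).comp Q).hasFDerivAt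
    have h3 : HasFDerivAt (fun z : ℝ × J0 m n => z.2.2.1) ((ContinuousLinearMap.fst ℝ (Fin n → ℝ)
      ((Fin m → ℝ) × (Fin n → ℝ))).comp Q₁) 0 :=
      ((ContinuousLinearMap.fst ℝ (Fin n → ℝ) _).comp Q₁).hasFDerivAt
    have h4 := hscale ((ContinuousLinearMap.fst ℝ (Fin m → ℝ) (Fin n → ℝ)).comp Q₂)
    have h5 := hscale ((ContinuousLinearMap.snd ℝ (Fin m → ℝ) (Fin n → ℝ)).comp Q₂)
    exact h1.prodMk (h2.prodMk (h3.prodMk (h4.prodMk h5)))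
  obtain ⟨e, h0e, -, heΨ, hes, -⟩ := exists_openPartialHomeomorph
    (O := Set.Ioo (-b) b ×ˢ Metric.ball (0 : J0 m n) b) (isOpen_Ioo.prod Metric.isOpen_ball)
    hΨ.contDiffOn (a := 0) ⟨⟨neg_lt_zero.2 hb, hb⟩, Metric.mem_ball_self hb⟩ hΨ'
  obtain ⟨δ₀, hδ₀, hbox₀⟩ := exists_box_subset (e.open_source.mem_nhds h0e)
  set δ := min δ₀ b with hδ
  have hδpos : 0 < δ := lt_min hδ₀ hb
  have hboxsub : Set.Ioo (-δ) δ ×ˢ Metric.ball (0 : J0 m n) δ ⊆ e.source :=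
    (Set.prod_mono (Set.Ioo_subset_Ioo (neg_le_neg (min_le_left _ _)) (min_le_left _ _))
      (Metric.ball_subset_ball (min_le_left _ _))).trans hbox₀
  have hbox : IsOpen (Set.Ioo (-δ) δ ×ˢ Metric.ball (0 : J0 m n) δ) :=
    isOpen_Ioo.prod Metric.isOpen_ball
  -- Restricting to a box makes the source of every slice the same ball, so each slice of the
  -- scaling is a bijection from that ball to the corresponding slice of `T`.
  let e' := e.restrOpen _ hbox
  have he's : e'.source = Set.Ioo (-δ) δ ×ˢ Metric.ball (0 : J0 m n) δ := by
    rw [OpenPartialHomeomorph.restrOpen_source]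
    exact Set.inter_eq_right.2 hboxsub
  have he'Ψ : ∀ z, e' z = Ψ z := fun z => congrFun heΨ z
  have hT : e'.target ⊆ e.target := fun z hz => by
    have h1 := e.map_source (hboxsub (he's ▸ e'.map_target hz))
    have h2 : e (e'.symm z) = z := e'.right_inv hz
    rwa [h2] at h1
  have hsymm : ∀ z ∈ e'.target, (e'.symm z).1 = z.1 ∧
      fiberScale (fun x => A (z.1, x)) (e'.symm z).2 = z.2 := by
    intro z hz
    have h1 : Ψ (e'.symm z) = z := by rw [← he'Ψ]; exact e'.right_inv hz
    have h2 : (e'.symm z).1 = z.1 := (Prod.ext_iff.1 h1).1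
    refine ⟨h2, ?_⟩
    rw [← h2]
    exact (Prod.ext_iff.1 h1).2
  refine ⟨δ, hδpos, min_le_right _ _, e'.target, fun z => (e'.symm z).2, e'.open_target,
    contDiff_snd.comp_contDiffOn (hes.mono hT), fun z hz => ?_, fun ε hε x hx => ?_⟩
  · have h1 : e'.symm z ∈ Set.Ioo (-δ) δ ×ˢ Metric.ball (0 : J0 m n) δ :=
      he's ▸ e'.map_target hz
    exact ⟨(hsymm z hz).1 ▸ h1.1, h1.2, (hsymm z hz).2⟩
  · have h1 : ((ε, x) : ℝ × J0 m n) ∈ e'.source := he's ▸ ⟨hε, hx⟩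
    have h2 : e' (ε, x) = (ε, fiberScale (fun x => A (ε, x)) x) := he'Ψ _
    rw [← h2]
    exact ⟨e'.map_source h1, congrArg Prod.snd (e'.left_inv h1)⟩

/-- `F` preserves the contact form and has the same configurations as `C`. -/
def IsThetaModel (r : ℕ) (U U' : Set (J m n)) (F C : J m n → J m n) : Prop :=
  F ∈ CTTheta U' ∧ ∀ x ∈ U', IsBasePoint r x → ∃ y ∈ U, IsBasePoint r y ∧ (x = 0 → y = 0) ∧
    ConfigLE r F x C y ∧ ConfigLE r C y F x

/-- The strata lie in {z = 0}, where the normal form is `C` after the inverse scaling. The scaling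
and its inverse preserve each stratum, which gives both inclusions. -/
theorem configLE_normalForm {c : J0 m n → J m n} {C : J m n → J m n} {B B' : Set (J0 m n)}
    (hB : IsOpen B) (hB' : IsOpen B') (hc : ∀ x ∈ B, c x = C (incl x)) {a : J0 m n → ℝ}
    (ha : ContDiff ℝ ∞ a) (ha0 : ∀ x ∈ B, a x ≠ 0) {φ : J0 m n → J0 m n}
    (hφ : ContinuousOn φ B')
    (hmaps : Set.MapsTo φ B' B) (hψφ : ∀ y ∈ B', fiberScale a (φ y) = y)
    (hφψ : ∀ x ∈ B, φ (fiberScale a x) = x) {x : J m n} (hx : IsBasePoint r x)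
    (hxB : forgetZ x ∈ B') :
    IsBasePoint r (incl (φ (forgetZ x))) ∧
      ConfigLE r (normalForm c φ) x C (incl (φ (forgetZ x))) ∧
      ConfigLE r C (incl (φ (forgetZ x))) (normalForm c φ) x := by
  have hL : ∀ w : J m n, forgetZ w ∈ B' → ∀ σ, w ∈ L0 r σ → incl (φ (forgetZ w)) ∈ L0 r σ := by
    intro w hw σ hwσ
    rw [← incl_fiberScale_mem_L0_iff (ha0 _ (hmaps hw)), hψφ _ hw, incl_forgetZ hwσ.2.2.2.2]
    exact hwσ
  refine ⟨isBasePoint_of_forall_mem_L0 fun σ _ => hL x hxB σ (hx.mem_L0 σ), ?_, ?_⟩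
  · have hcont : ContinuousAt (fun w : J m n => incl (φ (forgetZ w))) x :=
      continuous_incl.continuousAt.comp ((hφ.continuousAt (hB'.mem_nhds hxB)).comp
        continuous_forgetZ.continuousAt)
    refine configLE_of_eventually_comp hcont rfl fun σ _ => ?_
    filter_upwards [(hB'.preimage continuous_forgetZ).mem_nhds hxB] with w hw hwσ
    refine ⟨hL w hw σ hwσ, ?_⟩
    have hz : zc w = 0 := hwσ.2.2.2.2
    rw [normalForm, hz, zero_smul, add_zero, hc _ (hmaps hw)]
  · have hcont : Continuous (fun w : J m n => incl (fiberScale a (forgetZ w))) :=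
      continuous_incl.comp ((contDiff_fiberScale ha).continuous.comp continuous_forgetZ)
    have hval : incl (fiberScale a (forgetZ (incl (φ (forgetZ x))))) = x := by
      rw [forgetZ_incl, hψφ _ hxB, incl_forgetZ hx.2.1]
    refine configLE_of_eventually_comp hcont.continuousAt hval fun σ _ => ?_
    filter_upwards [(hB.preimage continuous_forgetZ).mem_nhds (hmaps hxB)] with w hw hwσ
    have hz : zc w = 0 := hwσ.2.2.2.2
    constructor
    · rw [incl_fiberScale_mem_L0_iff (ha0 _ hw), incl_forgetZ hz]
      exact hwσ
    · have h1 : zc (incl (fiberScale a (forgetZ w))) = 0 := rfl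
      rw [normalForm, h1, zero_smul, add_zero, forgetZ_incl, hφψ _ hw, hc _ hw, incl_forgetZ hz]

/-- Sequences that converge fast enough in `C_T^Z` have models in `C_T^Θ` that lie on a smooth
one-parameter family. -/
theorem exists_thetaModel_family (r : ℕ) (hU : IsOpen U) (h0U : (0 : J m n) ∈ U)
    {C₀ : J m n → J m n} (hC₀ : C₀ ∈ CT U) {c₀ : J0 m n → J m n}
    (hc₀ : Set.EqOn c₀ (C₀ ∘ incl) (incl ⁻¹' U)) :
    ∃ N : ℕ → Set (J0 m n → J m n), (∀ j, N j ∈ @nhds _ (cInfty (incl ⁻¹' U)) c₀) ∧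
      ∀ (C : ℕ → J m n → J m n) (c : ℕ → J0 m n → J m n), (∀ j, C j ∈ CT U) →
        (∀ j, Set.EqOn (c j) (C j ∘ incl) (incl ⁻¹' U)) → (∀ j, c j ∈ N j) →
        ∃ (U' : Set (J m n)) (δ : ℝ) (Γ : ℝ × J m n → J m n), IsOpen U' ∧ (0 : J m n) ∈ U' ∧
          0 < δ ∧ ContDiffOn ℝ ∞ Γ (Set.Ioo (-δ) δ ×ˢ U') ∧
          IsThetaModel r U U' (fun x => Γ (0, x)) C₀ ∧
          ∀ j : ℕ, (1 / 2 : ℝ) ^ j < δ →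
            IsThetaModel r U U' (fun x => Γ ((1 / 2) ^ j, x)) (C j) := by
  have hV : IsOpen (incl ⁻¹' U : Set (J0 m n)) := hU.preimage continuous_incl
  have hsm : ∀ (C : J m n → J m n) (c : J0 m n → J m n), C ∈ CT U →
      Set.EqOn c (C ∘ incl) (incl ⁻¹' U) → ContDiffOn ℝ ∞ c (incl ⁻¹' U) := fun C c hC hc =>
    (hC.1.smooth.comp (inclL m n).contDiff.contDiffOn fun _ h => h).congr hc
  have h0V : (0 : J0 m n) ∈ (incl ⁻¹' U : Set (J0 m n)) := h0U
  obtain ⟨b, hb, hbV, N, hN, hint⟩ := exists_smooth_interpolation hV h0V (hsm C₀ c₀ hC₀ hc₀)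
  refine ⟨N, hN, fun C c hC hc hcN => ?_⟩
  obtain ⟨G, hG, hGc⟩ := hint c (fun j => hsm _ _ (hC j) (hc j)) hcN
  have hGC₀ : ∀ x ∈ Metric.ball (0 : J0 m n) b, G (0, x) = C₀ (incl x) :=
    fun x hx => ((hGc x hx).1).trans (hc₀ (hbV hx))
  have hGC : ∀ j, ∀ x ∈ Metric.ball (0 : J0 m n) b, G ((1 / 2) ^ j, x) = C j (incl x) :=
    fun j x hx => ((hGc x hx).2 j).trans (hc j (hbV hx))
  obtain ⟨A, hA, hAC⟩ := exists_fiberFactor hU hbV hG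
  have hA0 : A 0 ≠ 0 := (hAC 0 C₀ hC₀ hGC₀).1 0 (Metric.mem_ball_self hb)
  obtain ⟨δ₁, hδ₁, hδ₁b, T, φ, hT, hφ, hTφ, hφT⟩ := exists_fiberScale_inverse hA hA0 hb
  have hBb : Metric.ball (0 : J0 m n) δ₁ ⊆ Metric.ball 0 b := Metric.ball_subset_ball hδ₁b
  let Γ : ℝ × J m n → J m n := fun z =>
    normalForm (fun x => G (z.1, x)) (fun y => φ (z.1, y)) z.2
  let W : Set (ℝ × J m n) := (fun z : ℝ × J m n => (z.1, forgetZL m n z.2)) ⁻¹' T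
  have hWc : ContDiff ℝ ∞ (fun z : ℝ × J m n => (z.1, forgetZL m n z.2)) := by fun_prop
  have hW : IsOpen W := hT.preimage hWc.continuous
  have hΓ : ContDiffOn ℝ ∞ Γ W := by
    have h1 : ContDiffOn ℝ ∞ (fun z : ℝ × J m n => φ (z.1, forgetZL m n z.2)) W :=
      hφ.comp hWc.contDiffOn fun z hz => hz
    refine ContDiffOn.add (hG.comp_contDiffOn (contDiff_fst.contDiffOn.prodMk h1)) ?_
    exact (((zcL m n).contDiff.comp contDiff_snd).smul contDiff_const).contDiffOn
  have hslice : ∀ ε : ℝ, IsOpen {y : J0 m n | (ε, y) ∈ T} := fun ε =>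
    hT.preimage (by fun_prop : Continuous fun y : J0 m n => (ε, y))
  have hφslice : ∀ ε : ℝ, ContDiffOn ℝ ∞ (fun y => φ (ε, y)) {y : J0 m n | (ε, y) ∈ T} :=
    fun ε => hφ.comp (by fun_prop : ContDiff ℝ ∞ fun y : J0 m n => (ε, y)).contDiffOn
      fun y hy => hy
  have hAslice : ∀ ε : ℝ, ContDiff ℝ ∞ fun x => A (ε, x) := fun ε => hA.comp (by fun_prop)
  have hspec : ∀ ε ∈ Set.Ioo (-δ₁) δ₁, ∀ C ∈ CT U,
      (∀ x ∈ Metric.ball (0 : J0 m n) b, G (ε, x) = C (incl x)) →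
      IsPForm {x | (ε, x) ∈ W} (fun x => Γ (ε, x)) ∧ ∀ x ∈ {x | (ε, x) ∈ W}, ∀ v,
        Theta (Γ (ε, x)) (fderiv ℝ (fun x => Γ (ε, x)) x v) = Theta x v ∧
        (x = 0 → fderiv ℝ (fun x => Γ (ε, x)) x v = 0 → v = 0) := by
    intro ε hε C hC hGC
    obtain ⟨h1, h2, h3⟩ := hAC ε C hC hGC
    refine normalForm_spec hU hC Metric.isOpen_ball (fun x hx => hbV (hBb hx)) ?_
      (fun x hx => hGC x (hBb hx)) (fun x hx => h1 x (hBb hx)) (hAslice ε)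
      (fun x hx y hy => h2 x (hBb hx) y (hBb hy)) (fun x hx => h3 x (hBb hx)) ?_ (hslice ε)
      (hφslice ε) (fun y hy => (hTφ _ hy).2.1) (fun y hy => (hTφ _ hy).2.2) fun x hx => hx
    · intro x hx
      rw [mem_ball_zero_iff] at hx ⊢
      refine lt_of_le_of_lt ?_ hx
      refine norm_prod_le_iff.2 ⟨norm_fst_le x, norm_prod_le_iff.2
        ⟨(norm_fst_le x.2).trans (norm_snd_le x), norm_prod_le_iff.2 ⟨?_, ?_⟩⟩⟩
      · simp
      · exact (norm_snd_le x.2.2).trans ((norm_snd_le x.2).trans (norm_snd_le x))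
    · intro x hx y hy hxy
      rw [← (hφT ε hε x hx).2, hxy, (hφT ε hε y hy).2]
  have h0δ₁ : (0 : ℝ) ∈ Set.Ioo (-δ₁) δ₁ := ⟨neg_lt_zero.2 hδ₁, hδ₁⟩
  have hφ0 : ∀ ε ∈ Set.Ioo (-δ₁) δ₁, (ε, (0 : J0 m n)) ∈ T ∧ φ (ε, 0) = 0 := by
    intro ε hε
    have h := hφT ε hε 0 (Metric.mem_ball_self hδ₁)
    rwa [fiberScale_zero] at h
  have h0W : (0 : ℝ × J m n) ∈ W := (hφ0 0 h0δ₁).1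
  have hΓd : ∀ z ∈ W, HasFDerivAt Γ (fderiv ℝ Γ z) z := fun z hz =>
    ((hΓ.contDiffAt (hW.mem_nhds hz)).differentiableAt (by simp)).hasFDerivAt
  have hΓslice : ∀ ε x, (ε, x) ∈ W → HasFDerivAt (fun x => Γ (ε, x))
      ((fderiv ℝ Γ (ε, x)).comp (ContinuousLinearMap.inr ℝ ℝ (J m n))) x := fun ε x h =>
    (hΓd _ h).comp x (hasFDerivAt_prodMk_right ε x)
  -- Keeping ε as a coordinate, one application of the inverse function theorem makes all slices
  -- with small ε embeddings on a common ball. Applied slice by slice, it would not control the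
  -- domains as j grows.
  let Γ' : ℝ × J m n → ℝ × J m n := fun z => (z.1, Γ z)
  have hΓ's : ContDiffOn ℝ ∞ Γ' W := contDiff_fst.contDiffOn.prodMk hΓ
  have hΓ'd : ∀ z ∈ W, HasFDerivAt Γ'
      ((ContinuousLinearMap.fst ℝ ℝ (J m n)).prod (fderiv ℝ Γ z)) z := fun z hz =>
    hasFDerivAt_fst.prodMk (hΓd z hz)
  have hinj : Function.Injective
      ((ContinuousLinearMap.fst ℝ ℝ (J m n)).prod (fderiv ℝ Γ 0)) := by
    rw [injective_iff_map_eq_zero]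
    rintro ⟨e, v⟩ hev
    have he : e = 0 := (Prod.ext_iff.1 hev).1
    subst he
    have hv : fderiv ℝ Γ 0 (0, v) = 0 := (Prod.ext_iff.1 hev).2
    have h1 := ((hspec 0 h0δ₁ C₀ hC₀ hGC₀).2 0 h0W v).2 rfl
    rw [(hΓslice 0 0 h0W).fderiv] at h1
    rw [h1 hv]
    rfl
  let f' : (ℝ × J m n) ≃L[ℝ] ℝ × J m n := (LinearEquiv.ofInjectiveEndo
    ((ContinuousLinearMap.fst ℝ ℝ (J m n)).prod (fderiv ℝ Γ 0) : ℝ × J m n →ₗ[ℝ] ℝ × J m n)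
    hinj).toContinuousLinearEquiv
  have hf' : HasFDerivAt Γ' (f' : ℝ × J m n →L[ℝ] ℝ × J m n) 0 := hΓ'd 0 h0W
  obtain ⟨e, h0e, heW, heΓ, -, hequiv⟩ := exists_openPartialHomeomorph hW hΓ's h0W hf'
  obtain ⟨δ, hδ, hbox⟩ := exists_box_subset (e.open_source.mem_nhds h0e)
  have hboxW : ∀ ε ∈ Set.Ioo (-δ) δ, ∀ x ∈ Metric.ball (0 : J m n) δ, (ε, x) ∈ W :=
    fun ε hε x hx => heW (hbox ⟨hε, hx⟩)
  have hmodel : ∀ ε ∈ Set.Ioo (-δ) δ, ∀ C ∈ CT U,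
      (∀ x ∈ Metric.ball (0 : J0 m n) b, G (ε, x) = C (incl x)) →
      IsThetaModel r U (Metric.ball 0 δ) (fun x => Γ (ε, x)) C := by
    intro ε hε C hC hGC
    have hεδ₁ : ε ∈ Set.Ioo (-δ₁) δ₁ :=
      (hTφ _ (hboxW ε hε 0 (Metric.mem_ball_self hδ))).1
    obtain ⟨hform, hΘ⟩ := hspec ε hεδ₁ C hC hGC
    refine ⟨⟨⟨⟨?_, ?_, ?_, ?_⟩, hform.mono fun x hx => hboxW ε hε x hx⟩, ?_⟩, ?_⟩
    · exact hΓ.comp (by fun_prop : ContDiff ℝ ∞ fun x : J m n => (ε, x)).contDiffOn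
        fun x hx => hboxW ε hε x hx
    · have h1 : IsEmbedding (fun x : Metric.ball (0 : J m n) δ =>
          (⟨(ε, x), hbox ⟨hε, x.2⟩⟩ : e.source)) :=
        IsEmbedding.codRestrict (e := fun x : Metric.ball (0 : J m n) δ => (ε, (x : J m n)))
          ((isEmbedding_prodMkRight ε).comp IsEmbedding.subtypeVal) _ _
      have h2 := e.isOpenEmbedding_restrict.isEmbedding.comp h1
      have h3 : Continuous fun x : Metric.ball (0 : J m n) δ => Γ (ε, x) :=
        (hΓ.continuousOn.comp (by fun_prop : Continuous fun x : J m n => (ε, x)).continuousOn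
          fun x hx => hboxW ε hε x hx).domRestrict
      have h4 : (fun y : J m n => (ε, y)) ∘ (fun x : Metric.ball (0 : J m n) δ => Γ (ε, x)) =
          e.source.domRestrict e ∘ (fun x : Metric.ball (0 : J m n) δ =>
            (⟨(ε, x), hbox ⟨hε, x.2⟩⟩ : e.source)) := by
        funext x
        change ((ε, Γ (ε, x)) : ℝ × J m n) = e (ε, x)
        rw [heΓ]
      refine IsEmbedding.of_comp h3 (g := fun y : J m n => (ε, y)) (by fun_prop) ?_
      rw [h4]
      exact h2
    · intro x hx
      obtain ⟨f'', hf''⟩ := hequiv (ε, x) (hbox ⟨hε, hx⟩)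
      rw [(hΓslice ε x (hboxW ε hε x hx)).fderiv, injective_iff_map_eq_zero]
      intro v hv
      have h1 := hf''.unique (hΓ'd (ε, x) (hboxW ε hε x hx))
      have h2 : f'' (0, v) = 0 := by
        have h3 := congrArg (fun L : ℝ × J m n →L[ℝ] ℝ × J m n => L (0, v)) h1
        refine h3.trans (Prod.ext rfl hv)
      have h4 := f''.injective (h2.trans (map_zero f'').symm)
      exact (Prod.ext_iff.1 h4).2
    · intro x hx
      exact ⟨1, one_ne_zero, fun v => by
        rw [(hΘ x (hboxW ε hε x hx) v).1, one_mul]⟩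
    · intro x hx v
      exact (hΘ x (hboxW ε hε x hx) v).1
    · intro x hx hxb
      have hxW := hboxW ε hε x hx
      obtain ⟨h1, h2, h3⟩ := configLE_normalForm (r := r) Metric.isOpen_ball (hslice ε)
        (fun x hx => hGC x (hBb hx)) (hAslice ε)
        (fun x hx => (hAC ε C hC hGC).1 x (hBb hx)) (hφslice ε).continuousOn
        (fun y hy => (hTφ _ hy).2.1) (fun y hy => (hTφ _ hy).2.2)
        (fun y hy => (hφT ε hεδ₁ y hy).2) hxb hxW
      refine ⟨_, hbV (hBb (hTφ _ hxW).2.1), h1, fun hx0 => ?_, h2, h3⟩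
      have h4 : forgetZ x = 0 := by rw [hx0]; rfl
      change incl (φ (ε, forgetZ x)) = 0
      rw [h4, (hφ0 ε hεδ₁).2]
      rfl
  refine ⟨Metric.ball 0 δ, δ, Γ, Metric.isOpen_ball, Metric.mem_ball_self hδ, hδ,
    hΓ.mono fun z hz => hboxW z.1 hz.1 z.2 hz.2,
    hmodel 0 ⟨neg_lt_zero.2 hδ, hδ⟩ C₀ hC₀ hGC₀, fun j hj => hmodel _ ⟨?_, hj⟩ _ (hC j) (hGC j)⟩
  have : (0 : ℝ) < (1 / 2) ^ j := by positivity
  linarith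

end Family

/-! ### Comparison of the notions of stability. -/

section Stability

variable {r : ℕ} {U : Set (J m n)}

theorem IsContactEmbedding.map_nhds_eq {C : J m n → J m n} (hC : IsContactEmbedding U C)
    (hU : IsOpen U) {x : J m n} (hx : x ∈ U) : map C (𝓝 x) = 𝓝 (C x) := by
  obtain ⟨f', hf'⟩ := hC.exists_equiv hU hx
  exact ((hC.smooth.contDiffAt (hU.mem_nhds hx)).hasStrictFDerivAt' hf'
    (by simp)).map_nhds_eq_of_equiv

/-- A contact embedding is a local diffeomorphism, so images of neighbourhoods are neighbourhoods.
Precomposition with one that preserves the strata therefore leaves configurations unchanged. -/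
theorem configLE_comp {F Φ : J m n → J m n} {O : Set (J m n)} (hΦ : IsContactEmbedding O Φ)
    (hO : IsOpen O) (hL : ∀ σ ⊆ {i : Fin n | (i : ℕ) < r}, ∀ w ∈ O, Φ w ∈ L0 r σ ↔ w ∈ L0 r σ)
    {x : J m n} (hx : x ∈ O) :
    ConfigLE r (F ∘ Φ) x F (Φ x) ∧ ConfigLE r F (Φ x) (F ∘ Φ) x := by
  constructor
  · refine configLE_of_eventually_comp (hΦ.continuousAt hO hx) rfl fun σ hσ => ?_
    filter_upwards [hO.mem_nhds hx] with w hw hwσ using ⟨(hL σ hσ w hw).2 hwσ, rfl⟩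
  · intro σ hσ W hW
    refine ⟨Φ '' (W ∩ O), ?_, ?_⟩
    · rw [← hΦ.map_nhds_eq hO hx]
      exact image_mem_map (inter_mem hW (hO.mem_nhds hx))
    · rintro _ ⟨_, ⟨hwσ, w, hw, rfl⟩, rfl⟩
      exact ⟨w, ⟨(hL σ hσ w hw.2).1 hwσ, hw.1⟩, rfl⟩

theorem eventually_eq_comp_forgetZ (hU : IsOpen U) {C : J m n → J m n} {c : J0 m n → J m n}
    (hc : Set.EqOn c (C ∘ incl) (incl ⁻¹' U)) {x : J m n} (hxU : x ∈ U) :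
    ∀ᶠ w in 𝓝 x, zc w = 0 → (c ∘ forgetZ) w = C w := by
  filter_upwards [hU.mem_nhds hxU] with w hw hz
  have h1 : forgetZ w ∈ (incl ⁻¹' U : Set (J0 m n)) := by
    rw [Set.mem_preimage, incl_forgetZ hz]; exact hw
  rw [Function.comp_apply, hc h1, Function.comp_apply, incl_forgetZ hz]

theorem extends_comp_forgetZ (hU : IsOpen U) (h0U : (0 : J m n) ∈ U) {C : J m n → J m n}
    {c : J0 m n → J m n} (hc : Set.EqOn c (C ∘ incl) (incl ⁻¹' U)) :
    Extends r (c ∘ forgetZ) C := by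
  filter_upwards [nhdsWithin_le_nhds (eventually_eq_comp_forgetZ hU hc h0U),
    self_mem_nhdsWithin] with w hw hwL using hw hwL.2.2.2

/-- Contact translation to a base point keeps 𝕃 inside 𝕃, hence inside {z = 0}, where the two maps
coincide. -/
theorem realizes_comp_forgetZ_iff (hU : IsOpen U) {C : J m n → J m n} {c : J0 m n → J m n}
    (hc : Set.EqOn c (C ∘ incl) (incl ⁻¹' U)) {ℒ : J m n → J m n} :
    Realizes r U (c ∘ forgetZ) ℒ ↔ Realizes r U C ℒ := by
  have key : ∀ x ∈ U, IsBasePoint r x → ∀ᶠ w in 𝓝[LL m n r] 0,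
      germAt (c ∘ forgetZ) x w = germAt C x w := by
    intro x hxU hx
    have hev := eventually_eq_comp_forgetZ hU hc hxU
    have h1 : Tendsto (contactTranslate x) (𝓝 0) (𝓝 x) := by
      have := (contDiff_contactTranslate x).continuous.tendsto 0
      rwa [contactTranslate_zero] at this
    filter_upwards [nhdsWithin_le_nhds (h1.eventually hev), self_mem_nhdsWithin] with w hw hwL
    rw [germAt, germAt, hw (hx.contactTranslate_mem_LL hwL).2.2.2, hev.self_of_nhds hx.2.1]
  constructor
  · rintro ⟨x, hxU, h1, h2, h3, h4, h⟩
    exact ⟨x, hxU, h1, h2, h3, h4, h.congr_left (key x hxU ⟨h1, h2, h3, h4⟩)⟩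
  · rintro ⟨x, hxU, h1, h2, h3, h4, h⟩
    refine ⟨x, hxU, h1, h2, h3, h4, h.congr_left ?_⟩
    filter_upwards [key x hxU ⟨h1, h2, h3, h4⟩] with w hw using hw.symm

/-- Stability on `{Z = 0}` implies stability. -/
theorem IsStableOverZ.isStableOver {𝒞 : Set (J m n) → Set (J m n → J m n)}
    {𝒞Z : Set (J m n) → Set (J0 m n → J m n)}
    {ext : ℕ → (J m n → J m n) → (J m n → J m n) → Prop} {ℒ : J m n → J m n}
    (h𝒞 : ∀ U, 𝒞 U ⊆ CT U) (h𝒞Z : ∀ U, ∀ C ∈ 𝒞 U, C ∘ incl ∈ 𝒞Z U)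
    (hext : ∀ f g, Extends r f g → ext r g ℒ → ext r f ℒ)
    (h : IsStableOverZ 𝒞Z ext r ℒ) : IsStableOver 𝒞 ext r ℒ := by
  intro U hU h0U C₀ hC₀ hC₀ext
  obtain ⟨N, hN, hC₀N, hreal⟩ := h U hU h0U (C₀ ∘ incl) (h𝒞Z U C₀ hC₀)
    (hext _ _ (extends_comp_forgetZ hU h0U fun _ _ => rfl) hC₀ext)
  obtain ⟨M, hM, hC₀M, hMN⟩ := exists_isOpen_cInfty_comp_mem hU (inclL m n)
    (h𝒞 U hC₀).1.smooth ((@mem_nhds_iff _ (cInfty (incl ⁻¹' U)) _ _).2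
      ⟨N, subset_rfl, hN, hC₀N⟩)
  exact ⟨M, hM, hC₀M, fun C hCM hC => (realizes_comp_forgetZ_iff hU fun _ _ => rfl).1
    (hreal _ (hMN C hCM (h𝒞 U hC).1.smooth) (h𝒞Z U C hC))⟩

theorem Extends.trans_definesConfiguration {f g ℒ : J m n → J m n} (hfg : Extends r f g)
    (h : DefinesConfiguration r g ℒ) : DefinesConfiguration r f ℒ := by
  have h1 := definesConfiguration_iff.1 hfg.definesConfiguration
  have h2 := definesConfiguration_iff.1 h
  exact definesConfiguration_iff.2 ⟨h1.1.trans h2.1, h2.2.trans h1.2⟩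

theorem Extends.trans {f g ℒ : J m n → J m n} (hfg : Extends r f g) (h : Extends r g ℒ) :
    Extends r f ℒ := by
  filter_upwards [hfg, h] with x hx hx' using hx.trans hx'

theorem IsThetaModel.definesConfiguration {U' : Set (J m n)} {F C ℒ : J m n → J m n}
    (hF : IsThetaModel r U U' F C) (h0 : (0 : J m n) ∈ U') (hC : DefinesConfiguration r C ℒ) :
    DefinesConfiguration r F ℒ := by
  obtain ⟨y, -, -, hy, h1, h2⟩ := hF.2 0 h0 isBasePoint_zero
  rw [hy rfl] at h1 h2
  have h3 := definesConfiguration_iff.1 hC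
  exact definesConfiguration_iff.2 ⟨h1.trans h3.1, h3.2.trans h2⟩

/-- Every configuration is defined by a map that preserves the contact form. -/
theorem exists_mem_CTTheta_definesConfiguration (hU : IsOpen U) (h0U : (0 : J m n) ∈ U)
    {C ℒ : J m n → J m n} (hC : C ∈ CT U) (hCℒ : DefinesConfiguration r C ℒ) :
    ∃ (U' : Set (J m n)) (D : J m n → J m n), IsOpen U' ∧ (0 : J m n) ∈ U' ∧ D ∈ CTTheta U' ∧
      DefinesConfiguration r D ℒ := by
  -- Only the slice ε = 0 matters, so the constant sequence suffices.
  obtain ⟨N, hN, h⟩ := exists_thetaModel_family r hU h0U hC (c₀ := C ∘ incl) fun _ _ => rfl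
  obtain ⟨U', -, Γ, hU', h0U', -, -, hΓ, -⟩ := h (fun _ => C) (fun _ => C ∘ incl) (fun _ => hC)
    (fun _ _ _ => rfl) fun j => @mem_of_mem_nhds _ (cInfty (incl ⁻¹' U)) _ _ (hN j)
  exact ⟨U', _, hU', h0U', hΓ.1, hΓ.definesConfiguration h0U' hCℒ⟩

/-- Stability with respect to `C_T` or `C_T^Θ`, in a sense of extension for which `ℒ` has an
extension, implies the strongest form of stability. -/
theorem IsStableOver.isStableOverZ {𝒞 : Set (J m n) → Set (J m n → J m n)}
    (h𝒞 : 𝒞 = CT ∨ 𝒞 = CTTheta) {ext : ℕ → (J m n → J m n) → (J m n → J m n) → Prop}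
    {D ℒ : J m n → J m n} {U_D : Set (J m n)} (hU_D : IsOpen U_D) (h0U_D : (0 : J m n) ∈ U_D)
    (hD : D ∈ 𝒞 U_D) (hDext : ext r D ℒ) (hDℒ : DefinesConfiguration r D ℒ)
    (hst : IsStableOver 𝒞 ext r ℒ) : IsStableOverZ CTZ DefinesConfiguration r ℒ := by
  have hsub : ∀ U, 𝒞 U ⊆ CT U := by
    rcases h𝒞 with rfl | rfl
    · exact fun U => subset_rfl
    · exact fun U C hC => hC.1
  have hmono : ∀ {O O' : Set (J m n)} {F : J m n → J m n}, F ∈ 𝒞 O → O' ⊆ O → F ∈ 𝒞 O' := by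
    rcases h𝒞 with rfl | rfl
    · exact CT.mono
    · exact CTTheta.mono
  -- The models preserve Θ, so composing them with `Φ` stays in whichever of the two classes `Φ`
  -- belongs to.
  have hcomp : ∀ {O O' : Set (J m n)} {F Φ : J m n → J m n}, F ∈ CTTheta O → IsOpen O →
      Φ ∈ 𝒞 O' → IsOpen O' → Set.MapsTo Φ O' O → F ∘ Φ ∈ 𝒞 O' := by
    rcases h𝒞 with rfl | rfl
    · exact fun hF hO hΦ hO' h => CT.comp hF.1 hO hΦ hO' h
    · exact CTTheta.comp
  intro U hU h0U c₀ ⟨C₀, hC₀, hc₀⟩ hc₀ℒ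
  have hC₀ℒ : DefinesConfiguration r C₀ ℒ := by
    refine Extends.trans_definesConfiguration ?_ hc₀ℒ
    filter_upwards [extends_comp_forgetZ (r := r) hU h0U hc₀] with x hx using hx.symm
  obtain ⟨N, hN, hfam⟩ := exists_thetaModel_family r hU h0U hC₀ hc₀
  -- Every neighbourhood of `c₀` contains a bad map, in particular each `N j`. The fast convergence
  -- is thus built into the choice of the sequence.
  by_contra! hcon
  have hseq : ∀ j, ∃ (c : J0 m n → J m n) (C : J m n → J m n), c ∈ N j ∧ C ∈ CT U ∧
      Set.EqOn c (C ∘ incl) (incl ⁻¹' U) ∧ ¬ Realizes r U (c ∘ forgetZ) ℒ := by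
    intro j
    obtain ⟨M, hMN, hM, hc₀M⟩ := (@mem_nhds_iff _ (cInfty (incl ⁻¹' U)) _ _).1 (hN j)
    obtain ⟨c, hcM, ⟨C, hC, hc⟩, hnot⟩ := hcon M hM hc₀M
    exact ⟨c, C, hMN hcM, hC, hc, hnot⟩
  choose c C hcN hC hc hnot using hseq
  obtain ⟨U', δ, Γ, hU', h0U', hδ, hΓ, hΓ₀, hΓC⟩ := hfam C c hC hc hcN
  have hΓ₀ℒ := definesConfiguration_iff.1 (hΓ₀.definesConfiguration h0U' hC₀ℒ)
  have hDℒ' := definesConfiguration_iff.1 hDℒ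
  -- `D` and Γ₀ define the same configuration, so Γ₀⁻¹ ∘ D exists near 0 and preserves the strata
  -- there.
  have hDΓ := hDℒ'.1.trans hΓ₀ℒ.2
  have hΓD := hΓ₀ℒ.1.trans hDℒ'.2
  have h0 : D 0 = Γ (0, 0) :=
    hDΓ.apply_eq (hΓ₀.1.1.1.continuousAt hU' h0U') isBasePoint_zero
  obtain ⟨O, Φ, hO, h0O, hOU, hmaps, hΦ, hΦ0, hΦCT, hΦΘ⟩ :=
    CT.exists_quotient (hsub _ hD) hU_D hΓ₀.1.1 hU' h0U_D h0U' h0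
  have hΦ𝒞 : Φ ∈ 𝒞 O := by
    rcases h𝒞 with rfl | rfl
    · exact hΦCT
    · exact hΦΘ hD hΓ₀.1
  have hΦL := eventually_mem_L0_iff_of_quotient hU' (hsub _ hD).1.injOn hΓ₀.1.1.1.injOn hO h0O
    hOU hmaps hΦ hΦ0 (hΦCT.1.continuousAt hO h0O) hDΓ hΓD
  have hall : ∀ᶠ w in 𝓝 (0 : J m n), ∀ σ : Set (Fin n), σ ⊆ {i : Fin n | (i : ℕ) < r} →
      (Φ w ∈ L0 r σ ↔ w ∈ L0 r σ) :=
    eventually_all.2 fun σ => by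
      by_cases hσ : σ ⊆ {i : Fin n | (i : ℕ) < r}
      · filter_upwards [hΦL σ hσ] with w hw _ using hw
      · exact Eventually.of_forall fun w h => absurd h hσ
  obtain ⟨W, hWL, hW, h0W⟩ := mem_nhds_iff.1 hall
  set U₁ : Set (J m n) := O ∩ W with hU₁
  have hU₁o : IsOpen U₁ := hO.inter hW
  have hU₁O : U₁ ⊆ O := Set.inter_subset_left
  have hΦU₁ : Set.MapsTo Φ U₁ U' := fun w hw => hmaps hw.1
  -- The hypothesis is applied to the extension `D`, cut down to a set on which Φ is defined and
  -- respects every stratum, since the base point it yields may be anywhere in that set.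
  obtain ⟨N₁, hN₁, hDN₁, hreal⟩ := hst U₁ hU₁o ⟨h0O, h0W⟩ D (hmono hD (hU₁O.trans hOU)) hDext
  have hsm : ContDiffOn ℝ ∞ (fun z : ℝ × J m n => Γ (z.1, Φ z.2)) (Set.Ioo (-δ) δ ×ˢ U₁) :=
    hΓ.comp (contDiff_fst.contDiffOn.prodMk ((hΦCT.1.smooth.mono hU₁O).comp
      contDiff_snd.contDiffOn fun z hz => hz.2)) fun z hz => ⟨hz.1, hΦU₁ hz.2⟩
  have hε : Tendsto (fun j : ℕ => (1 / 2 : ℝ) ^ j) atTop (𝓝 0) :=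
    tendsto_pow_atTop_nhds_zero_of_lt_one (by norm_num) (by norm_num)
  have hlim := tendsto_cInfty_of_contDiffOn hU₁o hδ hsm (D := D) (fun x hx => hΦ x hx.1) hε
  have hmem : ∀ᶠ j in atTop, (fun x => Γ ((1 / 2 : ℝ) ^ j, Φ x)) ∈ N₁ :=
    hlim ((@mem_nhds_iff _ (cInfty U₁) _ _).2 ⟨N₁, subset_rfl, hN₁, hDN₁⟩)
  obtain ⟨j, hjN, hjδ⟩ := (hmem.and (hε.eventually_lt_const hδ)).exists
  have hmodel := hΓC j hjδ
  have hF : (fun x => Γ ((1 / 2 : ℝ) ^ j, Φ x)) ∈ 𝒞 U₁ :=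
    hcomp hmodel.1 hU' (hmono hΦ𝒞 hU₁O) hU₁o hΦU₁
  obtain ⟨x, hxU₁, h1, h2, h3, h4, hx⟩ := hreal _ hjN hF
  have hxb : IsBasePoint r x := ⟨h1, h2, h3, h4⟩
  have hΦL₁ : ∀ σ ⊆ {i : Fin n | (i : ℕ) < r}, ∀ w ∈ U₁, Φ w ∈ L0 r σ ↔ w ∈ L0 r σ :=
    fun σ hσ w hw => hWL hw.2 σ hσ
  -- The base point x found for Γ_ε ∘ Φ goes to the base point Φ(x) of Γ_ε and then to a base point
  -- y of `C j`, with equal configurations at each stage.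
  have hΦx : IsBasePoint r (Φ x) := isBasePoint_of_forall_mem_L0 fun σ hσ =>
    (hΦL₁ σ hσ x hxU₁).2 (hxb.mem_L0 σ)
  obtain ⟨y, hyU, hyb, -, hle, hge⟩ := hmodel.2 _ (hΦU₁ hxU₁) hΦx
  obtain ⟨hle', hge'⟩ := configLE_comp (F := fun x => Γ ((1 / 2 : ℝ) ^ j, x))
    (hΦCT.1.mono hU₁O) hU₁o hΦL₁ hxU₁
  have hF' := hsub _ hF
  refine hnot j ((realizes_comp_forgetZ_iff hU (hc j)).2
    ⟨y, hyU, hyb.1, hyb.2.1, hyb.2.2.1, hyb.2.2.2, ?_⟩)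
  exact hx.of_configLE hU hU₁o (hC j).1 hF'.1 (hC j).2.time hF'.2.time hyU hxU₁ hyb hxb
    (hge.trans hge') (hle'.trans hle)

theorem IsStableOver.mono {𝒞 𝒞' : Set (J m n) → Set (J m n → J m n)}
    {ext ext' : ℕ → (J m n → J m n) → (J m n → J m n) → Prop} {ℒ : J m n → J m n}
    (h𝒞 : ∀ U, 𝒞' U ⊆ 𝒞 U) (hext : ∀ f, ext' r f ℒ → ext r f ℒ) (h : IsStableOver 𝒞 ext r ℒ) :
    IsStableOver 𝒞' ext' r ℒ := by
  intro U hU h0U C₀ hC₀ hC₀ext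
  obtain ⟨N, hN, hC₀N, hreal⟩ := h U hU h0U C₀ (h𝒞 U hC₀) (hext _ hC₀ext)
  exact ⟨N, hN, hC₀N, fun C hCN hC => hreal C hCN (h𝒞 U hC)⟩

theorem IsStableOverZ.mono {𝒞 𝒞' : Set (J m n) → Set (J0 m n → J m n)}
    {ext ext' : ℕ → (J m n → J m n) → (J m n → J m n) → Prop} {ℒ : J m n → J m n}
    (h𝒞 : ∀ U, 𝒞' U ⊆ 𝒞 U) (hext : ∀ f, ext' r f ℒ → ext r f ℒ) (h : IsStableOverZ 𝒞 ext r ℒ) :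
    IsStableOverZ 𝒞' ext' r ℒ := by
  intro U hU h0U C₀ hC₀ hC₀ext
  obtain ⟨N, hN, hC₀N, hreal⟩ := h U hU h0U C₀ (h𝒞 U hC₀) (hext _ hC₀ext)
  exact ⟨N, hN, hC₀N, fun C hCN hC => hreal C hCN (h𝒞 U hC)⟩

theorem CTTheta_subset_CT (U : Set (J m n)) : CTTheta U ⊆ CT U := fun _ hC => hC.1

theorem CTThetaZ_subset_CTZ (U : Set (J m n)) : CTThetaZ U ⊆ CTZ U :=
  fun _ ⟨C, hC, hc⟩ => ⟨C, hC.1, hc⟩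

theorem comp_incl_mem_CTZ {C : J m n → J m n} (hC : C ∈ CT U) : C ∘ incl ∈ CTZ U :=
  Set.mem_ofPred.2 ⟨C, hC, fun _ _ => rfl⟩

theorem comp_incl_mem_CTThetaZ {C : J m n → J m n} (hC : C ∈ CTTheta U) :
    C ∘ incl ∈ CTThetaZ U :=
  Set.mem_ofPred.2 ⟨C, hC, fun _ _ => rfl⟩

end Stability

end RetLeg

/-! ### The two cycles of implications. -/

theorem lemma4p2 (m n r : ℕ) (hr : r ≤ n) (ℒ : RetLeg.J m n → RetLeg.J m n)
    (hℒ : RetLeg.IsReticularLegendrianUnfolding r ℒ) :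
    List.TFAE
      [RetLeg.IsStableOver RetLeg.CT RetLeg.Extends r ℒ,
        RetLeg.IsStableOverZ RetLeg.CTZ RetLeg.Extends r ℒ,
        RetLeg.IsStableOver RetLeg.CT RetLeg.DefinesConfiguration r ℒ,
        RetLeg.IsStableOver RetLeg.CTTheta RetLeg.DefinesConfiguration r ℒ,
        RetLeg.IsStableOverZ RetLeg.CTZ RetLeg.DefinesConfiguration r ℒ,
        RetLeg.IsStableOverZ RetLeg.CTThetaZ RetLeg.DefinesConfiguration r ℒ] ∧
    (RetLeg.HasThetaExtension r ℒ →
      List.TFAE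
        [RetLeg.IsStableOver RetLeg.CT RetLeg.Extends r ℒ,
          RetLeg.IsStableOver RetLeg.CTTheta RetLeg.Extends r ℒ,
          RetLeg.IsStableOverZ RetLeg.CTZ RetLeg.Extends r ℒ,
          RetLeg.IsStableOverZ RetLeg.CTThetaZ RetLeg.Extends r ℒ]) := by
  obtain ⟨C, ⟨-, U, hU, h0U, hC⟩, hCℒ⟩ := hℒ
  have hstrict : ∀ f, RetLeg.Extends r f ℒ → RetLeg.DefinesConfiguration r f ℒ :=
    fun _ hf => hf.definesConfiguration
  have h15 : RetLeg.IsStableOver RetLeg.CT RetLeg.Extends r ℒ →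
      RetLeg.IsStableOverZ RetLeg.CTZ RetLeg.DefinesConfiguration r ℒ := fun h =>
    h.isStableOverZ (Or.inl rfl) hU h0U hC hCℒ hCℒ.definesConfiguration
  have h21 : RetLeg.IsStableOverZ RetLeg.CTZ RetLeg.Extends r ℒ →
      RetLeg.IsStableOver RetLeg.CT RetLeg.Extends r ℒ := fun h =>
    h.isStableOver (fun _ => subset_rfl) (fun _ _ => RetLeg.comp_incl_mem_CTZ)
      fun _ _ => RetLeg.Extends.trans
  have h52 : RetLeg.IsStableOverZ RetLeg.CTZ RetLeg.DefinesConfiguration r ℒ →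
      RetLeg.IsStableOverZ RetLeg.CTZ RetLeg.Extends r ℒ := fun h =>
    h.mono (fun _ => subset_rfl) hstrict
  constructor
  · tfae_have 1 → 5 := h15
    tfae_have 2 → 1 := h21
    tfae_have 5 → 2 := h52
    tfae_have 5 → 3 := fun h =>
      h.isStableOver (fun _ => subset_rfl) (fun _ _ => RetLeg.comp_incl_mem_CTZ)
        fun _ _ => RetLeg.Extends.trans_definesConfiguration
    tfae_have 3 → 1 := fun h => h.mono (fun _ => subset_rfl) hstrict
    tfae_have 5 → 6 := fun h => h.mono RetLeg.CTThetaZ_subset_CTZ fun _ hf => hf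
    tfae_have 6 → 4 := fun h =>
      h.isStableOver RetLeg.CTTheta_subset_CT (fun _ _ => RetLeg.comp_incl_mem_CTThetaZ)
        fun _ _ => RetLeg.Extends.trans_definesConfiguration
    -- In the wide sense a Θ-preserving extension always exists, so stability over `CTTheta` is not
    -- vacuous and no further hypothesis is needed.
    tfae_have 4 → 5 := fun h => by
      obtain ⟨U', D, hU', h0U', hD, hDℒ⟩ :=
        RetLeg.exists_mem_CTTheta_definesConfiguration hU h0U hC hCℒ.definesConfiguration
      exact h.isStableOverZ (Or.inr rfl) hU' h0U' hD hDℒ hDℒ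
    tfae_finish
  · rintro ⟨D, U', hU', h0U', hD, hDℒ⟩
    tfae_have 1 → 4 := fun h => (h15 h).mono RetLeg.CTThetaZ_subset_CTZ hstrict
    tfae_have 4 → 2 := fun h =>
      h.isStableOver RetLeg.CTTheta_subset_CT (fun _ _ => RetLeg.comp_incl_mem_CTThetaZ)
        fun _ _ => RetLeg.Extends.trans
    -- Here the strict Θ-preserving extension `D` is essential: without one, strict stability over
    -- `CTTheta` would hold vacuously.
    tfae_have 2 → 3 := fun h =>
      h52 (h.isStableOverZ (Or.inr rfl) hU' h0U' hD hDℒ hDℒ.definesConfiguration)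
    tfae_have 3 → 1 := h21
    tfae_finish
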